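/- Let $n \ge 3$ be an integer and let $(N,g_N)$ be a compact smooth Riemannian manifold (without boundary) of dimension $n-1$. Let $\bar r \in (0,\infty]$ and let $h:[0,\bar r)\to\mathbb R$ be a smooth positive function such that (H1) $h'(0)=0$ and $h''(0)>0$; (H2) $h'(r)>0$ for all $r\in(0,\bar r)$. Let $M=N\times[0,\bar r)$ be equipped with the Riemannian metric $g=dr\otimes dr+h(r)^2\,g_N$, write $\langle\cdot,\cdot\rangle$ for $g$, and define $f=h'(r)$ and $X=h(r)\,\frac{\partial}{\partial r}$ on $M$. Let $\Sigma$ be a closed (compact, without boundary) orientable smooth hypersurface, possibly only immersed, in $(M,g)$, with unit normal $\nu$, induced Riemannian measure $\mu$, and mean curvature $H$, i.e. the trace with respect to the induced metric of the second fundamental form $I\!I(v,w)=\langle D_v\nu,w\rangle$, where $D$ is the Levi-Civita connection of $g$. Then $\mu(\Sigma)<\infty$, the functions $H\,\langle X,\nu\rangle$ and $f$ are $\mu$-integrable on $\Sigma$, and $$\int_\Sigma H\,\langle X,\nu\rangle\,d\mu=(n-1)\int_\Sigma f\,d\mu .$$ Moreover, let $r_1\in(0,\bar r)$ be a real number such that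 $h''(r)>0$ for all $r\in[0,r_1]$. If $\Sigma$ is contained in $N\times(0,r_1)$, then $\frac{H}{f}\,\langle X,\nu\rangle$ is $\mu$-integrable on $\Sigma$ and $$\int_\Sigma \frac{H}{f}\,\langle X,\nu\rangle\,d\mu\le (n-1)\,\mu(\Sigma).$$ -/

import Mathlib

open scoped Manifold ContDiff
open MeasureTheory

noncomputable section

/-! ### Riemannian notions in charts

`g` assigns to each point `p` of a manifold a bilinear form on the tangent space at `p`.
Recall that Mathlib's `TangentSpace I p` is a copy of the model space `E`: a tangent vector at `p`
is given by its components in the chart `extChartAt I p`. -/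

section Charts

variable {E : Type*} [NormedAddCommGroup E] [NormedSpace ℝ E] {H : Type*} [TopologicalSpace H]
  (I : ModelWithCorners ℝ E H) {M : Type*} [TopologicalSpace M] [ChartedSpace H M]

/-- The component `g_{vw}(x)` of `g` in the chart around `p`, at the point of `M` with coordinates
`x`, in the coordinate directions `v` and `w`. -/
def metricInChart (g : ∀ p : M, TangentSpace I p → TangentSpace I p → ℝ) (p : M)
    (x v w : E) : ℝ :=
  g ((extChartAt I p).symm x)
    (mfderiv 𝓘(ℝ, E) I (extChartAt I p).symm x v)
    (mfderiv 𝓘(ℝ, E) I (extChartAt I p).symm x w)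

/-- The Christoffel symbol of the first kind of the metric `g` at `p`, in the chart around `p`:
`Γ(u, v; w) = (∂_u g_{vw} + ∂_v g_{uw} - ∂_w g_{uv}) / 2`, which is `g(D_u v, w)` for the
Levi-Civita connection `D` and the constant coordinate fields `u`, `v`, `w`. The metric is only
considered on the part `D` of the manifold (one-sided derivatives are taken at its boundary). -/
def christoffelFirst (g : ∀ p : M, TangentSpace I p → TangentSpace I p → ℝ) (D : Set M) (p : M)
    (u v w : E) : ℝ :=
  let A : Set E := (extChartAt I p).target ∩ (extChartAt I p).symm ⁻¹' D
  let x₀ : E := extChartAt I p p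
  (fderivWithin ℝ (fun x => metricInChart I g p x v w) A x₀ u
    + fderivWithin ℝ (fun x => metricInChart I g p x u w) A x₀ v
    - fderivWithin ℝ (fun x => metricInChart I g p x u v) A x₀ w) / 2

end Charts

/-- The Gram matrix `Q(e_i, e_j)` of `Q` in the standard basis of `ℝ^m`. -/
def gramMatrix {m : ℕ} (Q : EuclideanSpace ℝ (Fin m) → EuclideanSpace ℝ (Fin m) → ℝ) :
    Matrix (Fin m) (Fin m) ℝ :=
  Matrix.of fun i j => Q (EuclideanSpace.single i 1) (EuclideanSpace.single j 1)

/-- The trace `∑ Q^{ij} B_{ij}` of a bilinear form `B` on `ℝ^m` with respect to the inner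
product `Q`. -/
def traceWithRespectTo {m : ℕ}
    (Q B : EuclideanSpace ℝ (Fin m) → EuclideanSpace ℝ (Fin m) → ℝ) : ℝ :=
  ∑ i, ∑ j, (gramMatrix Q)⁻¹ i j * gramMatrix B i j

/-! ### The Riemannian measure -/

section RiemannianMeasure

variable {m : ℕ} {S : Type*} [TopologicalSpace S] [ChartedSpace (EuclideanSpace ℝ (Fin m)) S]
  [MeasurableSpace S]

/-- The Riemannian measure `√(det g_{ij}) dx` in the chart around `s`, seen as a measure on the
manifold which is concentrated on the domain of that chart. -/
def chartMeasure (g : ∀ s : S, TangentSpace (𝓡 m) s → TangentSpace (𝓡 m) s → ℝ) (s : S) :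
    Measure S :=
  ((volume.restrict (extChartAt (𝓡 m) s).target).withDensity fun x =>
    ENNReal.ofReal (Real.sqrt (gramMatrix (metricInChart (𝓡 m) g s x)).det)).map
      (extChartAt (𝓡 m) s).symm

/-- The Riemannian measure of `g`. The measures `chartMeasure g s` agree on the overlaps of the
chart domains; the least measure above all of them is the one which restricts to
`chartMeasure g s` on the domain of the chart around `s`, for each `s`. -/
def riemannianMeasure (g : ∀ s : S, TangentSpace (𝓡 m) s → TangentSpace (𝓡 m) s → ℝ) :
    Measure S :=
  ⨆ s : S, chartMeasure g s

end RiemannianMeasure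

/-! ### Immersed hypersurfaces -/

section Immersions

variable {E : Type*} [NormedAddCommGroup E] [NormedSpace ℝ E] {H : Type*} [TopologicalSpace H]
  (I : ModelWithCorners ℝ E H) {M : Type*} [TopologicalSpace M] [ChartedSpace H M]
  (m : ℕ) {S : Type*} [TopologicalSpace S] [ChartedSpace (EuclideanSpace ℝ (Fin m)) S]

/-- The metric on `S` induced by `F : S → M`, i.e. the pull-back of `g` under `F`. -/
def inducedMetric (g : ∀ p : M, TangentSpace I p → TangentSpace I p → ℝ) (F : S → M) (s : S)
    (v w : TangentSpace (𝓡 m) s) : ℝ :=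
  g (F s) (mfderiv (𝓡 m) I F s v) (mfderiv (𝓡 m) I F s w)

/-- `ν` is a field of unit normal vectors along `F`. -/
def IsUnitNormal (g : ∀ p : M, TangentSpace I p → TangentSpace I p → ℝ) (F : S → M)
    (ν : ∀ s : S, TangentSpace I (F s)) : Prop :=
  ∀ s : S, g (F s) (ν s) (ν s) = 1 ∧
    ∀ v : TangentSpace (𝓡 m) s, g (F s) (mfderiv (𝓡 m) I F s v) (ν s) = (0 : ℝ)

/-- The product `⟨D_v (dF(w)), ξ⟩` at `F s`, for the Levi-Civita connection `D` of `g` and the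
constant coordinate fields `v`, `w` around `s`. In coordinates,
`D_v (dF(w)) = ∂_v ∂_w F + Γ(∂_v F, ∂_w F)`. -/
def covariantSecondDerivative (g : ∀ p : M, TangentSpace I p → TangentSpace I p → ℝ) (D : Set M)
    (F : S → M) (s : S) (v w : EuclideanSpace ℝ (Fin m)) (ξ : TangentSpace I (F s)) : ℝ :=
  let Floc : EuclideanSpace ℝ (Fin m) → E := writtenInExtChartAt (𝓡 m) I s F
  let y₀ : EuclideanSpace ℝ (Fin m) := extChartAt (𝓡 m) s s
  g (F s) (fderiv ℝ (fun y => fderiv ℝ Floc y w) y₀ v) ξ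
    + christoffelFirst I g D (F s) (fderiv ℝ Floc y₀ v) (fderiv ℝ Floc y₀ w) ξ

/-- The second fundamental form with respect to the unit normal `ν`, with the sign convention
`II(v, w) = ⟨D_v ν, w⟩ = - ⟨D_v (dF(w)), ν⟩`. -/
def secondFundamentalForm (g : ∀ p : M, TangentSpace I p → TangentSpace I p → ℝ) (D : Set M)
    (F : S → M) (ν : ∀ s : S, TangentSpace I (F s)) (s : S) (v w : EuclideanSpace ℝ (Fin m)) :
    ℝ :=
  -covariantSecondDerivative I m g D F s v w (ν s)

/-- The mean curvature with respect to the unit normal `ν`: the trace of the second fundamental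
form with respect to the induced metric. -/
def meanCurvature (g : ∀ p : M, TangentSpace I p → TangentSpace I p → ℝ) (D : Set M)
    (F : S → M) (ν : ∀ s : S, TangentSpace I (F s)) (s : S) : ℝ :=
  traceWithRespectTo (inducedMetric I m g F s) (secondFundamentalForm I m g D F ν s)

end Immersions

/-! ### Warped products -/

/-- The half-open interval `[0, rbar)`, where `rbar` may be infinite. -/
def radialInterval (rbar : EReal) : Set ℝ := {r : ℝ | 0 ≤ r ∧ (r : EReal) < rbar}

/-- The first derivative of a function on `[0, rbar)` (one-sided at `0`). -/
def radialDeriv (rbar : EReal) (h : ℝ → ℝ) : ℝ → ℝ := derivWithin h (radialInterval rbar)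

section Warped

variable {m : ℕ} {N : Type*} [TopologicalSpace N] [ChartedSpace (EuclideanSpace ℝ (Fin m)) N]

/-- The metric `dr ⊗ dr + h(r)² g_N` at the point `p = (y, r)`, where the tangent space
is `T_y N × ℝ`. -/
def warpedMetric
    (gN : Bundle.RiemannianMetric (fun y : N => TangentSpace (𝓡 m) y)) (h : ℝ → ℝ) (p : N × ℝ)
    (v w : TangentSpace ((𝓡 m).prod 𝓘(ℝ, ℝ)) p) : ℝ :=
  v.2 * w.2 + h p.2 ^ 2 * gN.inner p.1 v.1 w.1

/-- The vector field `X = h(r) ∂_r`. -/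
def radialField (h : ℝ → ℝ) (p : N × ℝ) : TangentSpace ((𝓡 m).prod 𝓘(ℝ, ℝ)) p :=
  ((0 : EuclideanSpace ℝ (Fin m)), h p.2)

/-- The set `N × [0, rbar)`, as a part of `N × ℝ`. -/
def warpedDomain (N : Type*) (rbar : EReal) : Set (N × ℝ) := {p | p.2 ∈ radialInterval rbar}

end Warped

end

open scoped Manifold ContDiff
open MeasureTheory

noncomputable section

/-! ### Derivatives of determinants and inverse matrices -/

section MatrixCalculus

variable {m : ℕ}

/-! The field X = h ∂_r is conformal: D_v X = h'(r) v = f v for every tangent vector v. Let X^T = X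
- ⟨X, ν⟩ ν be its tangential part along Σ. Taking the trace over the tangent space gives div_Σ X^T =
(n-1) f - H ⟨X, ν⟩, and the divergence theorem on the closed manifold Σ yields the integral
identity.

For the inequality, X^T = h ∇r on Σ, so div_Σ(φ(r) X^T) = φ(r) div_Σ X^T + φ'(r) h |∇r|². For φ =
1/h' one has φ' = -h''/h'² ≤ 0 wherever h'' > 0. Integration then gives 0 ≤ ∫ (1/f) div_Σ X^T =
(n-1) μ(Σ) - ∫ (H/f) ⟨X, ν⟩.

The argument runs in coordinates. `sum_fderiv_sqrt_det_mul_inv` writes the divergence of a vector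
field through Christoffel symbols. `divergence_radialField_tangential` combines it with the
conformality of X and the splitting of X into X^T and its normal part. Mean curvature is defined at
each point in the chart around that point; `meanCurvature_eq_trace` moves it to a fixed chart.
`riemannianMeasure_restrict_source` identifies the measure in a chart, and
`integral_divergence_eq_zero` is the divergence theorem, proved with a partition of unity.

Since Σ may touch r = 0, where only one-sided derivatives exist, h is replaced by k(r) = h(max r 0).
This is C¹ because h'(0) = 0, and C¹ suffices because only first derivatives of the ambient metric
occur. -/

theorem hasDerivAt_matrix_det {A : ℝ → Matrix (Fin m) (Fin m) ℝ} {A' : Matrix (Fin m) (Fin m) ℝ}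
    {t : ℝ} (hA : ∀ i j, HasDerivAt (fun t => A t i j) (A' i j) t) :
    HasDerivAt (fun t => (A t).det) (∑ i, ∑ j, (A t).adjugate i j * A' j i) t := by
  have h1 : HasDerivAt (fun t => (A t).det)
      (∑ σ : Equiv.Perm (Fin m), ((Equiv.Perm.sign σ : ℤ) : ℝ) *
        ∑ i, (∏ j ∈ Finset.univ.erase i, A t (σ j) j) * A' (σ i) i) t := by
    simp only [Matrix.det_apply']
    refine HasDerivAt.fun_sum fun σ _ => ?_
    refine HasDerivAt.const_mul _ ?_
    simpa using HasDerivAt.fun_finsetProd (u := Finset.univ) (fun i _ => hA (σ i) i)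
  convert h1 using 1
  -- Cramer's rule: the i-th diagonal entry of adj(A) A' is the determinant of A with its i-th
  -- column differentiated.
  have h2 : ∀ i, ∑ j, (A t).adjugate i j * A' j i = ((A t).updateCol i fun j => A' j i).det := by
    intro i
    rw [← Matrix.cramer_apply, Matrix.cramer_eq_adjugate_mulVec]
    rfl
  simp only [h2, Matrix.det_apply', Finset.mul_sum]
  rw [Finset.sum_comm]
  refine Finset.sum_congr rfl fun σ _ => Finset.sum_congr rfl fun i _ => ?_
  congr 1
  rw [← Finset.prod_erase_mul _ _ (Finset.mem_univ i)]
  congr 1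
  · refine Finset.prod_congr rfl fun j hj => ?_
    simp [Finset.ne_of_mem_erase hj]
  · simp

variable {E : Type*} [NormedAddCommGroup E] [NormedSpace ℝ E]

theorem contDiffAt_matrix_det {k : WithTop ℕ∞} {A : E → Matrix (Fin m) (Fin m) ℝ} {x : E}
    (hA : ∀ i j, ContDiffAt ℝ k (fun x => A x i j) x) :
    ContDiffAt ℝ k (fun x => (A x).det) x := by
  simp only [Matrix.det_apply']
  exact ContDiffAt.sum fun σ _ => contDiffAt_const.mul (contDiffAt_prod fun i _ => hA _ _)

theorem contDiffAt_matrix_inv {k : WithTop ℕ∞} {A : E → Matrix (Fin m) (Fin m) ℝ} {x : E}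
    (hA : ∀ i j, ContDiffAt ℝ k (fun x => A x i j) x) (h0 : (A x).det ≠ 0) (i j : Fin m) :
    ContDiffAt ℝ k (fun x => (A x)⁻¹ i j) x := by
  simp only [Matrix.inv_def, Ring.inverse_eq_inv', Matrix.smul_apply, smul_eq_mul,
    Matrix.adjugate_apply]
  refine ((contDiffAt_matrix_det hA).inv h0).mul (contDiffAt_matrix_det fun a b => ?_)
  by_cases h : a = j
  · subst h
    simpa using contDiffAt_const
  · simpa [Matrix.updateRow_apply, h] using hA a b

/-- If `B = A⁻¹` near `t` and `B` is differentiable, then `B' = -B A' B`. -/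
theorem hasDerivAt_matrix_inv {A : ℝ → Matrix (Fin m) (Fin m) ℝ} {A' : Matrix (Fin m) (Fin m) ℝ}
    {t : ℝ} (hA : ∀ i j, HasDerivAt (fun t => A t i j) (A' i j) t) (h0 : (A t).det ≠ 0)
    (i j : Fin m) :
    HasDerivAt (fun t => (A t)⁻¹ i j) (-((A t)⁻¹ * A' * (A t)⁻¹) i j) t := by
  have hd : ∀ i j, DifferentiableAt ℝ (fun t => (A t)⁻¹ i j) t := by
    intro i j
    simp only [Matrix.inv_def, Ring.inverse_eq_inv', Matrix.smul_apply, smul_eq_mul,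
      Matrix.adjugate_apply]
    refine ((hasDerivAt_matrix_det hA).differentiableAt.inv h0).mul ?_
    have : ∀ a b, HasDerivAt (fun t => (A t).updateRow j (Pi.single i 1) a b)
        (if a = j then 0 else A' a b) t := by
      intro a b
      by_cases h : a = j
      · subst h
        simpa using hasDerivAt_const t _
      · simpa [Matrix.updateRow_apply, h] using hA a b
    exact (hasDerivAt_matrix_det (A' := Matrix.of fun a b => if a = j then 0 else A' a b)
      this).differentiableAt
  set B' : Matrix (Fin m) (Fin m) ℝ := Matrix.of fun i j => deriv (fun t => (A t)⁻¹ i j) t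
  have hB : ∀ i j, HasDerivAt (fun t => (A t)⁻¹ i j) (B' i j) t := fun i j => (hd i j).hasDerivAt
  -- The formula comes from differentiating A A⁻¹ = 1. This identity holds only where det A ≠ 0,
  -- hence as an equality of germs at t.
  have hev : ∀ᶠ s in nhds t, (A s).det ≠ 0 :=
    (hasDerivAt_matrix_det hA).continuousAt.eventually_ne h0
  have hu : IsUnit (A t).det := isUnit_iff_ne_zero.mpr h0
  have key : A' * (A t)⁻¹ + A t * B' = 0 := by
    ext i j
    have h1 : HasDerivAt (fun s => (A s * (A s)⁻¹) i j) ((A' * (A t)⁻¹ + A t * B') i j) t := by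
      simp only [Matrix.mul_apply, Matrix.add_apply, ← Finset.sum_add_distrib]
      exact HasDerivAt.fun_sum fun k _ => (hA i k).mul (hB k j)
    have h2 : HasDerivAt (fun s => (A s * (A s)⁻¹) i j) 0 t := by
      refine (hasDerivAt_const t ((1 : Matrix (Fin m) (Fin m) ℝ) i j)).congr_of_eventuallyEq ?_
      filter_upwards [hev] with s hs
      rw [Matrix.mul_nonsing_inv _ (isUnit_iff_ne_zero.mpr hs)]
    simpa using h1.unique h2
  have : B' = -((A t)⁻¹ * A' * (A t)⁻¹) := by
    have h3 : (A t)⁻¹ * (A' * (A t)⁻¹ + A t * B') = 0 := by rw [key, mul_zero]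
    rw [mul_add, ← mul_assoc, Matrix.nonsing_inv_mul_cancel_left _ _ hu] at h3
    exact eq_neg_of_add_eq_zero_right h3
  have h4 := hB i j
  rw [this] at h4
  exact h4

end MatrixCalculus

/-! ### The Laplacian in coordinates -/

section Laplacian

variable {m : ℕ}

/-- In coordinates, `∂_i (√γ γ^{ij} a_j) = √γ γ^{ij} (∂_i a_j - Γ_{ijk} γ^{kl} a_l)`. -/
theorem sum_fderiv_sqrt_det_mul_inv {γ : EuclideanSpace ℝ (Fin m) → Matrix (Fin m) (Fin m) ℝ}
    {a : Fin m → EuclideanSpace ℝ (Fin m) → ℝ}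
    {x : EuclideanSpace ℝ (Fin m)} (hγ : ∀ i j, ContDiffAt ℝ 1 (fun x => γ x i j) x)
    (hdet : 0 < (γ x).det)
    (hsymm : ∀ x i j, γ x i j = γ x j i) (ha : ∀ j, DifferentiableAt ℝ (a j) x)
    {Γ : Fin m → Fin m → Fin m → ℝ}
    (hΓ : ∀ i j k, Γ i j k = (fderiv ℝ (fun x => γ x j k) x (EuclideanSpace.single i 1)
      + fderiv ℝ (fun x => γ x i k) x (EuclideanSpace.single j 1)
      - fderiv ℝ (fun x => γ x i j) x (EuclideanSpace.single k 1)) / 2) :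
    ∑ i, fderiv ℝ (fun x => √(γ x).det * ∑ j, (γ x)⁻¹ i j * a j x) x (EuclideanSpace.single i 1) =
      √(γ x).det * ∑ i, ∑ j, (γ x)⁻¹ i j *
        (fderiv ℝ (a j) x (EuclideanSpace.single i 1) - ∑ k, ∑ l, Γ i j k * (γ x)⁻¹ k l * a l x) := by
  set d : Fin m → Matrix (Fin m) (Fin m) ℝ := fun i =>
    Matrix.of fun j k => fderiv ℝ (fun x => γ x j k) x (EuclideanSpace.single i 1) with hd
  set B := (γ x)⁻¹ with hB
  have hne : (γ x).det ≠ 0 := hdet.ne'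
  have hBsymm : ∀ i j, B i j = B j i := by
    have : (γ x).transpose = γ x := by ext i j; exact hsymm x j i
    intro i j
    have h2 : B.transpose = B := by rw [hB, Matrix.transpose_nonsing_inv, this]
    conv_lhs => rw [← h2]
    rfl
  have hdsymm : ∀ i j k, d i j k = d i k j := by
    intro i j k
    simp only [hd, Matrix.of_apply]
    simp only [hsymm _ j k]
  -- Restriction to the coordinate line x + t e_i reduces everything to the one-variable formulas
  -- for determinants and inverses.
  have hline : ∀ i j k, HasDerivAt (fun t : ℝ => γ (x + t • EuclideanSpace.single i 1) j k)
      (d i j k) 0 := by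
    intro i j k
    exact ((hγ j k).differentiableAt one_ne_zero).hasFDerivAt.hasLineDerivAt
      (EuclideanSpace.single i 1)
  have key : ∀ i, fderiv ℝ (fun x => √(γ x).det * ∑ j, (γ x)⁻¹ i j * a j x) x
      (EuclideanSpace.single i 1) = √(γ x).det *
        ((∑ p, ∑ q, B p q * d i q p) / 2 * ∑ j, B i j * a j x +
          ∑ j, (-(B * d i * B) i j * a j x +
            B i j * fderiv ℝ (a j) x (EuclideanSpace.single i 1))) := by
    intro i
    have hdiff : DifferentiableAt ℝ (fun x => √(γ x).det * ∑ j, (γ x)⁻¹ i j * a j x) x := by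
      refine DifferentiableAt.mul ?_ ?_
      · exact ((contDiffAt_matrix_det hγ).differentiableAt one_ne_zero).sqrt hne
      · exact DifferentiableAt.fun_sum fun j _ =>
          ((contDiffAt_matrix_inv hγ hne i j).differentiableAt one_ne_zero).mul (ha j)
    have h1 := hdiff.hasFDerivAt.hasLineDerivAt (EuclideanSpace.single i 1)
    refine h1.unique ?_
    have e0 : x + (0 : ℝ) • EuclideanSpace.single i (1 : ℝ) = x := by simp
    have hde := hasDerivAt_matrix_det (hline i)
    have hinv := fun j => hasDerivAt_matrix_inv (hline i) (by rw [e0]; exact hne) i j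
    have haj := fun j => (ha j).hasFDerivAt.hasLineDerivAt (EuclideanSpace.single i 1)
    have h2 := (hde.sqrt (by rw [e0]; exact hne)).mul
      (HasDerivAt.fun_sum (u := Finset.univ) fun j _ => (hinv j).mul (haj j))
    simp only [e0, Pi.mul_apply] at h2
    refine HasDerivAt.congr_deriv h2 ?_
    -- With this, Jacobi's formula becomes ∂_i √(det γ) = ½ √(det γ) tr(γ⁻¹ ∂_i γ).
    have hadj : (γ x).adjugate = (γ x).det • B := by
      rw [hB, Matrix.inv_def, Ring.inverse_eq_inv', smul_smul, mul_inv_cancel₀ hne, one_smul]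
    rw [mul_add, hadj]
    congr 1
    have hs : √(γ x).det ≠ 0 := (Real.sqrt_pos.mpr hdet).ne'
    have : (γ x).det = √(γ x).det * √(γ x).det := (Real.mul_self_sqrt hdet.le).symm
    simp only [Matrix.smul_apply, smul_eq_mul, mul_assoc, ← Finset.mul_sum]
    rw [← mul_assoc]
    rw [div_mul_eq_mul_div, div_eq_iff (by positivity)]
    linear_combination ((∑ p, ∑ q, B p q * d i q p) * ∑ j, B i j * a j x) * this
  rw [Finset.sum_congr rfl fun i _ => key i, ← Finset.mul_sum]
  congr 1
  have hG : ∀ i j k, Γ i j k = (d i j k + d j i k - d k i j) / 2 := hΓ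
  simp only [hG, Matrix.mul_apply, mul_sub, Finset.sum_add_distrib, Finset.sum_sub_distrib]
  -- Matching of the terms: the derivative of √det is the contraction of ∂_k γ_{ij} (`e1`), and the
  -- derivative of γ⁻¹ is minus the contraction of ∂_i γ_{jk} (`e2`). The terms ∂_i γ_{jk} and ∂_j
  -- γ_{ik} of Γ contract equally because γ⁻¹ is symmetric (`e3`).
  have e1 : ∑ i, (∑ p, ∑ q, B p q * d i q p) / 2 * ∑ j, B i j * a j x
      = ∑ i, ∑ j, ∑ k, ∑ l, B i j * (d k i j / 2 * B k l * a l x) := by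
    have : ∀ i, ∑ j, ∑ k, ∑ l, B i j * (d k i j / 2 * B k l * a l x) =
        ∑ k, ∑ j, ∑ l, B i j * (d k i j / 2 * B k l * a l x) := fun i => Finset.sum_comm
    rw [Finset.sum_congr rfl fun i _ => this i, Finset.sum_comm]
    refine Finset.sum_congr rfl fun i _ => ?_
    rw [Finset.sum_div, Finset.sum_mul]
    refine Finset.sum_congr rfl fun p _ => ?_
    rw [Finset.sum_div, Finset.sum_mul]
    refine Finset.sum_congr rfl fun q _ => ?_
    rw [Finset.mul_sum]
    refine Finset.sum_congr rfl fun j _ => ?_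
    rw [hdsymm i q p]
    ring
  have e2 : ∑ i, ∑ j, -(∑ p, (∑ q, B i q * d i q p) * B p j) * a j x
      = -∑ i, ∑ j, ∑ k, ∑ l, B i j * (d i j k * B k l * a l x) := by
    rw [← Finset.sum_neg_distrib]
    refine Finset.sum_congr rfl fun i _ => ?_
    have : ∑ j, ∑ k, ∑ l, B i j * (d i j k * B k l * a l x) =
        ∑ l, ∑ k, ∑ j, B i j * (d i j k * B k l * a l x) := by
      rw [Finset.sum_comm, Finset.sum_congr rfl fun k _ => Finset.sum_comm, Finset.sum_comm]
    rw [this, ← Finset.sum_neg_distrib]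
    refine Finset.sum_congr rfl fun j _ => ?_
    simp only [neg_mul, Finset.sum_mul]
    congr 1
    refine Finset.sum_congr rfl fun p _ => Finset.sum_congr rfl fun q _ => ?_
    ring
  have e3 : ∑ i, ∑ j, ∑ k, ∑ l, B i j * (d j i k * B k l * a l x) =
      ∑ i, ∑ j, ∑ k, ∑ l, B i j * (d i j k * B k l * a l x) := by
    rw [Finset.sum_comm]
    refine Finset.sum_congr rfl fun i _ => Finset.sum_congr rfl fun j _ => ?_
    rw [hBsymm]
  have e4 : ∑ i, ∑ j, B i j * ∑ k, ∑ l, (d i j k + d j i k - d k i j) / 2 * B k l * a l x =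
      ((∑ i, ∑ j, ∑ k, ∑ l, B i j * (d i j k * B k l * a l x)) +
        ∑ i, ∑ j, ∑ k, ∑ l, B i j * (d j i k * B k l * a l x)) / 2 -
      ∑ i, ∑ j, ∑ k, ∑ l, B i j * (d k i j / 2 * B k l * a l x) := by
    rw [← Finset.sum_add_distrib, Finset.sum_div, ← Finset.sum_sub_distrib]
    refine Finset.sum_congr rfl fun i _ => ?_
    rw [← Finset.sum_add_distrib, Finset.sum_div, ← Finset.sum_sub_distrib]
    refine Finset.sum_congr rfl fun j _ => ?_
    rw [← Finset.sum_add_distrib, Finset.sum_div, ← Finset.sum_sub_distrib, Finset.mul_sum]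
    refine Finset.sum_congr rfl fun k _ => ?_
    rw [← Finset.sum_add_distrib, Finset.sum_div, ← Finset.sum_sub_distrib, Finset.mul_sum]
    refine Finset.sum_congr rfl fun l _ => ?_
    ring
  rw [e1, e2, e4, e3]
  ring

end Laplacian

/-! ### Gram matrices and traces -/

section Gram

variable {m : ℕ}

theorem bilin_apply_eq_sum (Q : EuclideanSpace ℝ (Fin m) →L[ℝ] EuclideanSpace ℝ (Fin m) →L[ℝ] ℝ)
    (v w : EuclideanSpace ℝ (Fin m)) :
    Q v w = ∑ i, ∑ j, v i * w j * gramMatrix (fun v w => Q v w) i j := by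
  have h : ∀ v : EuclideanSpace ℝ (Fin m), v = ∑ i, v i • EuclideanSpace.single i (1 : ℝ) := by
    intro v
    have := (EuclideanSpace.basisFun (Fin m) ℝ).sum_repr v
    simpa using this.symm
  conv_lhs => rw [h v, h w]
  simp only [map_sum, map_smul, sum_apply, smul_apply,
    smul_eq_mul, gramMatrix, Matrix.of_apply]
  rw [Finset.sum_comm]
  simp only [Finset.mul_sum]
  refine Finset.sum_congr rfl fun i _ => Finset.sum_congr rfl fun j _ => ?_
  ring

theorem gramMatrix_posDef {Q : EuclideanSpace ℝ (Fin m) →L[ℝ] EuclideanSpace ℝ (Fin m) →L[ℝ] ℝ}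
    (hs : ∀ v w, Q v w = Q w v)
    (hpos : ∀ v, v ≠ 0 → 0 < Q v v) : (gramMatrix fun v w => Q v w).PosDef := by
  refine Matrix.PosDef.of_dotProduct_mulVec_pos ?_ ?_
  · ext i j
    simp [gramMatrix, hs (EuclideanSpace.single i 1)]
  · intro x hx
    have h1 := hpos (WithLp.toLp 2 x) (by simpa using hx)
    rw [bilin_apply_eq_sum] at h1
    refine h1.trans_le (le_of_eq ?_)
    simp only [dotProduct, Matrix.mulVec, Finset.mul_sum]
    refine Finset.sum_congr rfl fun i _ => Finset.sum_congr rfl fun j _ => ?_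
    simp
    ring

/-- The matrix of a linear map in the standard basis. -/
def stdMatrix (T : EuclideanSpace ℝ (Fin m) →L[ℝ] EuclideanSpace ℝ (Fin m)) :
    Matrix (Fin m) (Fin m) ℝ :=
  Matrix.of fun i j => T (EuclideanSpace.single j 1) i

theorem det_stdMatrix (T : EuclideanSpace ℝ (Fin m) →L[ℝ] EuclideanSpace ℝ (Fin m)) :
    (stdMatrix T).det = T.det := by
  rw [ContinuousLinearMap.det,
    ← LinearMap.det_toMatrix (EuclideanSpace.basisFun (Fin m) ℝ).toBasis]
  congr 1

theorem gramMatrix_comp (Q : EuclideanSpace ℝ (Fin m) →L[ℝ] EuclideanSpace ℝ (Fin m) →L[ℝ] ℝ)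
    (T : EuclideanSpace ℝ (Fin m) →L[ℝ] EuclideanSpace ℝ (Fin m)) :
    gramMatrix (fun v w => Q (T v) (T w)) =
      (stdMatrix T).transpose * gramMatrix (fun v w => Q v w) * stdMatrix T := by
  ext i j
  rw [gramMatrix, Matrix.of_apply, bilin_apply_eq_sum]
  simp only [Matrix.mul_apply, Matrix.transpose_apply, Finset.sum_mul]
  rw [Finset.sum_comm]
  refine Finset.sum_congr rfl fun i _ => Finset.sum_congr rfl fun j _ => ?_
  simp only [stdMatrix, Matrix.of_apply]
  ring

theorem traceWithRespectTo_eq_trace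
    (Q B : EuclideanSpace ℝ (Fin m) → EuclideanSpace ℝ (Fin m) → ℝ) :
    traceWithRespectTo Q B = ((gramMatrix Q)⁻¹ * (gramMatrix B).transpose).trace := by
  simp [traceWithRespectTo, Matrix.trace, Matrix.mul_apply]

/-- The trace with respect to an inner product does not depend on the basis. -/
theorem traceWithRespectTo_comp
    (Q B : EuclideanSpace ℝ (Fin m) →L[ℝ] EuclideanSpace ℝ (Fin m) →L[ℝ] ℝ)
    {T : EuclideanSpace ℝ (Fin m) →L[ℝ] EuclideanSpace ℝ (Fin m)} (hT : T.det ≠ 0) :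
    traceWithRespectTo (fun v w => Q (T v) (T w)) (fun v w => B (T v) (T w)) =
      traceWithRespectTo (fun v w => Q v w) (fun v w => B v w) := by
  have hu : IsUnit (stdMatrix T).det := by
    rw [det_stdMatrix]; exact isUnit_iff_ne_zero.mpr hT
  rw [traceWithRespectTo_eq_trace, traceWithRespectTo_eq_trace, gramMatrix_comp, gramMatrix_comp]
  set A := stdMatrix T
  have hut : IsUnit A.transpose.det := by rwa [Matrix.det_transpose]
  simp only [Matrix.mul_inv_rev, Matrix.transpose_mul, Matrix.transpose_transpose, mul_assoc]
  rw [Matrix.nonsing_inv_mul_cancel_left _ _ hut, Matrix.trace_mul_comm]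
  simp only [mul_assoc]
  rw [Matrix.mul_nonsing_inv _ hu, mul_one]

theorem traceWithRespectTo_self {Q : EuclideanSpace ℝ (Fin m) → EuclideanSpace ℝ (Fin m) → ℝ}
    (hs : ∀ v w, Q v w = Q w v)
    (h : (gramMatrix Q).det ≠ 0) : traceWithRespectTo Q Q = m := by
  rw [traceWithRespectTo_eq_trace]
  have : (gramMatrix Q).transpose = gramMatrix Q := by
    ext i j
    simp [gramMatrix, hs (EuclideanSpace.single i 1)]
  rw [this, Matrix.nonsing_inv_mul _ (isUnit_iff_ne_zero.mpr h)]
  simp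

end Gram

/-! ### Hypersurfaces in coordinates -/

section LocalGeometry

variable {m : ℕ} {V : Type*} [NormedAddCommGroup V] [NormedSpace ℝ V]

/-- The product `⟨D_v (dG(w)), ξ⟩` at `x`, for the Levi-Civita connection of the metric `b`. -/
def covHessian (b : V → V →L[ℝ] V →L[ℝ] ℝ) (G : EuclideanSpace ℝ (Fin m) → V)
    (x v w : EuclideanSpace ℝ (Fin m)) : V →L[ℝ] ℝ :=
  b (G x) (fderiv ℝ (fderiv ℝ G) x v w) + (2⁻¹ : ℝ) •
    (fderiv ℝ b (G x) (fderiv ℝ G x v) (fderiv ℝ G x w)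
      + fderiv ℝ b (G x) (fderiv ℝ G x w) (fderiv ℝ G x v)
      - ((fderiv ℝ b (G x)).flip (fderiv ℝ G x v)).flip (fderiv ℝ G x w))

/-- The first fundamental form. -/
def firstForm (b : V → V →L[ℝ] V →L[ℝ] ℝ) (G : EuclideanSpace ℝ (Fin m) → V)
    (x : EuclideanSpace ℝ (Fin m)) : EuclideanSpace ℝ (Fin m) →L[ℝ] EuclideanSpace ℝ
    (Fin m) →L[ℝ] ℝ :=
  (b (G x)).bilinearComp (fderiv ℝ G x) (fderiv ℝ G x)

variable {b : V → V →L[ℝ] V →L[ℝ] ℝ} {G : EuclideanSpace ℝ (Fin m) → V}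
  {x : EuclideanSpace ℝ (Fin m)}

theorem contDiffAt_fderiv_one (hG : ContDiffAt ℝ 2 G x) : ContDiffAt ℝ 1 (fderiv ℝ G) x :=
  hG.fderiv_right (m := 1) (by norm_num)

theorem contDiffAt_firstForm (hG : ContDiffAt ℝ 2 G x) (hb : ContDiffAt ℝ 1 b (G x))
    (v w : EuclideanSpace ℝ (Fin m)) :
    ContDiffAt ℝ 1 (fun x => firstForm b G x v w) x := by
  have h1 := contDiffAt_fderiv_one hG
  have h2 : ContDiffAt ℝ 1 (fun x => b (G x)) x := hb.comp x (hG.of_le (by norm_num))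
  exact (h2.clm_apply (h1.clm_apply contDiffAt_const)).clm_apply (h1.clm_apply contDiffAt_const)

theorem fderiv_firstForm (hG : ContDiffAt ℝ 2 G x) (hb : ContDiffAt ℝ 1 b (G x))
    (u v w : EuclideanSpace ℝ (Fin m)) :
    fderiv ℝ (fun x => firstForm b G x v w) x u =
      fderiv ℝ b (G x) (fderiv ℝ G x u) (fderiv ℝ G x v) (fderiv ℝ G x w)
      + b (G x) (fderiv ℝ (fderiv ℝ G) x u v) (fderiv ℝ G x w)
      + b (G x) (fderiv ℝ G x v) (fderiv ℝ (fderiv ℝ G) x u w) := by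
  have h1 := ((contDiffAt_fderiv_one hG).differentiableAt one_ne_zero).hasFDerivAt
  have h0 := (hG.differentiableAt two_ne_zero).hasFDerivAt
  have h2 := (hb.differentiableAt one_ne_zero).hasFDerivAt.comp x h0
  have h3 := (h2.clm_apply (h1.clm_apply (hasFDerivAt_const v x))).clm_apply
    (h1.clm_apply (hasFDerivAt_const w x))
  have h4 : fderiv ℝ (fun x => firstForm b G x v w) x = _ := h3.fderiv
  rw [h4]
  simp
  ring

/-- The Christoffel symbols of the first fundamental form. -/
theorem covHessian_tangential (hG : ContDiffAt ℝ 2 G x) (hb : ContDiffAt ℝ 1 b (G x))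
    (hs : ∀ v w, b (G x) v w = b (G x) w v)
    (u v w : EuclideanSpace ℝ (Fin m)) :
    covHessian b G x u v (fderiv ℝ G x w) =
      (fderiv ℝ (fun x => firstForm b G x v w) x u + fderiv ℝ (fun x => firstForm b G x u w) x v
        - fderiv ℝ (fun x => firstForm b G x u v) x w) / 2 := by
  -- By this symmetry the second derivatives of G cancel in the Koszul combination, except for two
  -- copies of ⟨∂_u ∂_v G, ∂_w G⟩.
  have hsym : ∀ v w, fderiv ℝ (fderiv ℝ G) x v w = fderiv ℝ (fderiv ℝ G) x w v :=
    fun v w => (hG.isSymmSndFDerivAt (by simp)) v w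
  simp only [fderiv_firstForm hG hb, covHessian]
  simp only [add_apply, smul_apply,
    sub_apply, ContinuousLinearMap.flip_apply, smul_eq_mul]
  rw [hsym v u, hsym w u, hsym w v, hs (fderiv ℝ G x v), hs (fderiv ℝ G x u)]
  ring

/-- The decomposition of a vector into its tangential and normal parts. -/
theorem eq_tangential_add_normal [FiniteDimensional ℝ V] (hV : Module.finrank ℝ V = m + 1)
    (β : V →L[ℝ] V →L[ℝ] ℝ) (hs : ∀ v w, β v w = β w v) (hpos : ∀ v, v ≠ 0 → 0 < β v v)
    (A : EuclideanSpace ℝ (Fin m) →L[ℝ] V) (hA : Function.Injective A) (ν : V) (hν : β ν ν = 1)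
    (hAν : ∀ v, β (A v) ν = 0) (X : V) :
    X = (∑ k, (∑ l, (gramMatrix fun v w => β (A v) (A w))⁻¹ k l *
        β X (A (EuclideanSpace.single l 1))) • A (EuclideanSpace.single k 1)) + β X ν • ν := by
  set γ := gramMatrix fun v w => β (A v) (A w) with hγ
  have hdet : γ.det ≠ 0 := by
    refine (gramMatrix_posDef (Q := β.bilinearComp A A) (fun v w => hs _ _) fun v hv =>
      hpos (A v) fun h => hv ?_).det_pos.ne'
    rwa [map_eq_zero_iff A hA] at h
  -- The tangent space and the normal line span V: Λ is injective, as pairing with ν isolates the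
  -- normal coefficient, and the dimensions agree.
  let Λ : EuclideanSpace ℝ (Fin m) × ℝ →ₗ[ℝ] V := A.toLinearMap.coprod (LinearMap.toSpanSingleton ℝ V ν)
  have hΛ : ∀ p, Λ p = A p.1 + p.2 • ν := fun p => by simp [Λ]
  have hinj : Function.Injective Λ := by
    rw [injective_iff_map_eq_zero]
    rintro ⟨v, c⟩ hp
    rw [hΛ] at hp
    have h1 : β (A v + c • ν) ν = 0 := by rw [hp]; simp
    have hc : c = 0 := by simpa [hAν, hν] using h1
    subst hc
    have : A v = 0 := by simpa using hp
    rw [map_eq_zero_iff A hA] at this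
    simp [this]
  have hsurj : Function.Surjective Λ :=
    (LinearMap.injective_iff_surjective_of_finrank_eq_finrank (by simp [hV])).mp hinj
  -- The error term Y is orthogonal to the tangent space and to ν, hence to all of V and in
  -- particular to itself; positivity forces Y = 0.
  set Y : V := X - ((∑ k, (∑ l, γ⁻¹ k l * β X (A (EuclideanSpace.single l 1))) •
    A (EuclideanSpace.single k 1)) + β X ν • ν) with hY
  have hYν : β Y ν = 0 := by simp [hY, hAν, hν]
  have hYe : ∀ p, β Y (A (EuclideanSpace.single p 1)) = 0 := by
    intro p
    have h1 : ∀ k, β (A (EuclideanSpace.single k 1)) (A (EuclideanSpace.single p 1)) = γ k p :=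
      fun k => rfl
    have h2 : β ν (A (EuclideanSpace.single p 1)) = 0 := by rw [hs, hAν]
    simp only [hY, map_sub, map_add, map_sum, map_smul, sub_apply,
      add_apply, sum_apply,
      smul_apply, h1, h2, smul_eq_mul, mul_zero, add_zero]
    have h3 : ∀ l, ∑ k, γ⁻¹ k l * γ k p = if p = l then 1 else 0 := by
      intro l
      have hT : γ.transpose = γ := by
        ext i j
        simp [hγ, gramMatrix, hs (A (EuclideanSpace.single i 1))]
      have hT' : (γ⁻¹).transpose = γ⁻¹ := by rw [Matrix.transpose_nonsing_inv, hT]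
      have h4 : (γ * γ⁻¹) p l = if p = l then 1 else 0 := by
        rw [Matrix.mul_nonsing_inv _ (isUnit_iff_ne_zero.mpr hdet), Matrix.one_apply]
      rw [← h4, Matrix.mul_apply]
      refine Finset.sum_congr rfl fun k _ => ?_
      rw [mul_comm]
      congr 1
      exact congrFun (congrFun hT p) k
    simp only [Finset.sum_mul]
    rw [Finset.sum_comm]
    have h5 : ∀ l, ∑ k, γ⁻¹ k l * β X (A (EuclideanSpace.single l 1)) * γ k p =
        (if p = l then 1 else 0) * β X (A (EuclideanSpace.single l 1)) := by
      intro l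
      rw [← h3, Finset.sum_mul]
      exact Finset.sum_congr rfl fun k _ => by ring
    simp [h5]
  have hYA : ∀ v, β Y (A v) = 0 := by
    intro v
    have : v = ∑ i, v i • EuclideanSpace.single i (1 : ℝ) := by
      simpa using ((EuclideanSpace.basisFun (Fin m) ℝ).sum_repr v).symm
    rw [this]
    simp [hYe]
  have hYY : β Y Y = 0 := by
    obtain ⟨p, hp⟩ := hsurj Y
    have h1 : β Y (Λ p) = 0 := by rw [hΛ]; simp [hYA, hYν]
    rwa [hp] at h1
  have hY0 : Y = 0 := by
    by_contra h
    exact (hpos Y h).ne' hYY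
  exact sub_eq_zero.mp hY0

end LocalGeometry

/-! ### The warped metric in coordinates, and the divergence of the tangential part of X -/

section WarpedLocal

variable {m : ℕ}

/-- The inner product `dr ⊗ dr + c² κ` on `ℝ^m × ℝ`. -/
def warpedForm (c : ℝ)
    (κ : EuclideanSpace ℝ (Fin m) →L[ℝ] EuclideanSpace ℝ (Fin m) →L[ℝ] ℝ) :
    (EuclideanSpace ℝ (Fin m) × ℝ) →L[ℝ] (EuclideanSpace ℝ (Fin m) × ℝ) →L[ℝ] ℝ :=
  (ContinuousLinearMap.mul ℝ ℝ).bilinearComp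
      (ContinuousLinearMap.snd ℝ (EuclideanSpace ℝ (Fin m)) ℝ)
      (ContinuousLinearMap.snd ℝ (EuclideanSpace ℝ (Fin m)) ℝ)
    + c ^ 2 • κ.bilinearComp (ContinuousLinearMap.fst ℝ (EuclideanSpace ℝ (Fin m)) ℝ)
      (ContinuousLinearMap.fst ℝ (EuclideanSpace ℝ (Fin m)) ℝ)

theorem warpedForm_apply (c : ℝ)
    (κ : EuclideanSpace ℝ (Fin m) →L[ℝ] EuclideanSpace ℝ (Fin m) →L[ℝ] ℝ)
    (v w : EuclideanSpace ℝ (Fin m) × ℝ) :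
    warpedForm c κ v w = v.2 * w.2 + c ^ 2 * κ v.1 w.1 := by
  simp [warpedForm]

theorem warpedForm_pos {c : ℝ} (hc : 0 < c)
    {κ : EuclideanSpace ℝ (Fin m) →L[ℝ] EuclideanSpace ℝ (Fin m) →L[ℝ] ℝ}
    (hκ : ∀ v, v ≠ 0 → 0 < κ v v) {v : EuclideanSpace ℝ (Fin m) × ℝ} (hv : v ≠ 0) :
    0 < warpedForm c κ v v := by
  rw [warpedForm_apply]
  by_cases h1 : v.1 = 0
  · have h2 : v.2 ≠ 0 := fun h => hv (Prod.ext h1 h)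
    rw [h1]
    have := mul_self_pos.mpr h2
    simpa
  · have := mul_pos (pow_pos hc 2) (hκ _ h1)
    nlinarith [mul_self_nonneg v.2]

/-- The warped metric `dr ⊗ dr + h(r)² κ` on `ℝ^m × ℝ`. -/
def warpedFormField (h : ℝ → ℝ)
    (κ : EuclideanSpace ℝ (Fin m) →
      EuclideanSpace ℝ (Fin m) →L[ℝ] EuclideanSpace ℝ (Fin m) →L[ℝ] ℝ)
    (z : EuclideanSpace ℝ (Fin m) × ℝ) :
    (EuclideanSpace ℝ (Fin m) × ℝ) →L[ℝ] (EuclideanSpace ℝ (Fin m) × ℝ) →L[ℝ] ℝ :=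
  warpedForm (h z.2) (κ z.1)

variable {h : ℝ → ℝ} {κ : EuclideanSpace ℝ (Fin m) →
      EuclideanSpace ℝ (Fin m) →L[ℝ] EuclideanSpace ℝ (Fin m) →L[ℝ] ℝ}
  {z : EuclideanSpace ℝ (Fin m) × ℝ}

/-- In finite dimension a linear map amounts to its values on a basis. Applied twice, this reduces
smoothness of a field of bilinear forms to smoothness of its entries. -/
theorem contDiffAt_clm_apply_iff {X Y Z : Type*} [NormedAddCommGroup X] [NormedSpace ℝ X]
    [FiniteDimensional ℝ X] [NormedAddCommGroup Y] [NormedSpace ℝ Y] [NormedAddCommGroup Z]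
    [NormedSpace ℝ Z] {n : WithTop ℕ∞} {β : Y → X →L[ℝ] Z} {y : Y} :
    ContDiffAt ℝ n β y ↔ ∀ v, ContDiffAt ℝ n (fun y => β y v) y := by
  refine ⟨fun h v => h.clm_apply contDiffAt_const, fun h => ?_⟩
  have hd : Module.finrank ℝ X = Module.finrank ℝ (Fin (Module.finrank ℝ X) → ℝ) :=
    (Module.finrank_fin_fun ℝ).symm
  let e₁ := ContinuousLinearEquiv.ofFinrankEq hd
  let e₂ := (e₁.arrowCongr (1 : Z ≃L[ℝ] Z)).trans (ContinuousLinearEquiv.piRing _)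
  rw [← Function.id_comp β, ← e₂.symm_comp_self]
  exact e₂.symm.contDiff.contDiffAt.comp y (contDiffAt_pi.mpr fun i => h _)

theorem contDiffAt_warpedFormField (hh : ContDiffAt ℝ 1 h z.2) (hκ : ContDiffAt ℝ 1 κ z.1) :
    ContDiffAt ℝ 1 (warpedFormField h κ) z := by
  refine contDiffAt_clm_apply_iff.mpr fun v => contDiffAt_clm_apply_iff.mpr fun w => ?_
  simp only [warpedFormField, warpedForm_apply]
  refine contDiffAt_const.add ?_
  refine ((hh.comp z contDiffAt_snd).pow 2).mul ?_
  exact ((hκ.comp z contDiffAt_fst).clm_apply contDiffAt_const).clm_apply contDiffAt_const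

/-- The pairing with ∂_r does not depend on the point. Hence only the term with the derivative in
the direction of X survives in ⟨D_u v, X⟩. -/
theorem fderiv_warpedFormField_snd (hb : DifferentiableAt ℝ (warpedFormField h κ) z)
    (u v : EuclideanSpace ℝ (Fin m) × ℝ) (c : ℝ) :
    fderiv ℝ (warpedFormField h κ) z u v (0, c) = 0 := by
  have h1 : fderiv ℝ (fun z => warpedFormField h κ z v ((0, c) : EuclideanSpace ℝ (Fin m) × ℝ)) z u
      = fderiv ℝ (warpedFormField h κ) z u v (0, c) := by
    have := (hb.hasFDerivAt.clm_apply (hasFDerivAt_const v z)).clm_apply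
      (hasFDerivAt_const ((0, c) : EuclideanSpace ℝ (Fin m) × ℝ) z)
    rw [this.fderiv]
    simp
  rw [← h1]
  simp [warpedFormField, warpedForm_apply]

theorem fderiv_warpedFormField_radial (hb : DifferentiableAt ℝ (warpedFormField h κ) z)
    (hh : DifferentiableAt ℝ h z.2) (u v : EuclideanSpace ℝ (Fin m) × ℝ) (c : ℝ) :
    fderiv ℝ (warpedFormField h κ) z (0, c) u v = 2 * h z.2 * (deriv h z.2 * c) * κ z.1 u.1 v.1 := by
  have h1 := (hb.hasFDerivAt.clm_apply (hasFDerivAt_const u z)).clm_apply (hasFDerivAt_const v z)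
  have h2 := h1.hasLineDerivAt (0, c)
  simp at h2
  refine h2.unique ?_
  have h3 : HasDerivAt (fun t : ℝ => z.2 + t * c) c 0 := by
    simpa using ((hasDerivAt_id (0 : ℝ)).mul_const c).const_add z.2
  have h4 : HasDerivAt h (deriv h z.2) (z.2 + 0 * c) := by simpa using hh.hasDerivAt
  have h5 := (((h4.comp (0 : ℝ) h3).pow 2).mul_const (κ z.1 u.1 v.1)).const_add (u.2 * v.2)
  simp [HasLineDerivAt, warpedFormField, warpedForm_apply] at h5 ⊢
  exact h5

/-- The coordinate expression `div(X^T) = m h' - H ⟨X, ν⟩` for a hypersurface in a warped product;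
`X^T` has the covariant components `h(r) ∂_i r`. -/
theorem divergence_radialField_tangential
    {G : EuclideanSpace ℝ (Fin m) → EuclideanSpace ℝ (Fin m) × ℝ}
    {x : EuclideanSpace ℝ (Fin m)} (hG : ContDiffAt ℝ 2 G x)
    (hGi : Function.Injective (fderiv ℝ G x))
    (hh : ContDiffAt ℝ 1 h (G x).2) (hκ : ContDiffAt ℝ 1 κ (G x).1) (hpos : 0 < h (G x).2)
    (hκs : ∀ z v w, κ z v w = κ z w v) (hκpos : ∀ v, v ≠ 0 → 0 < κ (G x).1 v v)
    {ν : EuclideanSpace ℝ (Fin m) × ℝ} (hν : warpedFormField h κ (G x) ν ν = 1)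
    (hGν : ∀ v, warpedFormField h κ (G x) (fderiv ℝ G x v) ν = 0)
    {γ : EuclideanSpace ℝ (Fin m) → Matrix (Fin m) (Fin m) ℝ} (hγs : ∀ x i j, γ x i j = γ x j i)
    (hγ : γ =ᶠ[nhds x] fun x => gramMatrix fun v w => firstForm (warpedFormField h κ) G x v w)
    {a : Fin m → EuclideanSpace ℝ (Fin m) → ℝ} (ha : ∀ j, a j =ᶠ[nhds x] fun x =>
      h (G x).2 * (fderiv ℝ G x (EuclideanSpace.single j 1)).2) :
    ∑ i, fderiv ℝ (fun x => √(γ x).det * ∑ j, (γ x)⁻¹ i j * a j x) x (EuclideanSpace.single i 1) =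
      √(γ x).det * (m * deriv h (G x).2 -
        traceWithRespectTo (fun v w => firstForm (warpedFormField h κ) G x v w)
          (fun v w => -covHessian (warpedFormField h κ) G x v w ν) * (h (G x).2 * ν.2)) := by
  set b := warpedFormField h κ with hbdef
  have hb : ContDiffAt ℝ 1 b (G x) := contDiffAt_warpedFormField hh hκ
  have hbd := hb.differentiableAt one_ne_zero
  have hbs : ∀ z v w, b z v w = b z w v := by
    intro z v w
    simp only [hbdef, warpedFormField, warpedForm_apply, hκs z.1 v.1]
    ring
  have hbpos : ∀ v, v ≠ 0 → 0 < b (G x) v v := fun v hv => warpedForm_pos hpos hκpos hv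
  have hγx : γ x = gramMatrix fun v w => firstForm b G x v w := hγ.eq_of_nhds
  have hdet : 0 < (γ x).det := by
    rw [hγx]
    refine (gramMatrix_posDef (fun v w => hbs _ _ _) fun v hv => hbpos (fderiv ℝ G x v) ?_).det_pos
    intro h0
    exact hv (by rwa [map_eq_zero_iff _ hGi] at h0)
  have hγe : ∀ i j, (fun x => γ x i j) =ᶠ[nhds x]
      fun x => firstForm b G x (EuclideanSpace.single i 1) (EuclideanSpace.single j 1) := by
    intro i j
    filter_upwards [hγ] with y hy
    rw [hy]
    rfl
  have hγc : ∀ i j, ContDiffAt ℝ 1 (fun x => γ x i j) x := fun i j =>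
    (contDiffAt_firstForm hG hb _ _).congr_of_eventuallyEq (hγe i j)
  have hG1 := (hG.differentiableAt two_ne_zero).hasFDerivAt
  have hG2 := ((contDiffAt_fderiv_one hG).differentiableAt one_ne_zero).hasFDerivAt
  -- Product rule: ∂_i a_j = h ∂_i ∂_j r + h' ∂_i r ∂_j r.
  have hda : ∀ j, HasFDerivAt (a j) (h (G x).2 • (ContinuousLinearMap.snd ℝ _ ℝ).comp
        ((fderiv ℝ (fderiv ℝ G) x).flip (EuclideanSpace.single j 1)) +
      (fderiv ℝ G x (EuclideanSpace.single j 1)).2 • (deriv h (G x).2 •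
        (ContinuousLinearMap.snd ℝ _ ℝ).comp (fderiv ℝ G x))) x := by
    intro j
    refine HasFDerivAt.congr_of_eventuallyEq ?_ (ha j)
    have h1 : HasFDerivAt (fun x => h (G x).2) (deriv h (G x).2 •
        (ContinuousLinearMap.snd ℝ _ ℝ).comp (fderiv ℝ G x)) x :=
      (hh.differentiableAt one_ne_zero).hasDerivAt.comp_hasFDerivAt x hG1.snd
    have h2 : HasFDerivAt (fun x => (fderiv ℝ G x (EuclideanSpace.single j 1)).2)
        ((ContinuousLinearMap.snd ℝ _ ℝ).comp
        ((fderiv ℝ (fderiv ℝ G) x).flip (EuclideanSpace.single j 1))) x := by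
      have := (hG2.clm_apply (hasFDerivAt_const (EuclideanSpace.single j (1:ℝ)) x)).snd
      exact this.congr_fderiv (by simp)
    exact h1.mul h2
  have hax : ∀ j, a j x = h (G x).2 * (fderiv ℝ G x (EuclideanSpace.single j 1)).2 :=
    fun j => (ha j).eq_of_nhds
  have hΓ : ∀ i j k, covHessian b G x (EuclideanSpace.single i 1) (EuclideanSpace.single j 1)
        (fderiv ℝ G x (EuclideanSpace.single k 1)) =
      (fderiv ℝ (fun x => γ x j k) x (EuclideanSpace.single i 1)
      + fderiv ℝ (fun x => γ x i k) x (EuclideanSpace.single j 1)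
      - fderiv ℝ (fun x => γ x i j) x (EuclideanSpace.single k 1)) / 2 := by
    intro i j k
    rw [covHessian_tangential hG hb (hbs _), (hγe j k).fderiv_eq, (hγe i k).fderiv_eq,
      (hγe i j).fderiv_eq]
  rw [sum_fderiv_sqrt_det_mul_inv hγc hdet hγs (fun j => (hda j).differentiableAt) hΓ]
  congr 1
  set X : EuclideanSpace ℝ (Fin m) × ℝ := (0, h (G x).2) with hX
  have hXb : ∀ v, b (G x) X v = h (G x).2 * v.2 := by
    intro v
    simp [hbdef, warpedFormField, warpedForm_apply, hX]
  -- Splitting X replaces the Christoffel contraction Γ_{ijk} γ^{kl} a_l, a pairing with X^T, by a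
  -- pairing with X minus ⟨X, ν⟩ times a pairing with ν.
  have hdec := eq_tangential_add_normal (by simp) (b (G x)) (hbs _) hbpos (fderiv ℝ G x) hGi ν hν
    hGν X
  have hγx' : (gramMatrix fun v w => b (G x) (fderiv ℝ G x v) (fderiv ℝ G x w)) = γ x := hγx.symm
  rw [hγx'] at hdec
  simp only [hXb] at hdec
  -- This is where X is conformal. The pairing of the Hessian with X is h ∂_i ∂_j r - h² h' κ(∂_i G,
  -- ∂_j G); subtracting it from ∂_i a_j leaves h' (∂_i r ∂_j r + h² κ(∂_i G, ∂_j G)) = h' γ_{ij}.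
  have hterm : ∀ i j, fderiv ℝ (a j) x (EuclideanSpace.single i 1) -
      ∑ k, ∑ l, covHessian b G x (EuclideanSpace.single i 1) (EuclideanSpace.single j 1)
        (fderiv ℝ G x (EuclideanSpace.single k 1)) * (γ x)⁻¹ k l * a l x =
      deriv h (G x).2 * γ x i j + h (G x).2 * ν.2 *
        covHessian b G x (EuclideanSpace.single i 1) (EuclideanSpace.single j 1) ν := by
    intro i j
    have h1 := congrArg (covHessian b G x (EuclideanSpace.single i 1) (EuclideanSpace.single j 1)) hdec
    simp only [map_add, map_sum, map_smul, smul_eq_mul] at h1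
    have h2 : covHessian b G x (EuclideanSpace.single i 1) (EuclideanSpace.single j 1) X =
        h (G x).2 * (fderiv ℝ (fderiv ℝ G) x (EuclideanSpace.single i 1)
          (EuclideanSpace.single j 1)).2 - h (G x).2 ^ 2 * deriv h (G x).2 *
          κ (G x).1 (fderiv ℝ G x (EuclideanSpace.single i 1)).1
          (fderiv ℝ G x (EuclideanSpace.single j 1)).1 := by
      simp only [covHessian, add_apply, smul_apply, sub_apply, ContinuousLinearMap.flip_apply,
        smul_eq_mul]
      rw [hbs _ _ X, hXb, hX, fderiv_warpedFormField_snd hbd, fderiv_warpedFormField_snd hbd,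
        fderiv_warpedFormField_radial hbd (hh.differentiableAt one_ne_zero)]
      ring
    have h3 : γ x i j = (fderiv ℝ G x (EuclideanSpace.single i 1)).2 *
        (fderiv ℝ G x (EuclideanSpace.single j 1)).2 + h (G x).2 ^ 2 *
        κ (G x).1 (fderiv ℝ G x (EuclideanSpace.single i 1)).1
          (fderiv ℝ G x (EuclideanSpace.single j 1)).1 := by
      rw [hγx]
      simp [gramMatrix, firstForm, hbdef, warpedFormField, warpedForm_apply]
    have h4 : ∑ k, ∑ l, covHessian b G x (EuclideanSpace.single i 1) (EuclideanSpace.single j 1)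
        (fderiv ℝ G x (EuclideanSpace.single k 1)) * (γ x)⁻¹ k l * a l x =
        ∑ k, (∑ l, (γ x)⁻¹ k l * (h (G x).2 * (fderiv ℝ G x (EuclideanSpace.single l 1)).2)) *
        covHessian b G x (EuclideanSpace.single i 1) (EuclideanSpace.single j 1)
          (fderiv ℝ G x (EuclideanSpace.single k 1)) := by
      refine Finset.sum_congr rfl fun k _ => ?_
      rw [Finset.sum_mul]
      refine Finset.sum_congr rfl fun l _ => ?_
      rw [hax]
      ring
    rw [h4, (hda j).fderiv, h3]
    simp only [add_apply, smul_apply, ContinuousLinearMap.comp_apply,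
      ContinuousLinearMap.flip_apply, ContinuousLinearMap.coe_snd', smul_eq_mul]
    linear_combination h1 - h2
  simp only [hterm]
  -- The trace of h' γ is m h', the first term of the divergence.
  have htr := traceWithRespectTo_self (Q := fun v w => firstForm b G x v w) (fun v w => hbs _ _ _)
    (by rw [← hγx]; exact hdet.ne')
  simp only [traceWithRespectTo, ← hγx] at htr ⊢
  rw [← htr]
  simp only [Finset.sum_mul, ← Finset.sum_sub_distrib]
  refine Finset.sum_congr rfl fun i _ => Finset.sum_congr rfl fun j _ => ?_
  simp only [gramMatrix, Matrix.of_apply]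
  ring

end WarpedLocal

/-! ### The Riemannian measure: change of charts, integration in a chart, finiteness -/

section ChartMeasure

variable {m : ℕ} {S : Type*} [TopologicalSpace S] [ChartedSpace (EuclideanSpace ℝ (Fin m)) S]

/-- The inner products `Q` in the chart around `s`. -/
def chartForm (Q : S → EuclideanSpace ℝ (Fin m) →L[ℝ] EuclideanSpace ℝ (Fin m) →L[ℝ] ℝ) (s : S)
    (x : EuclideanSpace ℝ (Fin m)) :
    EuclideanSpace ℝ (Fin m) →L[ℝ] EuclideanSpace ℝ (Fin m) →L[ℝ] ℝ :=
  let A : EuclideanSpace ℝ (Fin m) →L[ℝ] EuclideanSpace ℝ (Fin m) :=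
    mfderiv 𝓘(ℝ, EuclideanSpace ℝ (Fin m)) (𝓡 m) (extChartAt (𝓡 m) s).symm x
  (Q ((extChartAt (𝓡 m) s).symm x)).bilinearComp A A

/-- The Gram matrix of `Q` in the chart around `s`. -/
def chartGram (Q : S → EuclideanSpace ℝ (Fin m) →L[ℝ] EuclideanSpace ℝ (Fin m) →L[ℝ] ℝ) (s : S)
    (x : EuclideanSpace ℝ (Fin m)) : Matrix (Fin m) (Fin m) ℝ :=
  gramMatrix fun v w => chartForm Q s x v w

/-- The change of coordinates from the chart around `s` to the chart around `t`. -/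
def chartChange (m : ℕ) {S : Type*} [TopologicalSpace S]
    [ChartedSpace (EuclideanSpace ℝ (Fin m)) S] (s t : S) (x : EuclideanSpace ℝ (Fin m)) :
    EuclideanSpace ℝ (Fin m) :=
  extChartAt (𝓡 m) t ((extChartAt (𝓡 m) s).symm x)

variable {Q : S → EuclideanSpace ℝ (Fin m) →L[ℝ] EuclideanSpace ℝ (Fin m) →L[ℝ] ℝ}
  {s t : S} {x : EuclideanSpace ℝ (Fin m)}

theorem eventually_mem_source (hx : x ∈ (extChartAt (𝓡 m) s).target)
    (hx' : (extChartAt (𝓡 m) s).symm x ∈ (extChartAt (𝓡 m) t).source) :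
    ∀ᶠ y in nhds x, (extChartAt (𝓡 m) s).symm y ∈ (extChartAt (𝓡 m) t).source :=
  (continuousAt_extChartAt_symm'' hx).eventually
    ((isOpen_extChartAt_source (I := 𝓡 m) t).mem_nhds hx')

theorem continuousOn_sqrt_det_chartGram
    (hQ : ∀ i j, ContinuousOn (fun x => chartGram Q s x i j) (extChartAt (𝓡 m) s).target) :
    ContinuousOn (fun x => √(chartGram Q s x).det) (extChartAt (𝓡 m) s).target := by
  refine ContinuousOn.sqrt ?_
  simp only [Matrix.det_apply']
  exact continuousOn_finsetSum _ fun σ _ => continuousOn_const.mul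
    (continuousOn_finsetProd _ fun i _ => hQ _ _)

section Measurable

theorem chartMeasure_eq_map [MeasurableSpace S] :
    chartMeasure (fun s v w => Q s v w) s =
      (((volume : Measure (EuclideanSpace ℝ (Fin m))).restrict
        (extChartAt (𝓡 m) s).target).withDensity fun x =>
          ENNReal.ofReal √(chartGram Q s x).det).map (extChartAt (𝓡 m) s).symm := rfl

variable [MeasurableSpace S] [BorelSpace S]

theorem aemeasurable_extChartAt_symm :
    AEMeasurable (extChartAt (𝓡 m) s).symm
      ((volume : Measure (EuclideanSpace ℝ (Fin m))).restrict (extChartAt (𝓡 m) s).target) :=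
  (continuousOn_extChartAt_symm s).aemeasurable (isOpen_extChartAt_target s).measurableSet

theorem chartMeasure_apply {B : Set S} (hB : MeasurableSet B) :
    chartMeasure (fun s v w => Q s v w) s B =
      ∫⁻ x in (extChartAt (𝓡 m) s).target ∩ (extChartAt (𝓡 m) s).symm ⁻¹' B,
        ENNReal.ofReal √(chartGram Q s x).det := by
  rw [chartMeasure, Measure.map_apply_of_aemeasurable
    (aemeasurable_extChartAt_symm.mono_ac (withDensity_absolutelyContinuous _ _)) hB,
    withDensity_apply', Measure.restrict_restrict' (isOpen_extChartAt_target s).measurableSet,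
    Set.inter_comm]
  rfl

theorem chartMeasure_apply_eq_inter_source {B : Set S} (hB : MeasurableSet B) :
    chartMeasure (fun s v w => Q s v w) s B =
      chartMeasure (fun s v w => Q s v w) s (B ∩ (extChartAt (𝓡 m) s).source) := by
  rw [chartMeasure_apply hB,
    chartMeasure_apply (hB.inter (isOpen_extChartAt_source (I := 𝓡 m) s).measurableSet)]
  congr 2
  ext x
  constructor
  · rintro ⟨hx, hxB⟩
    exact ⟨hx, hxB, (extChartAt (𝓡 m) s).map_target hx⟩
  · rintro ⟨hx, hxB, -⟩
    exact ⟨hx, hxB⟩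

end Measurable

variable [IsManifold (𝓡 m) ∞ S]

theorem contDiffAt_chartChange (hx : x ∈ (extChartAt (𝓡 m) s).target)
    (hx' : (extChartAt (𝓡 m) s).symm x ∈ (extChartAt (𝓡 m) t).source) :
    ContDiffAt ℝ ∞ (chartChange m s t) x := by
  have h := contDiffWithinAt_ext_coord_change (n := ∞) (I := 𝓡 m) t s (y := x)
    (by simp [PartialEquiv.trans_source] at hx' ⊢; exact ⟨by simpa using hx, hx'⟩)
  simp at h
  exact h

theorem mdifferentiableAt_extChartAt_symm (hx : x ∈ (extChartAt (𝓡 m) s).target) :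
    MDifferentiableAt 𝓘(ℝ, EuclideanSpace ℝ (Fin m)) (𝓡 m) (extChartAt (𝓡 m) s).symm x :=
  (((contMDiffOn_extChartAt_symm (n := ∞) s).contMDiffAt
    ((isOpen_extChartAt_target s).mem_nhds hx))).mdifferentiableAt (by simp)

theorem mfderiv_extChartAt_symm_eq_comp (hx : x ∈ (extChartAt (𝓡 m) s).target)
    (hx' : (extChartAt (𝓡 m) s).symm x ∈ (extChartAt (𝓡 m) t).source) :
    (mfderiv 𝓘(ℝ, EuclideanSpace ℝ (Fin m)) (𝓡 m) (extChartAt (𝓡 m) s).symm x :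
      EuclideanSpace ℝ (Fin m) →L[ℝ] EuclideanSpace ℝ (Fin m)) =
      (mfderiv 𝓘(ℝ, EuclideanSpace ℝ (Fin m)) (𝓡 m) (extChartAt (𝓡 m) t).symm
        (chartChange m s t x) :
      EuclideanSpace ℝ (Fin m) →L[ℝ] EuclideanSpace ℝ (Fin m)).comp
        (fderiv ℝ (chartChange m s t) x) := by
  have hτ : chartChange m s t x ∈ (extChartAt (𝓡 m) t).target :=
    (extChartAt (𝓡 m) t).map_source hx'
  have hev : (extChartAt (𝓡 m) s).symm =ᶠ[nhds x]
      (extChartAt (𝓡 m) t).symm ∘ chartChange m s t := by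
    filter_upwards [eventually_mem_source hx hx'] with y hy
    exact ((extChartAt (𝓡 m) t).left_inv hy).symm
  have h2 := mfderiv_comp x (mdifferentiableAt_extChartAt_symm hτ)
    ((contDiffAt_chartChange hx hx').differentiableAt (by simp)).mdifferentiableAt
  rw [mfderiv_eq_fderiv] at h2
  have h3 := hev.mfderiv_eq (I := 𝓘(ℝ, EuclideanSpace ℝ (Fin m))) (I' := 𝓡 m)
  exact h3.trans h2

theorem chartForm_chartChange (hx : x ∈ (extChartAt (𝓡 m) s).target)
    (hx' : (extChartAt (𝓡 m) s).symm x ∈ (extChartAt (𝓡 m) t).source)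
    (v w : EuclideanSpace ℝ (Fin m)) :
    chartForm Q s x v w = chartForm Q t (chartChange m s t x)
      (fderiv ℝ (chartChange m s t) x v) (fderiv ℝ (chartChange m s t) x w) := by
  have hp : (extChartAt (𝓡 m) t).symm (chartChange m s t x) = (extChartAt (𝓡 m) s).symm x :=
    (extChartAt (𝓡 m) t).left_inv hx'
  simp only [chartForm, mfderiv_extChartAt_symm_eq_comp hx hx', hp]
  rfl

/-- The Gram matrix changes by γ ↦ Tᵀ γ T, so √det acquires the factor |det T|, the Jacobian in the
change of variables formula. -/
theorem det_chartGram_chartChange (hx : x ∈ (extChartAt (𝓡 m) s).target)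
    (hx' : (extChartAt (𝓡 m) s).symm x ∈ (extChartAt (𝓡 m) t).source) :
    √(chartGram Q s x).det = |(fderiv ℝ (chartChange m s t) x).det| *
      √(chartGram Q t (chartChange m s t x)).det := by
  have : chartGram Q s x = gramMatrix fun v w => chartForm Q t (chartChange m s t x)
      (fderiv ℝ (chartChange m s t) x v) (fderiv ℝ (chartChange m s t) x w) := by
    unfold chartGram
    congr 1
    ext v w
    exact chartForm_chartChange hx hx' v w
  rw [this, gramMatrix_comp, Matrix.det_mul, Matrix.det_mul, Matrix.det_transpose, det_stdMatrix]
  rw [← Real.sqrt_sq_eq_abs, ← Real.sqrt_mul (sq_nonneg _)]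
  congr 1
  simp only [chartGram]
  ring

variable [MeasurableSpace S] [BorelSpace S]

/-- Change of variables under the transition map, whose Jacobian is absorbed by the transformation
of the densities. -/
theorem chartMeasure_eq_of_subset {B : Set S} (hB : MeasurableSet B)
    (hs : B ⊆ (extChartAt (𝓡 m) s).source) (ht : B ⊆ (extChartAt (𝓡 m) t).source) :
    chartMeasure (fun s v w => Q s v w) s B = chartMeasure (fun s v w => Q s v w) t B := by
  rw [chartMeasure_apply hB, chartMeasure_apply hB]
  set A := (extChartAt (𝓡 m) s).target ∩ (extChartAt (𝓡 m) s).symm ⁻¹' B with hA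
  -- The inverse chart is continuous only on its target, so the preimage is taken in that subtype
  -- and then mapped back.
  have hAm : MeasurableSet A := by
    have h1 := (continuousOn_iff_continuous_domRestrict.mp
      (continuousOn_extChartAt_symm (I := 𝓡 m) s)).measurable hB
    have h2 := (isOpen_extChartAt_target (I := 𝓡 m) s).measurableSet.subtype_image h1
    convert! h2 using 1
    ext x
    simp [hA, and_comm]
  have himage : chartChange m s t '' A =
      (extChartAt (𝓡 m) t).target ∩ (extChartAt (𝓡 m) t).symm ⁻¹' B := by
    ext y
    constructor
    · rintro ⟨x, ⟨hx, hxB⟩, rfl⟩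
      refine ⟨(extChartAt (𝓡 m) t).map_source (ht hxB), ?_⟩
      rw [Set.mem_preimage, chartChange, (extChartAt (𝓡 m) t).left_inv (ht hxB)]
      exact hxB
    · rintro ⟨hy, hyB⟩
      refine ⟨extChartAt (𝓡 m) s ((extChartAt (𝓡 m) t).symm y),
        ⟨(extChartAt (𝓡 m) s).map_source (hs hyB), ?_⟩, ?_⟩
      · rw [Set.mem_preimage, (extChartAt (𝓡 m) s).left_inv (hs hyB)]
        exact hyB
      · rw [chartChange, (extChartAt (𝓡 m) s).left_inv (hs hyB), (extChartAt (𝓡 m) t).right_inv hy]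
  have hinj : Set.InjOn (chartChange m s t) A := by
    rintro x ⟨hx, hxB⟩ y ⟨hy, hyB⟩ hxy
    exact (extChartAt (𝓡 m) s).symm.injOn hx hy
      ((extChartAt (𝓡 m) t).injOn (ht hxB) (ht hyB) hxy)
  rw [← himage, lintegral_image_eq_lintegral_abs_det_fderiv_mul volume hAm
    (f' := fderiv ℝ (chartChange m s t)) (fun x hx =>
      ((contDiffAt_chartChange hx.1 (ht hx.2)).differentiableAt
        (by simp)).hasFDerivAt.hasFDerivWithinAt) hinj]
  refine setLIntegral_congr_fun hAm fun x hx => ?_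
  rw [det_chartGram_chartChange hx.1 (ht hx.2), ENNReal.ofReal_mul (abs_nonneg _)]

variable [CompactSpace S]

/-- A supremum of measures is not computed set by set. The upper bound comes from one measure ρ,
glued from finitely many charts along disjoint pieces, which dominates every chart measure and
agrees with it on its own chart. -/
theorem riemannianMeasure_apply_of_subset {B : Set S} (hB : MeasurableSet B)
    (hs : B ⊆ (extChartAt (𝓡 m) s).source) :
    riemannianMeasure (fun s v w => Q s v w) B = chartMeasure (fun s v w => Q s v w) s B := by
  set μ := fun s : S => chartMeasure (fun s v w => Q s v w) s with hμ
  refine le_antisymm ?_ (Measure.le_iff'.mp (le_iSup μ s) B)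
  obtain ⟨T, hT⟩ := isCompact_univ.elim_finite_subcover
    (fun s : S => (extChartAt (𝓡 m) s).source) (fun s => isOpen_extChartAt_source s)
    (fun s _ => Set.mem_iUnion.mpr ⟨s, mem_extChartAt_source s⟩)
  have hTne : (T : Set S).Nonempty := by
    obtain ⟨i, hi⟩ := Set.mem_iUnion.mp (hT (Set.mem_univ s))
    obtain ⟨hi', -⟩ := Set.mem_iUnion.mp hi
    exact ⟨i, hi'⟩
  -- The enumeration by ℕ repeats charts; each repetition contributes an empty piece after
  -- `disjointed`.
  obtain ⟨f, hf⟩ := T.countable_toSet.exists_eq_range hTne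
  set U : ℕ → Set S := fun n => (extChartAt (𝓡 m) (f n)).source with hU
  have hUm : ∀ n, MeasurableSet (U n) := fun n => (isOpen_extChartAt_source (f n)).measurableSet
  have hAm : ∀ n, MeasurableSet (disjointed U n) := MeasurableSet.disjointed hUm
  have hcover : ⋃ n, disjointed U n = Set.univ := by
    rw [iUnion_disjointed, Set.eq_univ_iff_forall]
    intro y
    obtain ⟨i, hi⟩ := Set.mem_iUnion.mp (hT (Set.mem_univ y))
    obtain ⟨hi', hy⟩ := Set.mem_iUnion.mp hi
    obtain ⟨n, rfl⟩ : i ∈ Set.range f := hf ▸ hi'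
    exact Set.mem_iUnion.mpr ⟨n, hy⟩
  set ρ : Measure S := Measure.sum fun n => (μ (f n)).restrict (disjointed U n) with hρ
  -- Each piece of C lies in two charts, where the two chart measures coincide.
  have hsum : ∀ (t : S) (C : Set S), MeasurableSet C → C ⊆ (extChartAt (𝓡 m) t).source →
      μ t C = ρ C := by
    intro t C hC hCt
    rw [hρ, Measure.sum_apply _ hC]
    have h1 : C = ⋃ n, C ∩ disjointed U n := by rw [← Set.inter_iUnion, hcover, Set.inter_univ]
    conv_lhs => rw [h1]
    rw [measure_iUnion (fun i j hij => ((disjoint_disjointed U) hij).mono Set.inter_subset_right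
      Set.inter_subset_right) fun n => hC.inter (hAm n)]
    refine tsum_congr fun n => ?_
    rw [Measure.restrict_apply hC]
    exact chartMeasure_eq_of_subset (hC.inter (hAm n)) (Set.inter_subset_left.trans hCt)
      (Set.inter_subset_right.trans (disjointed_subset U n))
  have hle : ∀ t, μ t ≤ ρ := by
    intro t
    refine Measure.le_iff.mpr fun C hC => ?_
    have h2 := isOpen_extChartAt_source (I := 𝓡 m) t
    rw [hμ]
    dsimp only
    rw [chartMeasure_apply_eq_inter_source hC]
    change μ t _ ≤ _
    rw [hsum t _ (hC.inter h2.measurableSet) Set.inter_subset_right]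
    exact measure_mono Set.inter_subset_left
  rw [hsum s B hB hs]
  exact Measure.le_iff'.mp (iSup_le hle) B

/-- On the domain of a chart the Riemannian measure is `√(det g_{ij}) dx`. -/
theorem riemannianMeasure_restrict_source (s : S) :
    (riemannianMeasure fun s v w => Q s v w).restrict (extChartAt (𝓡 m) s).source =
      chartMeasure (fun s v w => Q s v w) s := by
  ext B hB
  have h2 := (isOpen_extChartAt_source (I := 𝓡 m) s).measurableSet
  rw [Measure.restrict_apply hB, chartMeasure_apply_eq_inter_source hB,
    riemannianMeasure_apply_of_subset (hB.inter h2) Set.inter_subset_right]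

/-- Integration in a chart. -/
theorem integral_riemannianMeasure_eq_of_subset
    (hQ : ∀ i j, ContinuousOn (fun x => chartGram Q s x i j) (extChartAt (𝓡 m) s).target)
    {u : S → ℝ} (hu : Continuous u) (hsupp : Function.support u ⊆ (extChartAt (𝓡 m) s).source) :
    ∫ p, u p ∂(riemannianMeasure fun s v w => Q s v w) =
      ∫ x in (extChartAt (𝓡 m) s).target,
        √(chartGram Q s x).det * u ((extChartAt (𝓡 m) s).symm x) := by
  have ht := (isOpen_extChartAt_target (I := 𝓡 m) s).measurableSet
  rw [← setIntegral_eq_integral_of_forall_compl_eq_zero (s := (extChartAt (𝓡 m) s).source)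
    (fun x hx => by_contra fun h => hx (hsupp h)), riemannianMeasure_restrict_source, chartMeasure_eq_map,
    integral_map (aemeasurable_extChartAt_symm.mono_ac (withDensity_absolutelyContinuous _ _))
      hu.aestronglyMeasurable]
  have hd : AEMeasurable (fun x => √(chartGram Q s x).det)
      ((volume : Measure (EuclideanSpace ℝ (Fin m))).restrict (extChartAt (𝓡 m) s).target) :=
    (continuousOn_sqrt_det_chartGram hQ).aemeasurable ht
  rw [integral_withDensity_eq_integral_toReal_smul₀ hd.ennreal_ofReal
    (Filter.Eventually.of_forall fun x => ENNReal.ofReal_lt_top)]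
  refine integral_congr_ae (Filter.Eventually.of_forall fun x => ?_)
  dsimp only
  rw [ENNReal.toReal_ofReal (Real.sqrt_nonneg _)]
  rfl

/-- The density is continuous, hence integrable over a small closed ball inside the chart; this
gives local finiteness, and S is compact. -/
theorem isFiniteMeasure_riemannianMeasure
    (hQ : ∀ s i j, ContinuousOn (fun x => chartGram Q s x i j) (extChartAt (𝓡 m) s).target) :
    IsFiniteMeasure (riemannianMeasure fun (s : S) v w => Q s v w) := by
  have : IsLocallyFiniteMeasure (riemannianMeasure fun (s : S) v w => Q s v w) := by
    refine ⟨fun s => ?_⟩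
    have ho := isOpen_extChartAt_target (I := 𝓡 m) s
    obtain ⟨r, hr, hrt⟩ := Metric.nhds_basis_closedBall.mem_iff.mp
      (ho.mem_nhds (mem_extChartAt_target s))
    set K := Metric.closedBall (extChartAt (𝓡 m) s s) r
    have hcont := (continuousOn_sqrt_det_chartGram (hQ s)).mono hrt
    set V := (extChartAt (𝓡 m) s).source ∩ extChartAt (𝓡 m) s ⁻¹' Metric.ball (extChartAt (𝓡 m) s s) r
    have hV : IsOpen V := (continuousOn_extChartAt s).isOpen_inter_preimage
      (isOpen_extChartAt_source s) Metric.isOpen_ball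
    refine ⟨V, hV.mem_nhds ⟨mem_extChartAt_source s, Metric.mem_ball_self hr⟩, ?_⟩
    rw [riemannianMeasure_apply_of_subset hV.measurableSet Set.inter_subset_left,
      chartMeasure_apply hV.measurableSet]
    have hsub : (extChartAt (𝓡 m) s).target ∩ (extChartAt (𝓡 m) s).symm ⁻¹' V ⊆ K := by
      rintro x ⟨hx, -, hxV⟩
      rw [Set.mem_preimage, (extChartAt (𝓡 m) s).right_inv hx] at hxV
      exact Metric.ball_subset_closedBall hxV
    refine (lintegral_mono_set hsub).trans_lt ?_
    have hint : IntegrableOn (fun x => √(chartGram Q s x).det) K :=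
      hcont.integrableOn_compact (isCompact_closedBall _ _)
    exact hint.lintegral_lt_top
  infer_instance

end ChartMeasure

/-! ### The divergence theorem on a closed manifold -/

section Divergence

variable {m : ℕ}

/-- Integration by parts against the constant function 1. -/
theorem integral_fderiv_eq_zero_of_hasCompactSupport {W : EuclideanSpace ℝ (Fin m) → ℝ}
    (hW : ContDiff ℝ 1 W) (hc : HasCompactSupport W) (v : EuclideanSpace ℝ (Fin m)) :
    ∫ x, fderiv ℝ W x v = 0 := by
  have hd : Continuous fun x => fderiv ℝ W x v :=
    (hW.continuous_fderiv one_ne_zero).clm_apply continuous_const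
  have hi : Integrable fun x => fderiv ℝ W x v :=
    hd.integrable_of_hasCompactSupport (hc.fderiv_apply (𝕜 := ℝ) v)
  have h := integral_mul_fderiv_eq_neg_fderiv_mul_of_integrable (𝕜 := ℝ) (μ := volume)
    (f := fun _ : EuclideanSpace ℝ (Fin m) => (1 : ℝ)) (g := W) (v := v) (by simp)
    (by simpa using hi) (by simpa using hW.continuous.integrable_of_hasCompactSupport hc)
    (fun x _ => differentiableAt_const _)
    (fun x _ => hW.differentiable one_ne_zero x)
  simpa using h

variable {S : Type*} [TopologicalSpace S] [ChartedSpace (EuclideanSpace ℝ (Fin m)) S]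
  [IsManifold (𝓡 m) ∞ S]

theorem contDiffOn_comp_extChartAt_symm {φ : S → ℝ} (hφ : ContMDiff (𝓡 m) 𝓘(ℝ, ℝ) 1 φ) (s : S) :
    ContDiffOn ℝ 1 (fun x => φ ((extChartAt (𝓡 m) s).symm x)) (extChartAt (𝓡 m) s).target := by
  have h := hφ.comp_contMDiffOn
    ((contMDiffOn_extChartAt_symm (n := ∞) (I := 𝓡 m) s).of_le (by simp : (1 : WithTop ℕ∞) ≤ ∞))
  exact contMDiffOn_iff_contDiffOn.mp h

/-- The cut-off φ has compact support inside the chart domain, so φ V extends by zero to a C¹ field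
with compact support on ℝ^m. -/
theorem setIntegral_target_divergence_eq_zero [T2Space S] [CompactSpace S] {φ : S → ℝ}
    (hφ : ContMDiff (𝓡 m) 𝓘(ℝ, ℝ) 1 φ) {s : S}
    (hs : tsupport φ ⊆ (extChartAt (𝓡 m) s).source) {V : Fin m → EuclideanSpace ℝ (Fin m) → ℝ}
    (hV : ∀ i, ContDiffOn ℝ 1 (V i) (extChartAt (𝓡 m) s).target) :
    ∫ x in (extChartAt (𝓡 m) s).target,
      ∑ i, fderiv ℝ (fun x => φ ((extChartAt (𝓡 m) s).symm x) * V i x) x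
        (EuclideanSpace.single i 1) = 0 := by
  classical
  have ho := isOpen_extChartAt_target (I := 𝓡 m) s
  set K := extChartAt (𝓡 m) s '' tsupport φ with hK
  have hKc : IsCompact K := (isClosed_tsupport φ).isCompact.image_of_continuousOn
    ((continuousOn_extChartAt s).mono hs)
  have hKt : K ⊆ (extChartAt (𝓡 m) s).target := by
    rintro _ ⟨p, hp, rfl⟩
    exact (extChartAt (𝓡 m) s).map_source (hs hp)
  set W : Fin m → EuclideanSpace ℝ (Fin m) → ℝ := fun i =>
    (extChartAt (𝓡 m) s).target.indicator fun x => φ ((extChartAt (𝓡 m) s).symm x) * V i x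
  have hW0 : ∀ i x, x ∉ K → W i x = 0 := by
    intro i x hx
    by_cases hxt : x ∈ (extChartAt (𝓡 m) s).target
    · have : φ ((extChartAt (𝓡 m) s).symm x) = 0 := by
        by_contra h
        exact hx ⟨_, subset_tsupport φ h, (extChartAt (𝓡 m) s).right_inv hxt⟩
      simp only [W, Set.indicator_of_mem hxt, this, zero_mul]
    · simp only [W, Set.indicator_of_notMem hxt]
  have hWe : ∀ i, ∀ x ∈ (extChartAt (𝓡 m) s).target, W i =ᶠ[nhds x]
      fun x => φ ((extChartAt (𝓡 m) s).symm x) * V i x := by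
    intro i x hx
    filter_upwards [ho.mem_nhds hx] with y hy
    simp only [W, Set.indicator_of_mem hy]
  have hWz : ∀ i, ∀ x ∉ K, W i =ᶠ[nhds x] fun _ => 0 := by
    intro i x hx
    filter_upwards [hKc.isClosed.isOpen_compl.mem_nhds hx] with y hy
    exact hW0 i y hy
  have hWc : ∀ i, ContDiff ℝ 1 (W i) := by
    intro i
    rw [contDiff_iff_contDiffAt]
    intro x
    by_cases hx : x ∈ K
    · refine ContDiffAt.congr_of_eventuallyEq ?_ (hWe i x (hKt hx))
      exact ((contDiffOn_comp_extChartAt_symm hφ s).mul (hV i)).contDiffAt (ho.mem_nhds (hKt hx))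
    · exact contDiffAt_const.congr_of_eventuallyEq (hWz i x hx)
  have hWs : ∀ i, HasCompactSupport (W i) := fun i => HasCompactSupport.intro hKc (hW0 i)
  have h1 : ∫ x in (extChartAt (𝓡 m) s).target,
      ∑ i, fderiv ℝ (fun x => φ ((extChartAt (𝓡 m) s).symm x) * V i x) x
        (EuclideanSpace.single i 1) = ∫ x in (extChartAt (𝓡 m) s).target,
      ∑ i, fderiv ℝ (W i) x (EuclideanSpace.single i 1) := by
    refine setIntegral_congr_fun ho.measurableSet fun x hx => ?_
    exact Finset.sum_congr rfl fun i _ => by rw [(hWe i x hx).fderiv_eq]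
  rw [h1, setIntegral_eq_integral_of_forall_compl_eq_zero, integral_finsetSum]
  · exact Finset.sum_eq_zero fun i _ =>
      integral_fderiv_eq_zero_of_hasCompactSupport (hWc i) (hWs i) _
  · intro i _
    refine Continuous.integrable_of_hasCompactSupport
      (((hWc i).continuous_fderiv one_ne_zero).clm_apply continuous_const)
      ((hWs i).fderiv_apply (𝕜 := ℝ) _)
  · intro x hx
    refine Finset.sum_eq_zero fun i _ => ?_
    rw [(hWz i x fun h => hx (hKt h)).fderiv_eq]
    simp

variable [MeasurableSpace S] [BorelSpace S] [T2Space S] [CompactSpace S]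
  {Q : S → EuclideanSpace ℝ (Fin m) →L[ℝ] EuclideanSpace ℝ (Fin m) →L[ℝ] ℝ}

/-- The divergence theorem. The operator `D` is `w ↦ div (w Y)` for a vector field `Y`, where
`V s i` are the components of `√(det g) Y` in the chart around `s`. -/
theorem integral_divergence_eq_zero
    (hQ : ∀ s i j, ContinuousOn (fun x => chartGram Q s x i j) (extChartAt (𝓡 m) s).target)
    (hdet : ∀ s, ∀ x ∈ (extChartAt (𝓡 m) s).target, 0 < (chartGram Q s x).det)
    {V : S → Fin m → EuclideanSpace ℝ (Fin m) → ℝ}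
    (hV : ∀ s i, ContDiffOn ℝ 1 (V s i) (extChartAt (𝓡 m) s).target)
    {D : (S → ℝ) → S → ℝ}
    (hD : ∀ w : S → ℝ, ContMDiff (𝓡 m) 𝓘(ℝ, ℝ) 1 w → ∀ s, ∀ x ∈ (extChartAt (𝓡 m) s).target,
      √(chartGram Q s x).det * D w ((extChartAt (𝓡 m) s).symm x) =
        ∑ i, fderiv ℝ (fun x => w ((extChartAt (𝓡 m) s).symm x) * V s i x) x
          (EuclideanSpace.single i 1))
    {w : S → ℝ} (hw : ContMDiff (𝓡 m) 𝓘(ℝ, ℝ) 1 w) :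
    Continuous (D w) ∧ ∫ p, D w p ∂(riemannianMeasure fun s v w => Q s v w) = 0 := by
  -- Since the density is positive, `hD` determines D w in each chart as a quotient of continuous
  -- functions.
  have hcont : ∀ w : S → ℝ, ContMDiff (𝓡 m) 𝓘(ℝ, ℝ) 1 w → Continuous (D w) := by
    intro w hw
    rw [continuous_iff_continuousAt]
    intro p
    have ho := isOpen_extChartAt_target (I := 𝓡 m) p
    set q : EuclideanSpace ℝ (Fin m) → ℝ := fun x => (√(chartGram Q p x).det)⁻¹ *
      ∑ i, fderiv ℝ (fun x => w ((extChartAt (𝓡 m) p).symm x) * V p i x) x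
          (EuclideanSpace.single i 1)
    have hq : ContinuousOn q (extChartAt (𝓡 m) p).target := by
      refine ((continuousOn_sqrt_det_chartGram (hQ p)).inv₀ fun x hx =>
        (Real.sqrt_pos.mpr (hdet p x hx)).ne').mul ?_
      refine continuousOn_finsetSum _ fun i _ => ?_
      exact (((contDiffOn_comp_extChartAt_symm hw p).mul (hV p i)).continuousOn_fderiv_of_isOpen ho
        le_rfl).clm_apply continuousOn_const
    have he : D w =ᶠ[nhds p] q ∘ extChartAt (𝓡 m) p := by
      filter_upwards [(isOpen_extChartAt_source (I := 𝓡 m) p).mem_nhds (mem_extChartAt_source p)]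
        with y hy
      have hy' := (extChartAt (𝓡 m) p).map_source hy
      have h1 := hD w hw p _ hy'
      rw [(extChartAt (𝓡 m) p).left_inv hy] at h1
      simp only [Function.comp_apply, q]
      rw [← h1, inv_mul_cancel_left₀ (Real.sqrt_pos.mpr (hdet p _ hy')).ne']
    refine ContinuousAt.congr ?_ he.symm
    exact (hq.continuousAt (ho.mem_nhds (mem_extChartAt_target p))).comp (continuousAt_extChartAt p)
  refine ⟨hcont w hw, ?_⟩
  -- For functions supported in a single chart, the integral is that of a coordinate divergence.
  have hlocal : ∀ (φ : S → ℝ) (s : S), ContMDiff (𝓡 m) 𝓘(ℝ, ℝ) 1 φ →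
      tsupport φ ⊆ (extChartAt (𝓡 m) s).source →
      ∫ p, D φ p ∂(riemannianMeasure fun s v w => Q s v w) = 0 := by
    intro φ s hφ hφs
    have hsupp : Function.support (D φ) ⊆ (extChartAt (𝓡 m) s).source := by
      intro p hp
      refine hφs (by_contra fun h => hp ?_)
      have h1 := hD φ hφ p _ (mem_extChartAt_target p)
      rw [extChartAt_to_inv] at h1
      have h2 : ∀ i, (fun x => φ ((extChartAt (𝓡 m) p).symm x) * V p i x) =ᶠ[nhds
          (extChartAt (𝓡 m) p p)] fun _ => 0 := by
        intro i
        have h3 : ContinuousAt (extChartAt (𝓡 m) p).symm (extChartAt (𝓡 m) p p) :=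
          continuousAt_extChartAt_symm p
        have h4 := h3.eventually (by
          rw [extChartAt_to_inv]
          exact (isClosed_tsupport φ).isOpen_compl.mem_nhds h)
        filter_upwards [h4] with x hx
        rw [image_eq_zero_of_notMem_tsupport hx, zero_mul]
      rw [Finset.sum_eq_zero fun i _ => by rw [(h2 i).fderiv_eq]; simp] at h1
      exact (mul_eq_zero.mp h1).resolve_left
        (Real.sqrt_pos.mpr (hdet p _ (mem_extChartAt_target p))).ne'
    rw [integral_riemannianMeasure_eq_of_subset (hQ s) (hcont φ hφ) hsupp]
    rw [setIntegral_congr_fun (isOpen_extChartAt_target s).measurableSet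
      (fun x hx => hD φ hφ s x hx)]
    exact setIntegral_target_divergence_eq_zero hφ hφs (hV s)
  obtain ⟨T, hT⟩ := isCompact_univ.elim_finite_subcover
    (fun s : S => (extChartAt (𝓡 m) s).source) (fun s => isOpen_extChartAt_source s)
    (fun s _ => Set.mem_iUnion.mpr ⟨s, mem_extChartAt_source s⟩)
  -- A partition of unity over finitely many charts turns w into a finite sum of functions of the
  -- local kind.
  obtain ⟨ρ, hρ⟩ := SmoothPartitionOfUnity.exists_isSubordinate (𝓡 m) isClosed_univ
    (fun t : T => (extChartAt (𝓡 m) (t : S)).source) (fun t => isOpen_extChartAt_source (t : S))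
    (fun x hx => by
      obtain ⟨i, hi⟩ := Set.mem_iUnion.mp (hT hx)
      obtain ⟨hi', hx'⟩ := Set.mem_iUnion.mp hi
      exact Set.mem_iUnion.mpr ⟨⟨i, hi'⟩, hx'⟩)
  have hρw : ∀ t : T, ContMDiff (𝓡 m) 𝓘(ℝ, ℝ) 1 fun p => ρ t p * w p := fun t =>
    ((ρ t).contMDiff.of_le (by simp)).mul hw
  have hsum : ∀ p, w p = ∑ t : T, ρ t p * w p := by
    intro p
    have h1 := ρ.sum_eq_one (Set.mem_univ p)
    rw [finsum_eq_sum_of_fintype] at h1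
    rw [← Finset.sum_mul, h1, one_mul]
  -- Additivity of D is not assumed; it is read off from `hD` in the chart around p, after
  -- cancelling the density.
  have hDsum : ∀ p, D w p = ∑ t : T, D (fun p => ρ t p * w p) p := by
    intro p
    have hx := mem_extChartAt_target (I := 𝓡 m) p
    have hpos := (Real.sqrt_pos.mpr (hdet p _ hx)).ne'
    refine mul_left_cancel₀ hpos ?_
    have h1 := hD w hw p _ hx
    have h2 := fun t => hD _ (hρw t) p _ hx
    rw [extChartAt_to_inv] at h1
    simp only [extChartAt_to_inv] at h2
    rw [h1, Finset.mul_sum, Finset.sum_congr rfl fun t _ => h2 t, Finset.sum_comm]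
    refine Finset.sum_congr rfl fun i _ => ?_
    have h3 : (fun x => w ((extChartAt (𝓡 m) p).symm x) * V p i x) = fun x =>
        ∑ t : T, ρ t ((extChartAt (𝓡 m) p).symm x) * w ((extChartAt (𝓡 m) p).symm x) * V p i x := by
      funext x
      rw [← Finset.sum_mul, ← hsum]
    rw [h3, fderiv_fun_sum]
    · simp
    · intro t _
      exact (((contDiffOn_comp_extChartAt_symm (hρw t) p).mul (hV p i)).contDiffAt
        ((isOpen_extChartAt_target p).mem_nhds hx)).differentiableAt one_ne_zero
  have := isFiniteMeasure_riemannianMeasure hQ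
  rw [integral_congr_ae (Filter.Eventually.of_forall hDsum), integral_finsetSum]
  · refine Finset.sum_eq_zero fun t _ => hlocal _ t (hρw t) ?_
    exact (tsupport_mul_subset_left (f := fun p => ρ t p)).trans (hρ t)
  · intro t _
    exact (hcont _ (hρw t)).integrable_of_hasCompactSupport
      (HasCompactSupport.of_compactSpace _)

end Divergence

/-! ### The metric g_N in charts -/

section MetricCharts

variable {m : ℕ} {N : Type*} [TopologicalSpace N] [ChartedSpace (EuclideanSpace ℝ (Fin m)) N]

/-- The inner products of a Riemannian metric, as bilinear forms on the model space. -/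
def metricForm (gN : Bundle.RiemannianMetric (fun y : N => TangentSpace (𝓡 m) y)) (y : N) :
    EuclideanSpace ℝ (Fin m) →L[ℝ] EuclideanSpace ℝ (Fin m) →L[ℝ] ℝ :=
  gN.inner y

variable [IsManifold (𝓡 m) ∞ N]

/-- The components of a smooth Riemannian metric in a chart are smooth. -/
theorem contDiffAt_chartForm_metric (gN : Bundle.ContMDiffRiemannianMetric (𝓡 m) ∞
      (EuclideanSpace ℝ (Fin m)) (fun y : N => TangentSpace (𝓡 m) y)) {s : N}
    {x : EuclideanSpace ℝ (Fin m)} (hx : x ∈ (extChartAt (𝓡 m) s).target) :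
    ContDiffAt ℝ 1 (chartForm (metricForm gN.toRiemannianMetric) s) x := by
  refine contDiffAt_clm_apply_iff.mpr fun v => contDiffAt_clm_apply_iff.mpr fun w => ?_
  have ho := isOpen_extChartAt_target (I := 𝓡 m) s
  have hsymm := contMDiffOn_extChartAt_symm (n := ∞) (I := 𝓡 m) s
  -- The coordinate field v is smooth, being the tangent map of the inverse chart applied to a
  -- constant field. Pairing two such fields with the smooth section g_N gives the metric
  -- components.
  have htan : ∀ v : EuclideanSpace ℝ (Fin m),
      ContMDiffOn 𝓘(ℝ, EuclideanSpace ℝ (Fin m)) (𝓡 m).tangent ∞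
      (fun x => (⟨(extChartAt (𝓡 m) s).symm x,
        mfderiv 𝓘(ℝ, EuclideanSpace ℝ (Fin m)) (𝓡 m) (extChartAt (𝓡 m) s).symm x v⟩ :
        TangentBundle (𝓡 m) N)) (extChartAt (𝓡 m) s).target := by
    intro v
    have h1 := hsymm.contMDiffOn_tangentMapWithin (m := ∞) (by simp) ho.uniqueMDiffOn
    have h2 : ContMDiff 𝓘(ℝ, EuclideanSpace ℝ (Fin m)) (𝓘(ℝ, EuclideanSpace ℝ (Fin m))).tangent ∞
        (fun x => (⟨x, v⟩ : TangentBundle 𝓘(ℝ, EuclideanSpace ℝ (Fin m))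
          (EuclideanSpace ℝ (Fin m)))) := by
      exact contMDiff_vectorSpace_iff_contDiff.mpr contDiff_const
    have h3 := h1.comp (h2.contMDiffOn (s := (extChartAt (𝓡 m) s).target)) (fun x hx => hx)
    refine h3.congr fun y hy => ?_
    simp only [Function.comp_apply, tangentMapWithin, mfderivWithin_of_isOpen ho hy]
  have hg := gN.contMDiff.comp_contMDiffOn hsymm
  have h4 : ContMDiffAt 𝓘(ℝ, EuclideanSpace ℝ (Fin m)) ((𝓡 m).prod 𝓘(ℝ, ℝ)) ∞
      (fun x => Bundle.TotalSpace.mk' ℝ (E := Bundle.Trivial N ℝ) ((extChartAt (𝓡 m) s).symm x)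
        (chartForm (metricForm gN.toRiemannianMetric) s x v w)) x :=
    (ContMDiffOn.clm_bundle_apply₂ hg (htan v) (htan w)).contMDiffAt (ho.mem_nhds hx)
  simp only [Bundle.contMDiffAt_totalSpace] at h4
  exact (contMDiffAt_iff_contDiffAt.mp h4.2).of_le (by simp)

/-- A tangent vector at s is given by its components in the preferred chart at s, so that chart has
the identity as derivative there. -/
theorem mfderiv_extChartAt_symm_self (s : N) :
    (mfderiv 𝓘(ℝ, EuclideanSpace ℝ (Fin m)) (𝓡 m) (extChartAt (𝓡 m) s).symm
      (extChartAt (𝓡 m) s s) : EuclideanSpace ℝ (Fin m) →L[ℝ] EuclideanSpace ℝ (Fin m)) =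
      ContinuousLinearMap.id ℝ _ := by
  have h := mfderivWithin_range_extChartAt_symm (I := 𝓡 m) (x := s)
  rw [ModelWithCorners.range_eq_univ, mfderivWithin_univ] at h
  exact h

theorem chartForm_self
    (Q : N → EuclideanSpace ℝ (Fin m) →L[ℝ] EuclideanSpace ℝ (Fin m) →L[ℝ] ℝ) (s : N)
    (v w : EuclideanSpace ℝ (Fin m)) :
    chartForm Q s (extChartAt (𝓡 m) s s) v w = Q s v w := by
  simp only [chartForm, mfderiv_extChartAt_symm_self, extChartAt_to_inv]
  rfl

theorem det_mfderiv_extChartAt_symm_ne_zero {s : N} {x : EuclideanSpace ℝ (Fin m)}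
    (hx : x ∈ (extChartAt (𝓡 m) s).target) :
    (mfderiv 𝓘(ℝ, EuclideanSpace ℝ (Fin m)) (𝓡 m) (extChartAt (𝓡 m) s).symm x :
      EuclideanSpace ℝ (Fin m) →L[ℝ] EuclideanSpace ℝ (Fin m)).det ≠ 0 := by
  have h := isInvertible_mfderivWithin_extChartAt_symm (I := 𝓡 m) hx
  rw [ModelWithCorners.range_eq_univ, mfderivWithin_univ] at h
  obtain ⟨e, he⟩ := h
  rw [← he]
  exact (LinearEquiv.isUnit_det' e.toLinearEquiv).ne_zero

end MetricCharts

/-! ### Product charts on N × ℝ -/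

section Product

variable {m : ℕ} {N : Type*} [TopologicalSpace N] [ChartedSpace (EuclideanSpace ℝ (Fin m)) N]

theorem extChartAt_prod_real (p q : N × ℝ) :
    extChartAt ((𝓡 m).prod 𝓘(ℝ, ℝ)) p q = (extChartAt (𝓡 m) p.1 q.1, q.2) := by
  rw [extChartAt_prod]
  rfl

theorem extChartAt_prod_real_symm (p : N × ℝ) (z : EuclideanSpace ℝ (Fin m) × ℝ) :
    (extChartAt ((𝓡 m).prod 𝓘(ℝ, ℝ)) p).symm z = ((extChartAt (𝓡 m) p.1).symm z.1, z.2) := by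
  rw [extChartAt_prod]
  rfl

theorem extChartAt_prod_real_target (p : N × ℝ) (z : EuclideanSpace ℝ (Fin m) × ℝ) :
    z ∈ (extChartAt ((𝓡 m).prod 𝓘(ℝ, ℝ)) p).target ↔ z.1 ∈ (extChartAt (𝓡 m) p.1).target := by
  rw [extChartAt_prod, extChartAt_model_space_eq_id]
  simp only [PartialEquiv.prod_target, Set.mem_prod, PartialEquiv.refl_target, Set.mem_univ,
    and_true]

variable {E' : Type*} [NormedAddCommGroup E'] [NormedSpace ℝ E'] {H' : Type*} [TopologicalSpace H']
  {J : ModelWithCorners ℝ E' H'} {Z : Type*} [TopologicalSpace Z] [ChartedSpace H' Z]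
  {f : Z → N × ℝ} {z : Z}

theorem mfderiv_apply_fst (hf : MDifferentiableAt J ((𝓡 m).prod 𝓘(ℝ, ℝ)) f z)
    (v : TangentSpace J z) :
    (mfderiv J ((𝓡 m).prod 𝓘(ℝ, ℝ)) f z v).1 = mfderiv J (𝓡 m) (fun z => (f z).1) z v := by
  have h := mfderiv_comp z (mdifferentiableAt_fst (I := 𝓡 m) (I' := 𝓘(ℝ, ℝ)) (x := f z)) hf
  rw [mfderiv_fst] at h
  exact (congrArg (fun A => A v) h).symm

theorem mfderiv_apply_snd (hf : MDifferentiableAt J ((𝓡 m).prod 𝓘(ℝ, ℝ)) f z)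
    (v : TangentSpace J z) :
    (mfderiv J ((𝓡 m).prod 𝓘(ℝ, ℝ)) f z v).2 = mfderiv J 𝓘(ℝ, ℝ) (fun z => (f z).2) z v := by
  have h := mfderiv_comp z (mdifferentiableAt_snd (I := 𝓡 m) (I' := 𝓘(ℝ, ℝ)) (x := f z)) hf
  rw [mfderiv_snd] at h
  exact (congrArg (fun A => A v) h).symm

variable [IsManifold (𝓡 m) ∞ N]

/-- A chart of N × ℝ acts on the factors separately and is the identity on ℝ, so the warped form of
the metric persists with g_N expressed in the chart of N. -/
theorem metricInChart_warpedMetric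
    (gN : Bundle.RiemannianMetric (fun y : N => TangentSpace (𝓡 m) y)) (h : ℝ → ℝ) (p : N × ℝ)
    {z : EuclideanSpace ℝ (Fin m) × ℝ} (hz : z.1 ∈ (extChartAt (𝓡 m) p.1).target)
    (v w : EuclideanSpace ℝ (Fin m) × ℝ) :
    metricInChart ((𝓡 m).prod 𝓘(ℝ, ℝ)) (warpedMetric gN h) p z v w =
      warpedFormField h (chartForm (metricForm gN) p.1) z v w := by
  have hf : MDifferentiableAt 𝓘(ℝ, EuclideanSpace ℝ (Fin m) × ℝ) ((𝓡 m).prod 𝓘(ℝ, ℝ))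
      (extChartAt ((𝓡 m).prod 𝓘(ℝ, ℝ)) p).symm z :=
    ((contMDiffOn_extChartAt_symm (n := ∞) p).contMDiffAt
      ((isOpen_extChartAt_target p).mem_nhds
        ((extChartAt_prod_real_target p z).mpr hz))).mdifferentiableAt (by simp)
  have h1 : ∀ v, (mfderiv 𝓘(ℝ, EuclideanSpace ℝ (Fin m) × ℝ) ((𝓡 m).prod 𝓘(ℝ, ℝ))
      (extChartAt ((𝓡 m).prod 𝓘(ℝ, ℝ)) p).symm z v).1 =
      mfderiv 𝓘(ℝ, EuclideanSpace ℝ (Fin m)) (𝓡 m) (extChartAt (𝓡 m) p.1).symm z.1 v.1 := by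
    intro v
    rw [mfderiv_apply_fst hf]
    have h2 : (fun z => ((extChartAt ((𝓡 m).prod 𝓘(ℝ, ℝ)) p).symm z).1) =
        (extChartAt (𝓡 m) p.1).symm ∘ Prod.fst := by
      funext z
      rw [extChartAt_prod_real_symm]
      rfl
    have h3 := mfderiv_comp (I := 𝓘(ℝ, EuclideanSpace ℝ (Fin m) × ℝ)) z
      (mdifferentiableAt_extChartAt_symm hz)
      (differentiableAt_fst (𝕜 := ℝ) (p := z)).mdifferentiableAt
    rw [mfderiv_eq_fderiv, fderiv_fst] at h3
    rw [h2]
    exact congrArg (fun A => A v) h3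
  have h2 : ∀ v, (mfderiv 𝓘(ℝ, EuclideanSpace ℝ (Fin m) × ℝ) ((𝓡 m).prod 𝓘(ℝ, ℝ))
      (extChartAt ((𝓡 m).prod 𝓘(ℝ, ℝ)) p).symm z v).2 = v.2 := by
    intro v
    rw [mfderiv_apply_snd hf]
    have h2 : (fun z => ((extChartAt ((𝓡 m).prod 𝓘(ℝ, ℝ)) p).symm z).2) = Prod.snd := by
      funext z
      rw [extChartAt_prod_real_symm]
    rw [h2, mfderiv_eq_fderiv, fderiv_snd]
    rfl
  have h3 := extChartAt_prod_real_symm p z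
  -- All tangent spaces of N are the same model space, so inner products at equal base points can be
  -- compared by substitution.
  have h4 : ∀ (q q' : N) (a b a' b' : EuclideanSpace ℝ (Fin m)), q = q' → a = a' → b = b' →
      gN.inner q a b = gN.inner q' a' b' := by
    rintro q _ a b _ _ rfl rfl rfl
    rfl
  rw [warpedFormField, warpedForm_apply]
  exact congrArg₂ (· + ·) (congrArg₂ (· * ·) (h2 v) (h2 w))
    (congrArg₂ (· * ·) (congrArg (fun r => h r ^ 2) (congrArg Prod.snd h3))
      (h4 _ _ _ _ _ _ (congrArg Prod.fst h3) (h1 v) (h1 w)))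

end Product

/-! ### The metric induced by the immersion, in charts -/

section Immersion

variable {m : ℕ} {N : Type*} [TopologicalSpace N] [ChartedSpace (EuclideanSpace ℝ (Fin m)) N]
  {S : Type*} [TopologicalSpace S] [ChartedSpace (EuclideanSpace ℝ (Fin m)) S]

theorem warpedForm_symm {c : ℝ}
    {κ : EuclideanSpace ℝ (Fin m) →L[ℝ] EuclideanSpace ℝ (Fin m) →L[ℝ] ℝ}
    (hκ : ∀ v w, κ v w = κ w v) (v w : EuclideanSpace ℝ (Fin m) × ℝ) :
    warpedForm c κ v w = warpedForm c κ w v := by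
  rw [warpedForm_apply, warpedForm_apply, hκ]
  ring

/-- The inner products induced by `F` from the warped metric `dr ⊗ dr + k(r)² Q`. -/
def inducedForm (Q : N → EuclideanSpace ℝ (Fin m) →L[ℝ] EuclideanSpace ℝ (Fin m) →L[ℝ] ℝ)
    (k : ℝ → ℝ) (F : S → N × ℝ) (s : S) :
    EuclideanSpace ℝ (Fin m) →L[ℝ] EuclideanSpace ℝ (Fin m) →L[ℝ] ℝ :=
  let A : EuclideanSpace ℝ (Fin m) →L[ℝ] EuclideanSpace ℝ (Fin m) × ℝ :=
    mfderiv (𝓡 m) ((𝓡 m).prod 𝓘(ℝ, ℝ)) F s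
  (warpedForm (k (F s).2) (Q (F s).1)).bilinearComp A A

/-- The map `F` in the chart of `S` around `s` and the chart of `N × ℝ` around `p`. -/
def localMap (F : S → N × ℝ) (s : S) (p : N × ℝ) (x : EuclideanSpace ℝ (Fin m)) :
    EuclideanSpace ℝ (Fin m) × ℝ :=
  extChartAt ((𝓡 m).prod 𝓘(ℝ, ℝ)) p (F ((extChartAt (𝓡 m) s).symm x))

variable {Q : N → EuclideanSpace ℝ (Fin m) →L[ℝ] EuclideanSpace ℝ (Fin m) →L[ℝ] ℝ}
  {k : ℝ → ℝ} {F : S → N × ℝ} {s : S} {p : N × ℝ} {x : EuclideanSpace ℝ (Fin m)}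

theorem localMap_snd : (localMap F s p x).2 = (F ((extChartAt (𝓡 m) s).symm x)).2 := by
  rw [localMap, extChartAt_prod_real]

theorem localMap_fst : (localMap F s p x).1 =
    extChartAt (𝓡 m) p.1 (F ((extChartAt (𝓡 m) s).symm x)).1 := by
  rw [localMap, extChartAt_prod_real]

theorem inducedMetric_warpedMetric
    (gN : Bundle.RiemannianMetric (fun y : N => TangentSpace (𝓡 m) y)) {h : ℝ → ℝ}
    (hk : h (F s).2 = k (F s).2) (v w : TangentSpace (𝓡 m) s) :
    inducedMetric ((𝓡 m).prod 𝓘(ℝ, ℝ)) m (warpedMetric gN h) F s v w =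
      inducedForm (metricForm gN) k F s v w := by
  rw [inducedMetric, warpedMetric, hk]
  exact (warpedForm_apply (k (F s).2) (gN.inner (F s).1) _ _).symm

theorem inducedForm_pos (hQ : ∀ y v, v ≠ 0 → 0 < Q y v v) (hk : 0 < k (F s).2)
    (hF : Function.Injective (mfderiv (𝓡 m) ((𝓡 m).prod 𝓘(ℝ, ℝ)) F s))
    {v : EuclideanSpace ℝ (Fin m)} (hv : v ≠ 0) : 0 < inducedForm Q k F s v v := by
  refine warpedForm_pos hk (hQ _) fun h => hv (hF ?_)
  exact h.trans (map_zero (mfderiv (𝓡 m) ((𝓡 m).prod 𝓘(ℝ, ℝ)) F s)).symm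

theorem inducedForm_symm (hQ : ∀ y v w, Q y v w = Q y w v) (v w : EuclideanSpace ℝ (Fin m)) :
    inducedForm Q k F s v w = inducedForm Q k F s w v :=
  warpedForm_symm (hQ _) _ _

theorem chartForm_pos {P : S → EuclideanSpace ℝ (Fin m) →L[ℝ] EuclideanSpace ℝ (Fin m) →L[ℝ] ℝ}
    [IsManifold (𝓡 m) ∞ S]
    (hP : ∀ s v, v ≠ 0 → 0 < P s v v) (hx : x ∈ (extChartAt (𝓡 m) s).target)
    {v : EuclideanSpace ℝ (Fin m)} (hv : v ≠ 0) : 0 < chartForm P s x v v := by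
  set A : EuclideanSpace ℝ (Fin m) →L[ℝ] EuclideanSpace ℝ (Fin m) :=
    mfderiv 𝓘(ℝ, EuclideanSpace ℝ (Fin m)) (𝓡 m) (extChartAt (𝓡 m) s).symm x with hA
  have hdet : A.det ≠ 0 := det_mfderiv_extChartAt_symm_ne_zero hx
  refine hP _ (A v) fun h => hv ?_
  have hinj : Function.Injective A :=
    (LinearMap.equivOfDetNeZero A.toLinearMap hdet).injective
  exact hinj (h.trans (map_zero A).symm)

theorem chartForm_symm {P : S → EuclideanSpace ℝ (Fin m) →L[ℝ] EuclideanSpace ℝ (Fin m) →L[ℝ] ℝ}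
    (hP : ∀ s v w, P s v w = P s w v) (v w : EuclideanSpace ℝ (Fin m)) :
    chartForm P s x v w = chartForm P s x w v := hP _ _ _

variable [IsManifold (𝓡 m) ∞ S]

theorem contMDiffAt_comp_extChartAt_symm
    (hF : ContMDiff (𝓡 m) ((𝓡 m).prod 𝓘(ℝ, ℝ)) ∞ F) (hx : x ∈ (extChartAt (𝓡 m) s).target) :
    ContMDiffAt 𝓘(ℝ, EuclideanSpace ℝ (Fin m)) ((𝓡 m).prod 𝓘(ℝ, ℝ)) ∞
      (fun x => F ((extChartAt (𝓡 m) s).symm x)) x :=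
  hF.contMDiffAt.comp x ((contMDiffOn_extChartAt_symm (n := ∞) s).contMDiffAt
    ((isOpen_extChartAt_target s).mem_nhds hx))

variable [IsManifold (𝓡 m) ∞ N]

theorem contDiffAt_localMap (hF : ContMDiff (𝓡 m) ((𝓡 m).prod 𝓘(ℝ, ℝ)) ∞ F)
    (hx : x ∈ (extChartAt (𝓡 m) s).target)
    (hp : (F ((extChartAt (𝓡 m) s).symm x)).1 ∈ (extChartAt (𝓡 m) p.1).source) :
    ContDiffAt ℝ ∞ (localMap F s p) x := by
  have h1 := contMDiffAt_comp_extChartAt_symm hF hx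
  have h2 : ContDiffAt ℝ ∞ (fun x => (localMap F s p x).1) x := by
    simp only [localMap_fst]
    refine contMDiffAt_iff_contDiffAt.mp ?_
    refine ContMDiffAt.comp x (contMDiffAt_extChartAt' (I := 𝓡 m) ?_) h1.fst
    rwa [extChartAt_source] at hp
  have h3 : ContDiffAt ℝ ∞ (fun x => (localMap F s p x).2) x := by
    simp only [localMap_snd]
    exact contMDiffAt_iff_contDiffAt.mp h1.snd
  exact h2.prodMk h3

/-- Chain rule: pulling back by the inverse chart of S and by F is the same as pulling back by the
inverse chart of N × ℝ and by the coordinate map. The chart around p need only contain the image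
point, so it can be kept fixed while x varies. -/
theorem chartForm_inducedForm (hF : ContMDiff (𝓡 m) ((𝓡 m).prod 𝓘(ℝ, ℝ)) ∞ F)
    (hx : x ∈ (extChartAt (𝓡 m) s).target)
    (hp : (F ((extChartAt (𝓡 m) s).symm x)).1 ∈ (extChartAt (𝓡 m) p.1).source)
    (v w : EuclideanSpace ℝ (Fin m)) :
    chartForm (inducedForm Q k F) s x v w =
      firstForm (warpedFormField k (chartForm Q p.1)) (localMap F s p) x v w := by
  set Fs : EuclideanSpace ℝ (Fin m) → N × ℝ := fun x => F ((extChartAt (𝓡 m) s).symm x) with hFs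
  have hFsd : MDifferentiableAt 𝓘(ℝ, EuclideanSpace ℝ (Fin m)) ((𝓡 m).prod 𝓘(ℝ, ℝ)) Fs x :=
    (contMDiffAt_comp_extChartAt_symm hF hx).mdifferentiableAt (by simp)
  set G := localMap (m := m) F s p with hG
  have hGd : HasFDerivAt G (fderiv ℝ G x) x :=
    ((contDiffAt_localMap hF hx hp).differentiableAt (by simp)).hasFDerivAt
  have hG1 : (G x).1 ∈ (extChartAt (𝓡 m) p.1).target := by
    rw [hG, localMap_fst]
    exact (extChartAt (𝓡 m) p.1).map_source hp
  have hpt : (extChartAt (𝓡 m) p.1).symm (G x).1 = (Fs x).1 := by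
    rw [hG, localMap_fst]
    exact (extChartAt (𝓡 m) p.1).left_inv hp
  have hchain : ∀ v, mfderiv (𝓡 m) ((𝓡 m).prod 𝓘(ℝ, ℝ)) F ((extChartAt (𝓡 m) s).symm x)
      (mfderiv 𝓘(ℝ, EuclideanSpace ℝ (Fin m)) (𝓡 m) (extChartAt (𝓡 m) s).symm x v) =
      mfderiv 𝓘(ℝ, EuclideanSpace ℝ (Fin m)) ((𝓡 m).prod 𝓘(ℝ, ℝ)) Fs x v := by
    intro v
    have := mfderiv_comp x (hF.mdifferentiable (by simp) _) (mdifferentiableAt_extChartAt_symm hx)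
    exact (congrArg (fun A => A v) this).symm
  -- The derivatives are named as maps of model spaces, because their own types depend on the base
  -- points.
  obtain ⟨A, hA⟩ : ∃ A : EuclideanSpace ℝ (Fin m) →L[ℝ] EuclideanSpace ℝ (Fin m) × ℝ,
    A = mfderiv 𝓘(ℝ, EuclideanSpace ℝ (Fin m)) ((𝓡 m).prod 𝓘(ℝ, ℝ)) Fs x := ⟨_, rfl⟩
  obtain ⟨B, hB⟩ : ∃ B : EuclideanSpace ℝ (Fin m) →L[ℝ] EuclideanSpace ℝ (Fin m),
    B = mfderiv 𝓘(ℝ, EuclideanSpace ℝ (Fin m)) (𝓡 m) (extChartAt (𝓡 m) p.1).symm (G x).1 :=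
    ⟨_, rfl⟩
  have h2 : ∀ v, (A v).2 = (fderiv ℝ G x v).2 := by
    intro v
    have h3 : (fun x => (Fs x).2) = fun x => (G x).2 := by
      funext y
      exact localMap_snd.symm
    have h4 : mfderiv 𝓘(ℝ, EuclideanSpace ℝ (Fin m)) 𝓘(ℝ, ℝ) (fun x => (Fs x).2) x =
        (ContinuousLinearMap.snd ℝ _ ℝ).comp (fderiv ℝ G x) := by
      rw [h3, mfderiv_eq_fderiv, hGd.snd.fderiv]
    rw [hA]
    exact (mfderiv_apply_snd hFsd v).trans (congrArg (fun A => A v) h4)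
  have h1 : ∀ v, (A v).1 = B (fderiv ℝ G x v).1 := by
    intro v
    have hcont : ContinuousAt (fun x => (Fs x).1) x := hFsd.continuousAt.fst
    have h3 : (fun x => (Fs x).1) =ᶠ[nhds x]
        (extChartAt (𝓡 m) p.1).symm ∘ fun x => (G x).1 := by
      filter_upwards [hcont.eventually ((isOpen_extChartAt_source (I := 𝓡 m) p.1).mem_nhds hp)]
        with y hy
      rw [Function.comp_apply, hG, localMap_fst]
      exact ((extChartAt (𝓡 m) p.1).left_inv hy).symm
    have h4 := mfderiv_comp (I := 𝓘(ℝ, EuclideanSpace ℝ (Fin m))) x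
      (mdifferentiableAt_extChartAt_symm hG1) hGd.fst.differentiableAt.mdifferentiableAt
    rw [mfderiv_eq_fderiv, hGd.fst.fderiv] at h4
    rw [hA, hB]
    exact (mfderiv_apply_fst hFsd v).trans (congrArg (fun A => A v) ((h3.mfderiv_eq).trans h4))
  have e1 : chartForm (inducedForm Q k F) s x v w =
      warpedForm (k (Fs x).2) (Q (Fs x).1) (A v) (A w) := by
    rw [hA]
    exact congrArg₂ (fun a b => warpedForm (k (Fs x).2) (Q (Fs x).1) a b) (hchain v) (hchain w)
  have e2 : ∀ a b, chartForm Q p.1 (G x).1 a b = Q (Fs x).1 (B a) (B b) := by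
    intro a b
    rw [← hpt, hB]
    rfl
  have h5 : (G x).2 = (Fs x).2 := localMap_snd
  rw [e1, warpedForm_apply, firstForm, ContinuousLinearMap.bilinearComp_apply, warpedFormField,
    warpedForm_apply, h5, e2, h2, h2, h1, h1]

end Immersion

/-! ### The normal part of the second covariant derivative -/

section CovHessian

variable {m : ℕ} {V : Type*} [NormedAddCommGroup V] [NormedSpace ℝ V]
  {b : V → V →L[ℝ] V →L[ℝ] ℝ} {G G' : EuclideanSpace ℝ (Fin m) → V}
  {τ : EuclideanSpace ℝ (Fin m) → EuclideanSpace ℝ (Fin m)} {x : EuclideanSpace ℝ (Fin m)}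

theorem covHessian_congr (h : G =ᶠ[nhds x] G') : covHessian b G x = covHessian b G' x := by
  funext v w
  simp only [covHessian, h.eq_of_nhds, h.fderiv_eq, h.fderiv.fderiv_eq]

/-- Packages the second fundamental form as a continuous bilinear map, the form in which
`traceWithRespectTo_comp` takes its arguments. -/
theorem exists_bilin_covHessian (b : V → V →L[ℝ] V →L[ℝ] ℝ) (G : EuclideanSpace ℝ (Fin m) → V)
    (x : EuclideanSpace ℝ (Fin m)) (ν : V) :
    ∃ B : EuclideanSpace ℝ (Fin m) →L[ℝ] EuclideanSpace ℝ (Fin m) →L[ℝ] ℝ,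
      ∀ v w, B v w = -covHessian b G x v w ν := by
  set A := fderiv ℝ G x
  set β := fderiv ℝ b (G x)
  refine ⟨-((ContinuousLinearMap.compL ℝ _ V ℝ ((b (G x)).flip ν)).comp (fderiv ℝ (fderiv ℝ G) x)
    + (2⁻¹ : ℝ) • ((ContinuousLinearMap.compL ℝ (EuclideanSpace ℝ (Fin m)) (V →L[ℝ] ℝ) ℝ
        (ContinuousLinearMap.apply ℝ ℝ ν)).comp (β.bilinearComp A A)
      + (ContinuousLinearMap.compL ℝ (EuclideanSpace ℝ (Fin m)) (V →L[ℝ] ℝ) ℝ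
        (ContinuousLinearMap.apply ℝ ℝ ν)).comp (β.bilinearComp A A).flip
      - (β ν).bilinearComp A A)), fun v w => ?_⟩
  simp [covHessian, A, β]

/-- The normal part of the Hessian is a tensor. -/
theorem covHessian_comp (hG : ContDiffAt ℝ 2 G (τ x)) (hτ : ContDiffAt ℝ 2 τ x) {ν : V}
    (hν : ∀ u, b (G (τ x)) (fderiv ℝ G (τ x) u) ν = 0) (v w : EuclideanSpace ℝ (Fin m)) :
    covHessian b (G ∘ τ) x v w ν =
      covHessian b G (τ x) (fderiv ℝ τ x v) (fderiv ℝ τ x w) ν := by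
  have hτ1 := hτ.differentiableAt two_ne_zero
  have h1 : fderiv ℝ (G ∘ τ) =ᶠ[nhds x] fun y => (fderiv ℝ G (τ y)).comp (fderiv ℝ τ y) := by
    have e1 := (hτ.eventually (by simp)).mono fun y hy => hy.differentiableAt two_ne_zero
    have e2 := hτ.continuousAt.eventually
      ((hG.eventually (by simp)).mono fun y hy => hy.differentiableAt two_ne_zero)
    filter_upwards [e1, e2] with y hy1 hy2
    exact fderiv_comp y hy2 hy1
  have h2 : ∀ u, fderiv ℝ (G ∘ τ) x u = fderiv ℝ G (τ x) (fderiv ℝ τ x u) := by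
    intro u
    rw [h1.eq_of_nhds]
    rfl
  have hG2 := ((contDiffAt_fderiv_one hG).differentiableAt one_ne_zero).hasFDerivAt
  have hτ2 := ((contDiffAt_fderiv_one hτ).differentiableAt one_ne_zero).hasFDerivAt
  -- The only non-tensorial term is DG(D²τ(v, w)); it is tangential, so its pairing with ν vanishes.
  have h3 : fderiv ℝ (fderiv ℝ (G ∘ τ)) x v w =
      fderiv ℝ (fderiv ℝ G) (τ x) (fderiv ℝ τ x v) (fderiv ℝ τ x w) +
        fderiv ℝ G (τ x) (fderiv ℝ (fderiv ℝ τ) x v w) := by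
    have h4 : fderiv ℝ (fun y => (fderiv ℝ G (τ y)).comp (fderiv ℝ τ y)) x = _ :=
      ((hG2.comp x hτ1.hasFDerivAt).clm_comp hτ2).fderiv
    rw [h1.fderiv_eq, h4]
    simp
    abel
  simp only [covHessian, add_apply, smul_apply, sub_apply, ContinuousLinearMap.flip_apply, h2, h3,
    map_add, hν, Function.comp_apply, add_zero]

end CovHessian

/-! ### The interval [0, rbar) as a domain of differentiation -/

section RadialInterval

theorem convex_radialInterval (rbar : EReal) : Convex ℝ (radialInterval rbar) := by
  refine Set.OrdConnected.convex ⟨fun a ha b hb c hc => ⟨ha.1.trans hc.1, ?_⟩⟩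
  exact (EReal.coe_le_coe_iff.mpr hc.2).trans_lt hb.2

theorem uniqueDiffOn_radialInterval {rbar : EReal} (hr : 0 < rbar) :
    UniqueDiffOn ℝ (radialInterval rbar) := by
  obtain ⟨r, hr0, hr1⟩ := EReal.lt_iff_exists_real_btwn.mp hr
  refine uniqueDiffOn_convex (convex_radialInterval rbar) ⟨r / 2, ?_⟩
  have h0 : 0 < r := by exact_mod_cast hr0
  refine mem_interior.mpr ⟨Set.Ioo 0 r, fun c hc => ⟨hc.1.le, ?_⟩, isOpen_Ioo,
    ⟨by linarith, by linarith⟩⟩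
  exact (EReal.coe_lt_coe_iff.mpr hc.2).trans hr1

end RadialInterval

/-! ### The Levi-Civita connection of the warped metric in charts -/

section MeanCurvature

theorem localMap_self {m : ℕ} {N : Type*} [TopologicalSpace N]
    [ChartedSpace (EuclideanSpace ℝ (Fin m)) N] {S : Type*} [TopologicalSpace S]
    [ChartedSpace (EuclideanSpace ℝ (Fin m)) S] (F : S → N × ℝ) (s : S) :
    localMap (m := m) F s (F s) (extChartAt (𝓡 m) s s) =
      extChartAt ((𝓡 m).prod 𝓘(ℝ, ℝ)) (F s) (F s) := by
  rw [localMap, extChartAt_to_inv]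

variable {m : ℕ} {N : Type*} [TopologicalSpace N] [ChartedSpace (EuclideanSpace ℝ (Fin m)) N]
  [IsManifold (𝓡 m) ∞ N]
  (gN : Bundle.ContMDiffRiemannianMetric (𝓡 m) ∞ (EuclideanSpace ℝ (Fin m))
    (fun y : N => TangentSpace (𝓡 m) y)) {rbar : EReal} {h k : ℝ → ℝ}

theorem contDiffAt_warpedFormField_extChartAt {p : N × ℝ} (hk : ContDiffAt ℝ 1 k p.2) :
    ContDiffAt ℝ 1 (warpedFormField k (chartForm (metricForm gN.toRiemannianMetric) p.1))
      (extChartAt ((𝓡 m).prod 𝓘(ℝ, ℝ)) p p) := by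
  rw [extChartAt_prod_real]
  exact contDiffAt_warpedFormField hk
    (contDiffAt_chartForm_metric gN (mem_extChartAt_target p.1))

/-- The metrics built from h and k agree on N × [0, rbar). This domain has unique derivatives, so
the one-sided derivatives of the first metric are the two-sided derivatives of the second, also at r
= 0. -/
theorem christoffelFirst_warpedMetric (hr : 0 < rbar) (hhk : Set.EqOn h k (radialInterval rbar))
    {p : N × ℝ} (hp : p.2 ∈ radialInterval rbar) (hk : ContDiffAt ℝ 1 k p.2)
    (u v w : EuclideanSpace ℝ (Fin m) × ℝ) :
    christoffelFirst ((𝓡 m).prod 𝓘(ℝ, ℝ)) (warpedMetric gN.toRiemannianMetric h)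
      (warpedDomain N rbar) p u v w =
      2⁻¹ * (fderiv ℝ (warpedFormField k (chartForm (metricForm gN.toRiemannianMetric) p.1))
          (extChartAt ((𝓡 m).prod 𝓘(ℝ, ℝ)) p p) u v w
        + fderiv ℝ (warpedFormField k (chartForm (metricForm gN.toRiemannianMetric) p.1))
          (extChartAt ((𝓡 m).prod 𝓘(ℝ, ℝ)) p p) v u w
        - fderiv ℝ (warpedFormField k (chartForm (metricForm gN.toRiemannianMetric) p.1))
          (extChartAt ((𝓡 m).prod 𝓘(ℝ, ℝ)) p p) w u v) := by
  set z₀ := extChartAt ((𝓡 m).prod 𝓘(ℝ, ℝ)) p p with hz₀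
  set b := warpedFormField k (chartForm (metricForm gN.toRiemannianMetric) p.1) with hb
  set A : Set (EuclideanSpace ℝ (Fin m) × ℝ) :=
    (extChartAt ((𝓡 m).prod 𝓘(ℝ, ℝ)) p).target ∩
      (extChartAt ((𝓡 m).prod 𝓘(ℝ, ℝ)) p).symm ⁻¹' warpedDomain N rbar with hA
  have hbd : DifferentiableAt ℝ b z₀ :=
    (contDiffAt_warpedFormField_extChartAt gN hk).differentiableAt one_ne_zero
  have hAeq : A = (extChartAt (𝓡 m) p.1).target ×ˢ radialInterval rbar := by
    ext z
    rw [hA, Set.mem_inter_iff, extChartAt_prod_real_target, Set.mem_preimage,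
      extChartAt_prod_real_symm, Set.mem_prod]
    rfl
  have hz₀A : z₀ ∈ A := by
    rw [hAeq, hz₀, extChartAt_prod_real]
    exact ⟨mem_extChartAt_target p.1, hp⟩
  have hu : UniqueDiffWithinAt ℝ A z₀ := by
    rw [hAeq] at hz₀A ⊢
    exact ((isOpen_extChartAt_target p.1).uniqueDiffOn.prod (uniqueDiffOn_radialInterval hr)) _ hz₀A
  have key : ∀ v w a : EuclideanSpace ℝ (Fin m) × ℝ,
      fderivWithin ℝ (fun x => metricInChart ((𝓡 m).prod 𝓘(ℝ, ℝ))
        (warpedMetric gN.toRiemannianMetric h) p x v w) A z₀ a = fderiv ℝ b z₀ a v w := by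
    intro v w a
    have h1 : Set.EqOn (fun x => metricInChart ((𝓡 m).prod 𝓘(ℝ, ℝ))
        (warpedMetric gN.toRiemannianMetric h) p x v w) (fun x => b x v w) A := by
      intro z hz
      rw [hAeq] at hz
      dsimp only
      rw [metricInChart_warpedMetric _ _ _ hz.1, hb, warpedFormField, warpedFormField, hhk hz.2]
    have h2 := (hbd.hasFDerivAt.clm_apply (hasFDerivAt_const v z₀)).clm_apply
      (hasFDerivAt_const w z₀)
    rw [fderivWithin_congr h1 (h1 hz₀A), fderivWithin_eq_fderiv hu h2.differentiableAt, h2.fderiv]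
    simp
  unfold christoffelFirst
  simp only []
  rw [← hA, ← hz₀, key, key, key]
  ring

variable {S : Type*} [TopologicalSpace S] [ChartedSpace (EuclideanSpace ℝ (Fin m)) S]
  [IsManifold (𝓡 m) ∞ S] {F : S → N × ℝ}

theorem warpedFormField_extChartAt_self
    (Q : N → EuclideanSpace ℝ (Fin m) →L[ℝ] EuclideanSpace ℝ (Fin m) →L[ℝ] ℝ) (k : ℝ → ℝ)
    (p : N × ℝ) (v w : EuclideanSpace ℝ (Fin m) × ℝ) :
    warpedFormField k (chartForm Q p.1) (extChartAt ((𝓡 m).prod 𝓘(ℝ, ℝ)) p p) v w =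
      warpedForm (k p.2) (Q p.1) v w := by
  rw [warpedFormField, extChartAt_prod_real, warpedForm_apply, warpedForm_apply]
  simp only [chartForm_self]

theorem covariantSecondDerivative_warpedMetric (hr : 0 < rbar)
    (hhk : Set.EqOn h k (radialInterval rbar))
    (hF : ContMDiff (𝓡 m) ((𝓡 m).prod 𝓘(ℝ, ℝ)) ∞ F) {s : S}
    (hs : (F s).2 ∈ radialInterval rbar) (hk : ContDiffAt ℝ 1 k (F s).2)
    (v w : EuclideanSpace ℝ (Fin m)) (ξ : EuclideanSpace ℝ (Fin m) × ℝ) :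
    covariantSecondDerivative ((𝓡 m).prod 𝓘(ℝ, ℝ)) m (warpedMetric gN.toRiemannianMetric h)
      (warpedDomain N rbar) F s v w ξ =
      covHessian (warpedFormField k (chartForm (metricForm gN.toRiemannianMetric) (F s).1))
        (localMap F s (F s)) (extChartAt (𝓡 m) s s) v w ξ := by
  have hG : ContDiffAt ℝ 2 (localMap (m := m) F s (F s)) (extChartAt (𝓡 m) s s) :=
    contDiffAt_infty.mp (contDiffAt_localMap hF (mem_extChartAt_target s) (by
      rw [extChartAt_to_inv]; exact mem_extChartAt_source _)) 2
  have hd : fderiv ℝ (fun y => fderiv ℝ (localMap F s (F s)) y w) (extChartAt (𝓡 m) s s) v =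
      fderiv ℝ (fderiv ℝ (localMap F s (F s))) (extChartAt (𝓡 m) s s) v w := by
    have h1 := ((contDiffAt_fderiv_one hG).differentiableAt one_ne_zero).hasFDerivAt
    rw [(h1.clm_apply (hasFDerivAt_const w _)).fderiv]
    simp
  have h2 := christoffelFirst_warpedMetric gN hr hhk hs hk
    (fderiv ℝ (localMap F s (F s)) (extChartAt (𝓡 m) s s) v)
    (fderiv ℝ (localMap F s (F s)) (extChartAt (𝓡 m) s s) w) ξ
  have h3 : ∀ η : EuclideanSpace ℝ (Fin m) × ℝ,
      warpedMetric gN.toRiemannianMetric h (F s) η ξ =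
      warpedFormField k (chartForm (metricForm gN.toRiemannianMetric) (F s).1)
        (extChartAt ((𝓡 m).prod 𝓘(ℝ, ℝ)) (F s) (F s)) η ξ := by
    intro η
    rw [warpedFormField_extChartAt_self (metricForm gN.toRiemannianMetric) k (F s) η ξ, ← hhk hs]
    exact (warpedForm_apply _ _ _ _).symm
  have h4 : covariantSecondDerivative ((𝓡 m).prod 𝓘(ℝ, ℝ)) m
      (warpedMetric gN.toRiemannianMetric h) (warpedDomain N rbar) F s v w ξ =
      warpedMetric gN.toRiemannianMetric h (F s) (fderiv ℝ (fun y =>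
        fderiv ℝ (localMap F s (F s)) y w) (extChartAt (𝓡 m) s s) v) ξ +
      christoffelFirst ((𝓡 m).prod 𝓘(ℝ, ℝ)) (warpedMetric gN.toRiemannianMetric h)
        (warpedDomain N rbar) (F s) (fderiv ℝ (localMap F s (F s)) (extChartAt (𝓡 m) s s) v)
        (fderiv ℝ (localMap F s (F s)) (extChartAt (𝓡 m) s s) w) ξ := rfl
  rw [h4, h2, h3, hd]
  simp only [covHessian, add_apply, smul_apply, sub_apply, ContinuousLinearMap.flip_apply,
    smul_eq_mul, localMap_self]

end MeanCurvature

/-! ### Mean curvature in an arbitrary chart of the hypersurface -/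

section CoordinateDivergence

variable {m : ℕ} {N : Type*} [TopologicalSpace N] [ChartedSpace (EuclideanSpace ℝ (Fin m)) N]
  {S : Type*} [TopologicalSpace S] [ChartedSpace (EuclideanSpace ℝ (Fin m)) S]

/-- The function `r` on the hypersurface, in the chart around `s`. -/
def localRadius (m : ℕ) {N : Type*} {S : Type*} [TopologicalSpace S]
    [ChartedSpace (EuclideanSpace ℝ (Fin m)) S] (F : S → N × ℝ) (s : S)
    (x : EuclideanSpace ℝ (Fin m)) : ℝ :=
  (F ((extChartAt (𝓡 m) s).symm x)).2

/-- The component with index `i` of `√(det g) X^T` in the chart around `s`, for `X = k(r) ∂_r`. -/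
def radialDensity (Q : S → EuclideanSpace ℝ (Fin m) →L[ℝ] EuclideanSpace ℝ (Fin m) →L[ℝ] ℝ)
    (k : ℝ → ℝ) (F : S → N × ℝ) (s : S) (i : Fin m) (x : EuclideanSpace ℝ (Fin m)) : ℝ :=
  √(chartGram Q s x).det * ∑ j, (chartGram Q s x)⁻¹ i j *
    (k (localRadius m F s x) * fderiv ℝ (localRadius m F s) x (EuclideanSpace.single j 1))

theorem mfderiv_eq_fderiv_localMap {F : S → N × ℝ} {s : S}
    (hF : MDifferentiableAt (𝓡 m) ((𝓡 m).prod 𝓘(ℝ, ℝ)) F s) :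
    (mfderiv (𝓡 m) ((𝓡 m).prod 𝓘(ℝ, ℝ)) F s :
      EuclideanSpace ℝ (Fin m) →L[ℝ] EuclideanSpace ℝ (Fin m) × ℝ) =
      fderiv ℝ (localMap F s (F s)) (extChartAt (𝓡 m) s s) := by
  refine (if_pos hF).trans ?_
  rw [ModelWithCorners.range_eq_univ, fderivWithin_univ]
  rfl

theorem localMap_eventuallyEq_comp {F : S → N × ℝ} {s : S} {x : EuclideanSpace ℝ (Fin m)}
    (hx : x ∈ (extChartAt (𝓡 m) s).target) (p : N × ℝ) :
    localMap F s p =ᶠ[nhds x] localMap F ((extChartAt (𝓡 m) s).symm x) p ∘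
      chartChange m s ((extChartAt (𝓡 m) s).symm x) := by
  filter_upwards [eventually_mem_source hx (mem_extChartAt_source _)] with y hy
  simp only [localMap, Function.comp_apply, chartChange, PartialEquiv.left_inv _ hy]

variable [IsManifold (𝓡 m) ∞ N] [IsManifold (𝓡 m) ∞ S]
  (gN : Bundle.ContMDiffRiemannianMetric (𝓡 m) ∞ (EuclideanSpace ℝ (Fin m))
    (fun y : N => TangentSpace (𝓡 m) y)) {rbar : EReal} {h k : ℝ → ℝ} {F : S → N × ℝ}
  {s : S} {x : EuclideanSpace ℝ (Fin m)}

theorem mfderiv_extChartAt_symm_eq_fderiv_chartChange (hx : x ∈ (extChartAt (𝓡 m) s).target) :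
    (mfderiv 𝓘(ℝ, EuclideanSpace ℝ (Fin m)) (𝓡 m) (extChartAt (𝓡 m) s).symm x :
      EuclideanSpace ℝ (Fin m) →L[ℝ] EuclideanSpace ℝ (Fin m)) =
      fderiv ℝ (chartChange m s ((extChartAt (𝓡 m) s).symm x)) x := by
  have h1 := mfderiv_extChartAt_symm_eq_comp hx
    (mem_extChartAt_source (I := 𝓡 m) ((extChartAt (𝓡 m) s).symm x))
  rw [chartChange, mfderiv_extChartAt_symm_self] at h1
  exact h1.trans (ContinuousLinearMap.id_comp _)

theorem contDiffAt_localMap_self (hF : ContMDiff (𝓡 m) ((𝓡 m).prod 𝓘(ℝ, ℝ)) ∞ F) (s : S) :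
    ContDiffAt ℝ ∞ (localMap (m := m) F s (F s)) (extChartAt (𝓡 m) s s) :=
  contDiffAt_localMap hF (mem_extChartAt_target s) (by
    rw [extChartAt_to_inv]; exact mem_extChartAt_source _)

theorem fderiv_localMap_eq (hF : ContMDiff (𝓡 m) ((𝓡 m).prod 𝓘(ℝ, ℝ)) ∞ F)
    (hx : x ∈ (extChartAt (𝓡 m) s).target) (v : EuclideanSpace ℝ (Fin m)) :
    fderiv ℝ (localMap F s (F ((extChartAt (𝓡 m) s).symm x))) x v =
      mfderiv (𝓡 m) ((𝓡 m).prod 𝓘(ℝ, ℝ)) F ((extChartAt (𝓡 m) s).symm x)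
        (fderiv ℝ (chartChange m s ((extChartAt (𝓡 m) s).symm x)) x v) := by
  set t := (extChartAt (𝓡 m) s).symm x with ht
  have hτ := contDiffAt_chartChange hx (mem_extChartAt_source (I := 𝓡 m) t)
  have hG := contDiffAt_localMap_self hF t
  rw [(localMap_eventuallyEq_comp hx (F t)).fderiv_eq, ← ht,
    fderiv_comp x (hG.differentiableAt (by simp)) (hτ.differentiableAt (by simp))]
  have h2 := mfderiv_eq_fderiv_localMap (hF.mdifferentiable (by simp) t)
  exact (congrArg (fun A => A (fderiv ℝ (chartChange m s t) x v)) h2).symm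

/-- By definition the mean curvature at t is computed in the chart around t, whereas the divergence
is computed in one chart around s. Both forms transform by the derivative T of the transition map,
and the trace is invariant. The chart of N × ℝ is the one around F t on both sides, so only the
coordinates of S change. -/
theorem meanCurvature_eq_trace (hr : 0 < rbar) (hhk : Set.EqOn h k (radialInterval rbar))
    (hF : ContMDiff (𝓡 m) ((𝓡 m).prod 𝓘(ℝ, ℝ)) ∞ F)
    (hx : x ∈ (extChartAt (𝓡 m) s).target)
    (hs : (F ((extChartAt (𝓡 m) s).symm x)).2 ∈ radialInterval rbar)
    (hk : ContDiffAt ℝ 1 k (F ((extChartAt (𝓡 m) s).symm x)).2)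
    {ν : ∀ s : S, TangentSpace ((𝓡 m).prod 𝓘(ℝ, ℝ)) (F s)}
    (hν : IsUnitNormal ((𝓡 m).prod 𝓘(ℝ, ℝ)) m (warpedMetric gN.toRiemannianMetric h) F ν) :
    meanCurvature ((𝓡 m).prod 𝓘(ℝ, ℝ)) m (warpedMetric gN.toRiemannianMetric h)
      (warpedDomain N rbar) F ν ((extChartAt (𝓡 m) s).symm x) =
    traceWithRespectTo
      (fun v w => firstForm (warpedFormField k (chartForm (metricForm gN.toRiemannianMetric)
        (F ((extChartAt (𝓡 m) s).symm x)).1))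
        (localMap F s (F ((extChartAt (𝓡 m) s).symm x))) x v w)
      (fun v w => -covHessian (warpedFormField k (chartForm (metricForm gN.toRiemannianMetric)
        (F ((extChartAt (𝓡 m) s).symm x)).1))
        (localMap F s (F ((extChartAt (𝓡 m) s).symm x))) x v w
        (ν ((extChartAt (𝓡 m) s).symm x))) := by
  set t := (extChartAt (𝓡 m) s).symm x with ht
  set b := warpedFormField k (chartForm (metricForm gN.toRiemannianMetric) (F t).1) with hb
  set T := fderiv ℝ (chartChange m s t) x with hT
  have hτ0 : chartChange m s t x = extChartAt (𝓡 m) t t := rfl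
  have hτ := contDiffAt_chartChange hx (mem_extChartAt_source (I := 𝓡 m) t)
  have hG := contDiffAt_localMap_self hF t
  have hTdet : T.det ≠ 0 := by
    have h1 := det_mfderiv_extChartAt_symm_ne_zero hx
    rwa [mfderiv_extChartAt_symm_eq_fderiv_chartChange hx] at h1
  obtain ⟨B, hB⟩ := exists_bilin_covHessian b (localMap (m := m) F t (F t))
    (extChartAt (𝓡 m) t t) (ν t)
  have h1 : meanCurvature ((𝓡 m).prod 𝓘(ℝ, ℝ)) m (warpedMetric gN.toRiemannianMetric h)
      (warpedDomain N rbar) F ν t =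
      traceWithRespectTo (fun v w => inducedForm (metricForm gN.toRiemannianMetric) k F t v w)
        (fun v w => B v w) := by
    unfold meanCurvature
    congr 1
    · funext v w
      exact inducedMetric_warpedMetric _ (hhk hs) v w
    · funext v w
      rw [hB]
      exact congrArg Neg.neg
        (covariantSecondDerivative_warpedMetric gN hr hhk hF hs hk v w (ν t))
  -- Normality of ν is what makes the Hessian paired with ν tensorial.
  have hnormal : ∀ u, b (localMap F t (F t) (chartChange m s t x))
      (fderiv ℝ (localMap F t (F t)) (chartChange m s t x) u) (ν t) = 0 := by
    intro u
    have h2 := (hν t).2 u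
    have h3 := mfderiv_eq_fderiv_localMap (hF.mdifferentiable (by simp) t)
    rw [hτ0, localMap_self, hb]
    refine (warpedFormField_extChartAt_self (metricForm gN.toRiemannianMetric) k (F t) _ _).trans ?_
    rw [← hhk hs, ← h3]
    exact (warpedForm_apply _ _ _ _).trans h2
  rw [h1, ← traceWithRespectTo_comp _ _ hTdet]
  congr 1
  · funext v w
    rw [← chartForm_inducedForm hF hx (mem_extChartAt_source _),
      chartForm_chartChange hx (mem_extChartAt_source (I := 𝓡 m) t), hτ0, chartForm_self]
  · funext v w
    rw [hB, covHessian_congr (localMap_eventuallyEq_comp hx (F t)),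
      covHessian_comp (contDiffAt_infty.mp hG 2) (contDiffAt_infty.mp hτ 2) hnormal]
    rfl

end CoordinateDivergence

/-! ### The divergence of X^T in a chart of the immersed hypersurface -/

section RadialDivergence

variable {m : ℕ} {N : Type*} [TopologicalSpace N] [ChartedSpace (EuclideanSpace ℝ (Fin m)) N]
  {S : Type*} [TopologicalSpace S] [ChartedSpace (EuclideanSpace ℝ (Fin m)) S]

theorem metricForm_symm (gN : Bundle.RiemannianMetric (fun y : N => TangentSpace (𝓡 m) y)) (y : N)
    (v w : EuclideanSpace ℝ (Fin m)) : metricForm gN y v w = metricForm gN y w v :=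
  gN.symm y v w

theorem metricForm_pos (gN : Bundle.RiemannianMetric (fun y : N => TangentSpace (𝓡 m) y)) (y : N)
    (v : EuclideanSpace ℝ (Fin m)) (hv : v ≠ 0) : 0 < metricForm gN y v v :=
  gN.pos y v hv

theorem contDiffAt_localRadius [IsManifold (𝓡 m) ∞ S] {F : S → N × ℝ} {s : S}
    {x : EuclideanSpace ℝ (Fin m)} (hF : ContMDiff (𝓡 m) ((𝓡 m).prod 𝓘(ℝ, ℝ)) ∞ F)
    (hx : x ∈ (extChartAt (𝓡 m) s).target) : ContDiffAt ℝ ∞ (localRadius m F s) x :=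
  contMDiffAt_iff_contDiffAt.mp (contMDiffAt_comp_extChartAt_symm hF hx).snd

variable [IsManifold (𝓡 m) ∞ N]
  (gN : Bundle.ContMDiffRiemannianMetric (𝓡 m) ∞ (EuclideanSpace ℝ (Fin m))
    (fun y : N => TangentSpace (𝓡 m) y)) {rbar : EReal} {h k : ℝ → ℝ} {F : S → N × ℝ}
  {s : S} {x : EuclideanSpace ℝ (Fin m)}

theorem chartForm_inducedForm_symm (s : S) (x v w : EuclideanSpace ℝ (Fin m)) :
    chartForm (inducedForm (metricForm gN.toRiemannianMetric) k F) s x v w =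
      chartForm (inducedForm (metricForm gN.toRiemannianMetric) k F) s x w v :=
  chartForm_symm (fun _ => inducedForm_symm (metricForm_symm gN.toRiemannianMetric)) v w

theorem chartGram_inducedForm_symm (s : S) (x : EuclideanSpace ℝ (Fin m)) (i j : Fin m) :
    chartGram (inducedForm (metricForm gN.toRiemannianMetric) k F) s x i j =
      chartGram (inducedForm (metricForm gN.toRiemannianMetric) k F) s x j i := by
  simp only [chartGram, gramMatrix, Matrix.of_apply]
  exact chartForm_inducedForm_symm gN s x _ _

theorem contDiffAt_warpedFormField_localMap
    (hk : ContDiffAt ℝ 1 k (F ((extChartAt (𝓡 m) s).symm x)).2) :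
    ContDiffAt ℝ 1 (warpedFormField k (chartForm (metricForm gN.toRiemannianMetric)
      (F ((extChartAt (𝓡 m) s).symm x)).1))
      (localMap F s (F ((extChartAt (𝓡 m) s).symm x)) x) := by
  rw [localMap]
  exact contDiffAt_warpedFormField_extChartAt gN hk

variable [IsManifold (𝓡 m) ∞ S]

theorem chartForm_inducedForm_pos (hkpos : ∀ s, 0 < k (F s).2)
    (hFi : ∀ s, Function.Injective (mfderiv (𝓡 m) ((𝓡 m).prod 𝓘(ℝ, ℝ)) F s))
    (hx : x ∈ (extChartAt (𝓡 m) s).target) {v : EuclideanSpace ℝ (Fin m)} (hv : v ≠ 0) :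
    0 < chartForm (inducedForm (metricForm gN.toRiemannianMetric) k F) s x v v :=
  chartForm_pos (fun s _ hv => inducedForm_pos (metricForm_pos gN.toRiemannianMetric) (hkpos s)
    (hFi s) hv) hx hv

theorem chartGram_inducedForm_posDef (hkpos : ∀ s, 0 < k (F s).2)
    (hFi : ∀ s, Function.Injective (mfderiv (𝓡 m) ((𝓡 m).prod 𝓘(ℝ, ℝ)) F s))
    (hx : x ∈ (extChartAt (𝓡 m) s).target) :
    (chartGram (inducedForm (metricForm gN.toRiemannianMetric) k F) s x).PosDef :=
  gramMatrix_posDef (chartForm_inducedForm_symm gN s x)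
    fun _ hv => chartForm_inducedForm_pos gN hkpos hFi hx hv

/-- A single chart of N × ℝ around the image of x serves for all points near x, so the induced
metric can be differentiated at x. -/
theorem chartGram_inducedForm_eventuallyEq (hF : ContMDiff (𝓡 m) ((𝓡 m).prod 𝓘(ℝ, ℝ)) ∞ F)
    (hx : x ∈ (extChartAt (𝓡 m) s).target) :
    chartGram (inducedForm (metricForm gN.toRiemannianMetric) k F) s =ᶠ[nhds x] fun y =>
      gramMatrix fun v w => firstForm (warpedFormField k
        (chartForm (metricForm gN.toRiemannianMetric) (F ((extChartAt (𝓡 m) s).symm x)).1))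
        (localMap F s (F ((extChartAt (𝓡 m) s).symm x))) y v w := by
  have h1 : ContinuousAt (fun y => (F ((extChartAt (𝓡 m) s).symm y)).1) x :=
    (contMDiffAt_comp_extChartAt_symm hF hx).continuousAt.fst
  filter_upwards [(isOpen_extChartAt_target s).mem_nhds hx,
    h1.eventually ((isOpen_extChartAt_source (I := 𝓡 m) _).mem_nhds (mem_extChartAt_source _))]
    with y hy hy'
  rw [chartGram]
  congr 1
  funext v w
  exact chartForm_inducedForm hF hy hy' v w

theorem contDiffAt_localMap_fiber (hF : ContMDiff (𝓡 m) ((𝓡 m).prod 𝓘(ℝ, ℝ)) ∞ F)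
    (hx : x ∈ (extChartAt (𝓡 m) s).target) :
    ContDiffAt ℝ ∞ (localMap F s (F ((extChartAt (𝓡 m) s).symm x))) x :=
  contDiffAt_localMap hF hx (mem_extChartAt_source _)

theorem contDiffAt_chartGram_inducedForm (hk : ∀ s, ContDiffAt ℝ 1 k (F s).2)
    (hF : ContMDiff (𝓡 m) ((𝓡 m).prod 𝓘(ℝ, ℝ)) ∞ F) (hx : x ∈ (extChartAt (𝓡 m) s).target)
    (i j : Fin m) :
    ContDiffAt ℝ 1 (fun x => chartGram (inducedForm (metricForm gN.toRiemannianMetric) k F) s x i j)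
      x := by
  refine ContDiffAt.congr_of_eventuallyEq ?_
    ((chartGram_inducedForm_eventuallyEq gN hF hx).fun_comp fun A => A i j)
  refine contDiffAt_firstForm (contDiffAt_infty.mp (contDiffAt_localMap_fiber hF hx) 2)
    (contDiffAt_warpedFormField_localMap gN (hk _)) _ _

theorem contDiffOn_radialDensity (hk : ∀ s, ContDiffAt ℝ 1 k (F s).2)
    (hkpos : ∀ s, 0 < k (F s).2) (hF : ContMDiff (𝓡 m) ((𝓡 m).prod 𝓘(ℝ, ℝ)) ∞ F)
    (hFi : ∀ s, Function.Injective (mfderiv (𝓡 m) ((𝓡 m).prod 𝓘(ℝ, ℝ)) F s)) (s : S)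
    (i : Fin m) :
    ContDiffOn ℝ 1 (radialDensity (inducedForm (metricForm gN.toRiemannianMetric) k F) k F s i)
      (extChartAt (𝓡 m) s).target := by
  intro x hx
  refine ContDiffAt.contDiffWithinAt ?_
  have hd := (chartGram_inducedForm_posDef gN hkpos hFi hx).det_pos
  have hγ := contDiffAt_chartGram_inducedForm gN hk hF hx
  have hρ := contDiffAt_localRadius hF hx
  have h1 : ContDiffAt ℝ 1 (fun x => k (localRadius m F s x)) x :=
    (hk ((extChartAt (𝓡 m) s).symm x)).comp x (contDiffAt_infty.mp hρ 1)
  refine ((contDiffAt_matrix_det hγ).sqrt hd.ne').mul (ContDiffAt.sum fun j _ =>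
    (contDiffAt_matrix_inv hγ hd.ne' i j).mul (h1.mul ?_))
  exact (contDiffAt_fderiv_one (contDiffAt_infty.mp hρ 2)).clm_apply contDiffAt_const

/-- The divergence of the tangential part of `X = k(r) ∂_r`, in a chart. -/
theorem sum_fderiv_radialDensity (hr : 0 < rbar) (hhk : Set.EqOn h k (radialInterval rbar))
    (hmem : ∀ s, (F s).2 ∈ radialInterval rbar) (hk : ∀ s, ContDiffAt ℝ 1 k (F s).2)
    (hkpos : ∀ s, 0 < k (F s).2) (hF : ContMDiff (𝓡 m) ((𝓡 m).prod 𝓘(ℝ, ℝ)) ∞ F)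
    (hFi : ∀ s, Function.Injective (mfderiv (𝓡 m) ((𝓡 m).prod 𝓘(ℝ, ℝ)) F s))
    {ν : ∀ s : S, TangentSpace ((𝓡 m).prod 𝓘(ℝ, ℝ)) (F s)}
    (hν : IsUnitNormal ((𝓡 m).prod 𝓘(ℝ, ℝ)) m (warpedMetric gN.toRiemannianMetric h) F ν)
    (hx : x ∈ (extChartAt (𝓡 m) s).target) :
    ∑ i, fderiv ℝ (radialDensity (inducedForm (metricForm gN.toRiemannianMetric) k F) k F s i) x
        (EuclideanSpace.single i 1) =
      √(chartGram (inducedForm (metricForm gN.toRiemannianMetric) k F) s x).det *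
        (m * deriv k (F ((extChartAt (𝓡 m) s).symm x)).2 -
          meanCurvature ((𝓡 m).prod 𝓘(ℝ, ℝ)) m (warpedMetric gN.toRiemannianMetric h)
            (warpedDomain N rbar) F ν ((extChartAt (𝓡 m) s).symm x) *
          (k (F ((extChartAt (𝓡 m) s).symm x)).2 * (ν ((extChartAt (𝓡 m) s).symm x)).2)) := by
  rw [meanCurvature_eq_trace gN hr hhk hF hx (hmem _) (hk _) hν]
  set t := (extChartAt (𝓡 m) s).symm x with ht
  set κ := chartForm (metricForm gN.toRiemannianMetric) (F t).1 with hκ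
  have hG := contDiffAt_localMap_fiber hF hx
  rw [← ht] at hG
  set G := localMap (m := m) F s (F t) with hGdef
  have hG2 : (G x).2 = (F t).2 := localMap_snd
  have hG1 : (G x).1 = extChartAt (𝓡 m) (F t).1 (F t).1 := localMap_fst
  have hself : ∀ v w : EuclideanSpace ℝ (Fin m) × ℝ, warpedFormField k κ (G x) v w =
      warpedMetric gN.toRiemannianMetric h (F t) v w := by
    intro v w
    have h1 : warpedFormField k κ (G x) v w =
      warpedForm (k (F t).2) (metricForm gN.toRiemannianMetric (F t).1) v w :=
      warpedFormField_extChartAt_self (metricForm gN.toRiemannianMetric) k (F t) v w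
    rw [h1, ← hhk (hmem t)]
    exact warpedForm_apply _ _ _ _
  have hfirst : ∀ v w, firstForm (warpedFormField k κ) G x v w =
      chartForm (inducedForm (metricForm gN.toRiemannianMetric) k F) s x v w :=
    fun v w => (chartForm_inducedForm hF hx (mem_extChartAt_source _) v w).symm
  -- Read off from the positive definiteness of the induced form: a vector in the kernel would have
  -- length zero.
  have hGi : Function.Injective (fderiv ℝ G x) := by
    refine (injective_iff_map_eq_zero (fderiv ℝ G x)).mpr fun v hv => by_contra fun hv0 => ?_
    have h1 := chartForm_inducedForm_pos gN hkpos hFi hx hv0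
    rw [← hfirst, firstForm, ContinuousLinearMap.bilinearComp_apply, hv, map_zero] at h1
    exact lt_irrefl _ h1
  have hGκ : ContDiffAt ℝ 1 κ (G x).1 := by
    rw [hG1]
    exact contDiffAt_chartForm_metric gN (mem_extChartAt_target _)
  have hκpos : ∀ v, v ≠ 0 → 0 < κ (G x).1 v v := by
    rw [hG1]
    exact fun v hv => chartForm_pos (metricForm_pos gN.toRiemannianMetric)
      (mem_extChartAt_target _) hv
  have hκsymm : ∀ z v w, κ z v w = κ z w v := fun z v w =>
    chartForm_symm (metricForm_symm gN.toRiemannianMetric) v w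
  have hk1 : ContDiffAt ℝ 1 k (G x).2 := by
    rw [hG2]
    exact hk t
  have hk2 : 0 < k (G x).2 := by
    rw [hG2]
    exact hkpos t
  obtain ⟨ξ, hξ⟩ : ∃ ξ : EuclideanSpace ℝ (Fin m) × ℝ, ξ = ν t := ⟨_, rfl⟩
  have hξ1 : warpedFormField k κ (G x) ξ ξ = 1 := by
    rw [hself, hξ]
    exact (hν t).1
  have hξ2 : ∀ v, warpedFormField k κ (G x) (fderiv ℝ G x v) ξ = 0 := by
    intro v
    rw [hself, hξ, fderiv_localMap_eq hF hx v]
    exact (hν t).2 _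
  have hγs : ∀ y i j, chartGram (inducedForm (metricForm gN.toRiemannianMetric) k F) s y i j =
      chartGram (inducedForm (metricForm gN.toRiemannianMetric) k F) s y j i :=
    chartGram_inducedForm_symm gN s
  have hγ : chartGram (inducedForm (metricForm gN.toRiemannianMetric) k F) s =ᶠ[nhds x]
      fun y => gramMatrix fun v w => firstForm (warpedFormField k κ) G y v w :=
    chartGram_inducedForm_eventuallyEq gN hF hx
  have ha : ∀ j, (fun y => k (localRadius m F s y) *
      fderiv ℝ (localRadius m F s) y (EuclideanSpace.single j 1)) =ᶠ[nhds x]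
      fun y => k (G y).2 * (fderiv ℝ G y (EuclideanSpace.single j 1)).2 := by
    intro j
    have h1 : localRadius m F s = fun y => (G y).2 := by
      funext y
      exact localMap_snd.symm
    filter_upwards [(contDiffAt_infty.mp hG 1).eventually (by simp)] with y hy
    have h2 := (hy.differentiableAt one_ne_zero).hasFDerivAt
    rw [h1, h2.snd.fderiv]
    rfl
  have hmain := divergence_radialField_tangential (contDiffAt_infty.mp hG 2) hGi hk1 hGκ hk2
    hκsymm hκpos hξ1 hξ2 hγs hγ ha
  rw [hG2] at hmain
  rw [← hξ]
  exact hmain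

end RadialDivergence

/-! ### The divergence of w X^T and its integral -/

section WeightedDivergence

variable {m : ℕ}

theorem traceWithRespectTo_mul (Q : EuclideanSpace ℝ (Fin m) → EuclideanSpace ℝ (Fin m) → ℝ)
    (α β : EuclideanSpace ℝ (Fin m) → ℝ) :
    traceWithRespectTo Q (fun v u => α v * β u) =
      ∑ i, (∑ j, (gramMatrix Q)⁻¹ i j * β (EuclideanSpace.single j 1)) *
        α (EuclideanSpace.single i 1) := by
  rw [traceWithRespectTo]
  refine Finset.sum_congr rfl fun i _ => ?_
  rw [Finset.sum_mul]
  refine Finset.sum_congr rfl fun j _ => ?_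
  rw [gramMatrix, gramMatrix, Matrix.of_apply]
  ring

/-- This is |α|² in the dual metric, nonnegative because the inverse of a positive definite matrix
is positive definite. For α = dr it is |∇r|². -/
theorem traceWithRespectTo_mul_self_nonneg
    {Q : EuclideanSpace ℝ (Fin m) →L[ℝ] EuclideanSpace ℝ (Fin m) →L[ℝ] ℝ}
    (hs : ∀ v w, Q v w = Q w v) (hpos : ∀ v, v ≠ 0 → 0 < Q v v)
    (α : EuclideanSpace ℝ (Fin m) → ℝ) :
    0 ≤ traceWithRespectTo (fun v w => Q v w) (fun v u => α v * α u) := by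
  have h := (gramMatrix_posDef hs hpos).inv.posSemidef.dotProduct_mulVec_nonneg
    fun i => α (EuclideanSpace.single i 1)
  rw [traceWithRespectTo_mul]
  refine h.trans_eq ?_
  simp only [dotProduct, Matrix.mulVec, star_trivial]
  exact Finset.sum_congr rfl fun i _ => mul_comm _ _

variable {N : Type*} [TopologicalSpace N] [ChartedSpace (EuclideanSpace ℝ (Fin m)) N]
  {S : Type*} [TopologicalSpace S] [ChartedSpace (EuclideanSpace ℝ (Fin m)) S]

theorem riemannianMeasure_inducedMetric [IsManifold (𝓡 m) ∞ N] [MeasurableSpace S]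
    (gN : Bundle.ContMDiffRiemannianMetric (𝓡 m) ∞ (EuclideanSpace ℝ (Fin m))
      (fun y : N => TangentSpace (𝓡 m) y)) {h k : ℝ → ℝ} {F : S → N × ℝ}
    (hhk : ∀ s, h (F s).2 = k (F s).2) :
    riemannianMeasure (inducedMetric ((𝓡 m).prod 𝓘(ℝ, ℝ)) m
      (warpedMetric gN.toRiemannianMetric h) F) =
      riemannianMeasure fun s v w => inducedForm (metricForm gN.toRiemannianMetric) k F s v w := by
  congr 1
  funext s v w
  exact inducedMetric_warpedMetric _ (hhk s) v w

/-- The differential of a function, as a linear form on the model space. -/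
def differentialForm (m : ℕ) {S : Type*} [TopologicalSpace S]
    [ChartedSpace (EuclideanSpace ℝ (Fin m)) S] (w : S → ℝ) (s : S) :
    EuclideanSpace ℝ (Fin m) →L[ℝ] ℝ :=
  mfderiv (𝓡 m) 𝓘(ℝ, ℝ) w s

variable [IsManifold (𝓡 m) ∞ S]

theorem fderiv_comp_extChartAt_symm {w : S → ℝ} {s : S} {x : EuclideanSpace ℝ (Fin m)}
    (hx : x ∈ (extChartAt (𝓡 m) s).target)
    (hw : MDifferentiableAt (𝓡 m) 𝓘(ℝ, ℝ) w ((extChartAt (𝓡 m) s).symm x)) :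
    fderiv ℝ (fun y => w ((extChartAt (𝓡 m) s).symm y)) x =
      (differentialForm m w ((extChartAt (𝓡 m) s).symm x)).comp
        (mfderiv 𝓘(ℝ, EuclideanSpace ℝ (Fin m)) (𝓡 m) (extChartAt (𝓡 m) s).symm x :
          EuclideanSpace ℝ (Fin m) →L[ℝ] EuclideanSpace ℝ (Fin m)) := by
  have h := mfderiv_comp x hw (mdifferentiableAt_extChartAt_symm hx)
  rw [← mfderiv_eq_fderiv]
  exact h

variable [IsManifold (𝓡 m) ∞ N]
  (gN : Bundle.ContMDiffRiemannianMetric (𝓡 m) ∞ (EuclideanSpace ℝ (Fin m))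
    (fun y : N => TangentSpace (𝓡 m) y)) {rbar : EReal} {h k : ℝ → ℝ} {F : S → N × ℝ}

/-- The function `(n - 1) k' - H ⟨X, ν⟩`, which is the divergence of `X^T`. -/
def tangentialDivergence (gN : Bundle.RiemannianMetric (fun y : N => TangentSpace (𝓡 m) y))
    (rbar : EReal) (h k : ℝ → ℝ) (F : S → N × ℝ)
    (ν : ∀ s : S, TangentSpace ((𝓡 m).prod 𝓘(ℝ, ℝ)) (F s)) (s : S) : ℝ :=
  m * deriv k (F s).2 -
    meanCurvature ((𝓡 m).prod 𝓘(ℝ, ℝ)) m (warpedMetric gN h) (warpedDomain N rbar) F ν s *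
      (k (F s).2 * (ν s).2)

/-- The divergence of `w X^T`. -/
def weightedDivergence (gN : Bundle.RiemannianMetric (fun y : N => TangentSpace (𝓡 m) y))
    (rbar : EReal) (h k : ℝ → ℝ) (F : S → N × ℝ)
    (ν : ∀ s : S, TangentSpace ((𝓡 m).prod 𝓘(ℝ, ℝ)) (F s)) (w : S → ℝ) (s : S) : ℝ :=
  w s * tangentialDivergence gN rbar h k F ν s +
    traceWithRespectTo (fun v u => inducedForm (metricForm gN) k F s v u)
      (fun v u => differentialForm m w s v *
        (k (F s).2 * differentialForm m (fun s => (F s).2) s u))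

/-- Product rule div(w X^T) = w div X^T + ⟨∇w, X^T⟩ multiplied by the density, which is the
hypothesis on D in `integral_divergence_eq_zero`. -/
theorem sqrt_det_mul_weightedDivergence (hr : 0 < rbar)
    (hhk : Set.EqOn h k (radialInterval rbar))
    (hmem : ∀ s, (F s).2 ∈ radialInterval rbar) (hk : ∀ s, ContDiffAt ℝ 1 k (F s).2)
    (hkpos : ∀ s, 0 < k (F s).2) (hF : ContMDiff (𝓡 m) ((𝓡 m).prod 𝓘(ℝ, ℝ)) ∞ F)
    (hFi : ∀ s, Function.Injective (mfderiv (𝓡 m) ((𝓡 m).prod 𝓘(ℝ, ℝ)) F s))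
    {ν : ∀ s : S, TangentSpace ((𝓡 m).prod 𝓘(ℝ, ℝ)) (F s)}
    (hν : IsUnitNormal ((𝓡 m).prod 𝓘(ℝ, ℝ)) m (warpedMetric gN.toRiemannianMetric h) F ν)
    {w : S → ℝ} (hw : ContMDiff (𝓡 m) 𝓘(ℝ, ℝ) 1 w) (s : S) {x : EuclideanSpace ℝ (Fin m)}
    (hx : x ∈ (extChartAt (𝓡 m) s).target) :
    √(chartGram (inducedForm (metricForm gN.toRiemannianMetric) k F) s x).det *
        weightedDivergence gN.toRiemannianMetric rbar h k F ν w ((extChartAt (𝓡 m) s).symm x) =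
      ∑ i, fderiv ℝ (fun x => w ((extChartAt (𝓡 m) s).symm x) *
        radialDensity (inducedForm (metricForm gN.toRiemannianMetric) k F) k F s i x) x
          (EuclideanSpace.single i 1) := by
  set P := inducedForm (metricForm gN.toRiemannianMetric) k F with hP
  have hnhds := (isOpen_extChartAt_target (I := 𝓡 m) s).mem_nhds hx
  have hw1 := ((contDiffOn_comp_extChartAt_symm hw s).contDiffAt hnhds).differentiableAt
    one_ne_zero
  have hV : ∀ i, DifferentiableAt ℝ (radialDensity P k F s i) x := fun i =>
    ((contDiffOn_radialDensity gN hk hkpos hF hFi s i).contDiffAt hnhds).differentiableAt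
      one_ne_zero
  have hdiv := sum_fderiv_radialDensity gN hr hhk hmem hk hkpos hF hFi hν hx
  rw [← hP] at hdiv
  have hprod : ∀ i, fderiv ℝ (fun x => w ((extChartAt (𝓡 m) s).symm x) *
      radialDensity P k F s i x) x (EuclideanSpace.single i 1) =
      w ((extChartAt (𝓡 m) s).symm x) *
        fderiv ℝ (radialDensity P k F s i) x (EuclideanSpace.single i 1) +
      radialDensity P k F s i x * fderiv ℝ (fun x => w ((extChartAt (𝓡 m) s).symm x)) x
        (EuclideanSpace.single i 1) := by
    intro i
    rw [fderiv_fun_mul hw1 (hV i)]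
    simp
  set t := (extChartAt (𝓡 m) s).symm x with ht
  obtain ⟨A, hA⟩ : ∃ A : EuclideanSpace ℝ (Fin m) →L[ℝ] EuclideanSpace ℝ (Fin m),
    A = mfderiv 𝓘(ℝ, EuclideanSpace ℝ (Fin m)) (𝓡 m) (extChartAt (𝓡 m) s).symm x := ⟨_, rfl⟩
  have hAdet : A.det ≠ 0 := hA ▸ det_mfderiv_extChartAt_symm_ne_zero hx
  have hρ : ContMDiff (𝓡 m) 𝓘(ℝ, ℝ) ∞ fun s => (F s).2 := hF.snd
  have hwA : fderiv ℝ (fun y => w ((extChartAt (𝓡 m) s).symm y)) x =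
      (differentialForm m w t).comp A := by
    rw [hA]
    exact fderiv_comp_extChartAt_symm hx (hw.mdifferentiable one_ne_zero _)
  have hρA : fderiv ℝ (localRadius m F s) x = (differentialForm m (fun s => (F s).2) t).comp A := by
    rw [hA]
    exact fderiv_comp_extChartAt_symm hx (hρ.mdifferentiable (by simp) _)
  -- The gradient term is defined in the chart around t; invariance of the trace carries it to the
  -- chart around s.
  have htr := traceWithRespectTo_comp (P t) ((ContinuousLinearMap.mul ℝ ℝ).bilinearComp
    (differentialForm m w t) (k (F t).2 • differentialForm m (fun s => (F s).2) t)) hAdet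
  have hPA : (fun v u => P t (A v) (A u)) = fun v u => chartForm P s x v u := by
    rw [hA]
    rfl
  simp only [ContinuousLinearMap.bilinearComp_apply, ContinuousLinearMap.mul_apply',
    smul_apply, smul_eq_mul] at htr
  have htr' : traceWithRespectTo (fun v u => P t v u) (fun v u => differentialForm m w t v *
      (k (F t).2 * differentialForm m (fun s => (F s).2) t u)) =
      ∑ i, (∑ j, (chartGram P s x)⁻¹ i j * (k (localRadius m F s x) *
        fderiv ℝ (localRadius m F s) x (EuclideanSpace.single j 1))) *
          fderiv ℝ (fun y => w ((extChartAt (𝓡 m) s).symm y)) x (EuclideanSpace.single i 1) := by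
    rw [← htr, hPA, traceWithRespectTo_mul (fun v u => chartForm P s x v u)
      (fun v => differentialForm m w t (A v))
      (fun v => k (F t).2 * differentialForm m (fun s => (F s).2) t (A v)), hwA, hρA]
    rfl
  simp only [hprod, Finset.sum_add_distrib, ← Finset.mul_sum, hdiv]
  rw [weightedDivergence, ← hP, htr', mul_add, tangentialDivergence]
  congr 1
  · ring
  · rw [Finset.mul_sum]
    refine Finset.sum_congr rfl fun i _ => ?_
    rw [radialDensity, mul_assoc]

variable [CompactSpace S] [MeasurableSpace S] [BorelSpace S]

theorem isFiniteMeasure_riemannianMeasure_inducedForm (hk : ∀ s, ContDiffAt ℝ 1 k (F s).2)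
    (hF : ContMDiff (𝓡 m) ((𝓡 m).prod 𝓘(ℝ, ℝ)) ∞ F) :
    IsFiniteMeasure (riemannianMeasure fun (s : S) v w =>
      inducedForm (metricForm gN.toRiemannianMetric) k F s v w) :=
  isFiniteMeasure_riemannianMeasure fun _ i j _ hx =>
    (contDiffAt_chartGram_inducedForm gN hk hF hx i j).continuousAt.continuousWithinAt

variable [T2Space S]

theorem integral_weightedDivergence_eq_zero (hr : 0 < rbar)
    (hhk : Set.EqOn h k (radialInterval rbar))
    (hmem : ∀ s, (F s).2 ∈ radialInterval rbar) (hk : ∀ s, ContDiffAt ℝ 1 k (F s).2)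
    (hkpos : ∀ s, 0 < k (F s).2) (hF : ContMDiff (𝓡 m) ((𝓡 m).prod 𝓘(ℝ, ℝ)) ∞ F)
    (hFi : ∀ s, Function.Injective (mfderiv (𝓡 m) ((𝓡 m).prod 𝓘(ℝ, ℝ)) F s))
    {ν : ∀ s : S, TangentSpace ((𝓡 m).prod 𝓘(ℝ, ℝ)) (F s)}
    (hν : IsUnitNormal ((𝓡 m).prod 𝓘(ℝ, ℝ)) m (warpedMetric gN.toRiemannianMetric h) F ν)
    {w : S → ℝ} (hw : ContMDiff (𝓡 m) 𝓘(ℝ, ℝ) 1 w) :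
    Continuous (weightedDivergence gN.toRiemannianMetric rbar h k F ν w) ∧
      ∫ s, weightedDivergence gN.toRiemannianMetric rbar h k F ν w s
        ∂(riemannianMeasure fun s v w =>
          inducedForm (metricForm gN.toRiemannianMetric) k F s v w) = 0 :=
  integral_divergence_eq_zero
    (fun _ i j _ hx =>
      (contDiffAt_chartGram_inducedForm gN hk hF hx i j).continuousAt.continuousWithinAt)
    (fun _ _ hx => (chartGram_inducedForm_posDef gN hkpos hFi hx).det_pos)
    (contDiffOn_radialDensity gN hk hkpos hF hFi)
    (fun _ hw s _ hx =>
      sqrt_det_mul_weightedDivergence gN hr hhk hmem hk hkpos hF hFi hν hw s hx) hw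

theorem integral_tangentialDivergence_eq_zero (hr : 0 < rbar)
    (hhk : Set.EqOn h k (radialInterval rbar))
    (hmem : ∀ s, (F s).2 ∈ radialInterval rbar) (hk : ∀ s, ContDiffAt ℝ 1 k (F s).2)
    (hkpos : ∀ s, 0 < k (F s).2) (hF : ContMDiff (𝓡 m) ((𝓡 m).prod 𝓘(ℝ, ℝ)) ∞ F)
    (hFi : ∀ s, Function.Injective (mfderiv (𝓡 m) ((𝓡 m).prod 𝓘(ℝ, ℝ)) F s))
    {ν : ∀ s : S, TangentSpace ((𝓡 m).prod 𝓘(ℝ, ℝ)) (F s)}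
    (hν : IsUnitNormal ((𝓡 m).prod 𝓘(ℝ, ℝ)) m (warpedMetric gN.toRiemannianMetric h) F ν) :
    Continuous (tangentialDivergence gN.toRiemannianMetric rbar h k F ν) ∧
      ∫ s, tangentialDivergence gN.toRiemannianMetric rbar h k F ν s
        ∂(riemannianMeasure fun s v w =>
          inducedForm (metricForm gN.toRiemannianMetric) k F s v w) = 0 := by
  have hone : weightedDivergence gN.toRiemannianMetric rbar h k F ν (fun _ => 1) =
      tangentialDivergence gN.toRiemannianMetric rbar h k F ν := by
    funext s
    have h0 : differentialForm m (fun _ : S => (1 : ℝ)) s = 0 := mfderiv_const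
    rw [weightedDivergence, h0, one_mul, add_eq_left, traceWithRespectTo_mul]
    simp
  rw [← hone]
  exact integral_weightedDivergence_eq_zero gN hr hhk hmem hk hkpos hF hFi hν contMDiff_const

/-- With w = φ(r) the gradient term is φ'(r) k(r) |∇r|² ≤ 0. So φ div X^T dominates div(φ X^T)
pointwise, and the latter has integral zero. -/
theorem integral_mul_tangentialDivergence_nonneg (hr : 0 < rbar)
    (hhk : Set.EqOn h k (radialInterval rbar))
    (hmem : ∀ s, (F s).2 ∈ radialInterval rbar) (hk : ∀ s, ContDiffAt ℝ 1 k (F s).2)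
    (hkpos : ∀ s, 0 < k (F s).2) (hF : ContMDiff (𝓡 m) ((𝓡 m).prod 𝓘(ℝ, ℝ)) ∞ F)
    (hFi : ∀ s, Function.Injective (mfderiv (𝓡 m) ((𝓡 m).prod 𝓘(ℝ, ℝ)) F s))
    {ν : ∀ s : S, TangentSpace ((𝓡 m).prod 𝓘(ℝ, ℝ)) (F s)}
    (hν : IsUnitNormal ((𝓡 m).prod 𝓘(ℝ, ℝ)) m (warpedMetric gN.toRiemannianMetric h) F ν)
    {φ : ℝ → ℝ} (hφ : ∀ s, ContDiffAt ℝ 1 φ (F s).2) (hφ' : ∀ s, deriv φ (F s).2 ≤ 0) :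
    0 ≤ ∫ s, φ (F s).2 * tangentialDivergence gN.toRiemannianMetric rbar h k F ν s
      ∂(riemannianMeasure fun s v w =>
        inducedForm (metricForm gN.toRiemannianMetric) k F s v w) := by
  have hρ : ContMDiff (𝓡 m) 𝓘(ℝ, ℝ) ∞ fun s => (F s).2 := hF.snd
  have hρ1 : ContMDiff (𝓡 m) 𝓘(ℝ, ℝ) 1 fun s => (F s).2 := hρ.of_le (by simp)
  have hw : ContMDiff (𝓡 m) 𝓘(ℝ, ℝ) 1 fun s => φ (F s).2 := fun s =>
    (hφ s).contMDiffAt.comp s (hρ1 s)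
  have hfin := isFiniteMeasure_riemannianMeasure_inducedForm gN hk hF
  obtain ⟨hc, hi⟩ := integral_weightedDivergence_eq_zero gN hr hhk hmem hk hkpos hF hFi hν hw
  obtain ⟨hc1, -⟩ := integral_tangentialDivergence_eq_zero gN hr hhk hmem hk hkpos hF hFi hν
  rw [← hi]
  refine integral_mono (hc.integrable_of_hasCompactSupport (HasCompactSupport.of_compactSpace _))
    ((hw.continuous.mul hc1).integrable_of_hasCompactSupport
      (HasCompactSupport.of_compactSpace _)) fun s => ?_
  have hd : ∀ v, differentialForm m (fun s => φ (F s).2) s v =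
      deriv φ (F s).2 * differentialForm m (fun s => (F s).2) s v := by
    intro v
    have h1 := mfderiv_comp (I' := 𝓘(ℝ, ℝ)) s
      ((hφ s).differentiableAt one_ne_zero).mdifferentiableAt (hρ.mdifferentiable (by simp) s)
    rw [mfderiv_eq_fderiv] at h1
    refine (congrArg (fun A => A v) h1).trans ?_
    refine (fderiv_eq_smul_deriv (f := φ) (x := (F s).2) _).trans ?_
    exact mul_comm _ _
  have htr := traceWithRespectTo_mul_self_nonneg (Q := inducedForm
    (metricForm gN.toRiemannianMetric) k F s)
    (inducedForm_symm (metricForm_symm gN.toRiemannianMetric))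
    (fun v hv => inducedForm_pos (metricForm_pos gN.toRiemannianMetric) (hkpos s) (hFi s) hv)
    (differentialForm m (fun s => (F s).2) s)
  rw [traceWithRespectTo_mul] at htr
  have hle := mul_nonpos_of_nonpos_of_nonneg
    (mul_nonpos_of_nonpos_of_nonneg (hφ' s) (hkpos s).le) htr
  rw [weightedDivergence, traceWithRespectTo_mul]
  refine add_le_of_nonpos_right (hle.trans_eq' ?_)
  rw [Finset.mul_sum]
  refine Finset.sum_congr rfl fun i _ => ?_
  rw [hd, Finset.sum_mul, Finset.sum_mul, Finset.mul_sum]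
  refine Finset.sum_congr rfl fun j _ => ?_
  ring

end WeightedDivergence

/-! ### Extension of the warping function across r = 0 -/

section EvenExtension

variable {rbar : EReal} {h : ℝ → ℝ}

theorem isOpen_setOf_coe_lt (rbar : EReal) : IsOpen {r : ℝ | (r : EReal) < rbar} :=
  isOpen_lt continuous_coe_real_ereal continuous_const

theorem radialInterval_mem_nhds {r : ℝ} (h0 : 0 < r) (h1 : (r : EReal) < rbar) :
    radialInterval rbar ∈ nhds r :=
  Filter.inter_mem (Ici_mem_nhds h0) ((isOpen_setOf_coe_lt rbar).mem_nhds h1)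

theorem max_zero_mem_radialInterval (hr : 0 < rbar) {r : ℝ} (h1 : (r : EReal) < rbar) :
    max r 0 ∈ radialInterval rbar := by
  refine ⟨le_max_right _ _, ?_⟩
  rcases max_choice r 0 with h | h <;> rw [h]
  · exact h1
  · exact_mod_cast hr

/-- At 0 the left derivative of the constant extension is 0, which equals the right derivative
because h'(0) = 0. -/
theorem hasDerivAt_comp_max_zero (hr : 0 < rbar) (hh : ContDiffOn ℝ ∞ h (radialInterval rbar))
    (h0 : radialDeriv rbar h 0 = 0) {r : ℝ} (h1 : (r : EReal) < rbar) :
    HasDerivAt (fun r => h (max r 0)) (radialDeriv rbar h (max r 0)) r := by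
  have hd : HasDerivWithinAt h (radialDeriv rbar h (max r 0)) (radialInterval rbar) (max r 0) :=
    ((hh.differentiableOn (by simp)) _ (max_zero_mem_radialInterval hr h1)).hasDerivWithinAt
  rcases lt_trichotomy r 0 with h2 | h2 | h2
  · rw [max_eq_right h2.le, h0]
    refine (hasDerivAt_const r (h 0)).congr_of_eventuallyEq ?_
    filter_upwards [Iio_mem_nhds h2] with y hy
    rw [max_eq_right (le_of_lt hy)]
  · subst h2
    rw [max_self] at hd ⊢
    have hnhds : radialInterval rbar ∈ nhdsWithin 0 (Set.Ici 0) :=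
      Filter.inter_mem self_mem_nhdsWithin
        (mem_nhdsWithin_of_mem_nhds ((isOpen_setOf_coe_lt rbar).mem_nhds h1))
    have hright : HasDerivWithinAt (fun r => h (max r 0)) (radialDeriv rbar h 0) (Set.Ici 0) 0 :=
      (hd.mono_of_mem_nhdsWithin hnhds).congr (fun y hy => by rw [max_eq_left hy])
        (by rw [max_self])
    have hleft : HasDerivWithinAt (fun r => h (max r 0)) (radialDeriv rbar h 0) (Set.Iic 0) 0 := by
      rw [h0]
      exact (hasDerivWithinAt_const (0 : ℝ) _ (h 0)).congr
        (fun y hy => by rw [max_eq_right hy]) (by rw [max_self])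
    have := hleft.union hright
    rwa [Set.Iic_union_Ici, hasDerivWithinAt_univ] at this
  · rw [max_eq_left h2.le] at hd ⊢
    refine (hd.hasDerivAt (radialInterval_mem_nhds h2 h1)).congr_of_eventuallyEq ?_
    filter_upwards [Ioi_mem_nhds h2] with y hy
    rw [max_eq_left (le_of_lt hy)]

theorem continuousOn_radialDeriv (hr : 0 < rbar) (hh : ContDiffOn ℝ ∞ h (radialInterval rbar)) :
    ContinuousOn (radialDeriv rbar h) (radialInterval rbar) :=
  hh.continuousOn_derivWithin (uniqueDiffOn_radialInterval hr) (by simp)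

theorem contDiffAt_comp_max_zero (hr : 0 < rbar) (hh : ContDiffOn ℝ ∞ h (radialInterval rbar))
    (h0 : radialDeriv rbar h 0 = 0) {r : ℝ} (h1 : (r : EReal) < rbar) :
    ContDiffAt ℝ 1 (fun r => h (max r 0)) r := by
  have ho := isOpen_setOf_coe_lt rbar
  have hd : ∀ y ∈ {r : ℝ | (r : EReal) < rbar}, HasDerivAt (fun r => h (max r 0))
      (radialDeriv rbar h (max y 0)) y := fun y hy => hasDerivAt_comp_max_zero hr hh h0 hy
  refine ContDiffOn.contDiffAt (s := {r : ℝ | (r : EReal) < rbar}) ?_ (ho.mem_nhds h1)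
  refine (contDiffOn_succ_iff_deriv_of_isOpen (n := 0) ho).mpr
    ⟨fun y hy => (hd y hy).differentiableAt.differentiableWithinAt, by simp, ?_⟩
  refine contDiffOn_zero.mpr (ContinuousOn.congr ?_ fun y hy => (hd y hy).deriv)
  exact (continuousOn_radialDeriv hr hh).comp (continuous_id.max continuous_const).continuousOn
    fun y hy => max_zero_mem_radialInterval hr hy

theorem contDiffAt_radialDeriv (hr : 0 < rbar) (hh : ContDiffOn ℝ ∞ h (radialInterval rbar))
    {r : ℝ} (h0 : 0 < r) (h1 : (r : EReal) < rbar) : ContDiffAt ℝ 1 (radialDeriv rbar h) r :=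
  (hh.derivWithin (m := 1) (uniqueDiffOn_radialInterval hr) (by norm_cast)).contDiffAt
    (radialInterval_mem_nhds h0 h1)

end EvenExtension

/-! ### The integral identity and the inequality -/

theorem proposition2p3 (n : ℕ) (hn : 3 ≤ n)
    -- the compact Riemannian manifold `(N, g_N)` of dimension `n - 1`
    {N : Type*} [TopologicalSpace N] [T2Space N] [CompactSpace N]
    [ChartedSpace (EuclideanSpace ℝ (Fin (n - 1))) N] [IsManifold (𝓡 (n - 1)) ∞ N]
    (gN : Bundle.ContMDiffRiemannianMetric (𝓡 (n - 1)) ∞ (EuclideanSpace ℝ (Fin (n - 1)))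
      (fun y : N => TangentSpace (𝓡 (n - 1)) y))
    -- the warping function `h : [0, rbar) → ℝ`, and conditions (H1) and (H2)
    (rbar : EReal) (hrbar : 0 < rbar) (h : ℝ → ℝ)
    (h_smooth : ContDiffOn ℝ ∞ h (radialInterval rbar))
    (h_pos : ∀ r ∈ radialInterval rbar, 0 < h r)
    (H1 : radialDeriv rbar h 0 = 0 ∧ 0 < radialDeriv rbar (radialDeriv rbar h) 0)
    (H2 : ∀ r ∈ radialInterval rbar, 0 < r → 0 < radialDeriv rbar h r)
    -- the closed hypersurface, given by an immersion `F`, and its unit normal `ν`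
    {S : Type*} [TopologicalSpace S] [T2Space S] [CompactSpace S]
    [ChartedSpace (EuclideanSpace ℝ (Fin (n - 1))) S] [IsManifold (𝓡 (n - 1)) ∞ S]
    [MeasurableSpace S] [BorelSpace S]
    (F : S → N × ℝ) (F_smooth : ContMDiff (𝓡 (n - 1)) ((𝓡 (n - 1)).prod 𝓘(ℝ, ℝ)) ∞ F)
    (F_immersion : ∀ s : S,
      Function.Injective (mfderiv (𝓡 (n - 1)) ((𝓡 (n - 1)).prod 𝓘(ℝ, ℝ)) F s))
    (F_mem : ∀ s : S, F s ∈ warpedDomain N rbar)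
    (ν : ∀ s : S, TangentSpace ((𝓡 (n - 1)).prod 𝓘(ℝ, ℝ)) (F s))
    (hν : IsUnitNormal ((𝓡 (n - 1)).prod 𝓘(ℝ, ℝ)) (n - 1) (warpedMetric gN.toRiemannianMetric h) F ν) :
    let I := (𝓡 (n - 1)).prod 𝓘(ℝ, ℝ)
    let g := warpedMetric gN.toRiemannianMetric h
    let f : N × ℝ → ℝ := fun p => radialDeriv rbar h p.2
    let μ : Measure S := riemannianMeasure (inducedMetric I (n - 1) g F)
    let H : S → ℝ := meanCurvature I (n - 1) g (warpedDomain N rbar) F ν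
    let Xν : S → ℝ := fun s => g (F s) (radialField h (F s)) (ν s)
    (μ Set.univ < ⊤ ∧ Integrable (fun s => H s * Xν s) μ ∧ Integrable (fun s => f (F s)) μ ∧
      ∫ s, H s * Xν s ∂μ = ((n : ℝ) - 1) * ∫ s, f (F s) ∂μ) ∧
    ∀ r₁ : ℝ, 0 < r₁ → (r₁ : EReal) < rbar →
      (∀ r ∈ Set.Icc 0 r₁, 0 < radialDeriv rbar (radialDeriv rbar h) r) →
      (∀ s : S, (F s).2 ∈ Set.Ioo 0 r₁) →
      Integrable (fun s => H s / f (F s) * Xν s) μ ∧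
        ∫ s, H s / f (F s) * Xν s ∂μ ≤ ((n : ℝ) - 1) * μ.real Set.univ := by
  intro I g f μ H Xν
  -- The extension to negative r makes two-sided calculus available where Σ meets r = 0. It is only
  -- C¹ there, since h''(0) > 0.
  set k : ℝ → ℝ := fun r => h (max r 0) with hkdef
  have hk0 : ∀ s, 0 ≤ (F s).2 := fun s => (F_mem s).1
  have hhk : Set.EqOn h k (radialInterval rbar) := fun r hr => by
    simp only [hkdef, max_eq_left hr.1]
  have hk : ∀ s, ContDiffAt ℝ 1 k (F s).2 := fun s =>
    contDiffAt_comp_max_zero hrbar h_smooth H1.1 (F_mem s).2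
  have hkpos : ∀ s, 0 < k (F s).2 := fun s => by
    rw [← hhk (F_mem s)]
    exact h_pos _ (F_mem s)
  have hdk : ∀ r : ℝ, (r : EReal) < rbar → deriv k r = radialDeriv rbar h (max r 0) :=
    fun r hr => (hasDerivAt_comp_max_zero hrbar h_smooth H1.1 hr).deriv
  have hcast : ((n - 1 : ℕ) : ℝ) = (n : ℝ) - 1 := by
    rw [Nat.cast_sub (by omega), Nat.cast_one]
  have hμ : μ = riemannianMeasure fun s v w =>
      inducedForm (metricForm gN.toRiemannianMetric) k F s v w :=
    riemannianMeasure_inducedMetric gN fun s => hhk (F_mem s)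
  have hfin : IsFiniteMeasure μ := by
    rw [hμ]
    exact isFiniteMeasure_riemannianMeasure_inducedForm gN hk F_smooth
  have hint : ∀ {u : S → ℝ}, Continuous u → Integrable u μ := fun hu =>
    hu.integrable_of_hasCompactSupport (HasCompactSupport.of_compactSpace _)
  have hρ : Continuous fun s => (F s).2 := F_smooth.continuous.snd
  have hf : Continuous fun s => f (F s) :=
    (continuousOn_radialDeriv hrbar h_smooth).comp_continuous hρ F_mem
  obtain ⟨hc, hi⟩ := integral_tangentialDivergence_eq_zero gN hrbar hhk F_mem hk hkpos F_smooth
    F_immersion hν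
  have hT : ∀ s, tangentialDivergence gN.toRiemannianMetric rbar h k F ν s =
      ((n : ℝ) - 1) * f (F s) - H s * Xν s := by
    intro s
    have h1 : Xν s = k (F s).2 * (ν s).2 := by
      rw [← hhk (F_mem s)]
      refine (warpedForm_apply (h (F s).2) (metricForm gN.toRiemannianMetric (F s).1)
        (0, h (F s).2) (ν s)).trans ?_
      simp
    rw [tangentialDivergence, hcast, hdk _ (F_mem s).2, max_eq_left (hk0 s), h1]
  rw [← hμ] at hi
  -- Continuity of ν is not needed: the product is unchanged under ν ↦ -ν, and its continuity
  -- follows from that of div X^T.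
  have hHX : Continuous fun s => H s * Xν s := by
    have h1 : (fun s => H s * Xν s) = fun s => ((n : ℝ) - 1) * f (F s) -
        tangentialDivergence gN.toRiemannianMetric rbar h k F ν s := by
      funext s
      rw [hT]
      ring
    rw [h1]
    exact (continuous_const.mul hf).sub hc
  refine ⟨⟨measure_lt_top μ _, hint hHX, hint hf, ?_⟩, ?_⟩
  · simp only [hT] at hi
    rw [integral_sub ((hint hf).const_mul _) (hint hHX), integral_const_mul] at hi
    linarith
  · intro r₁ hr₁ hr₁' hconv hF₁
    have hlt : ∀ s, ((F s).2 : EReal) < rbar := fun s => (F_mem s).2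
    have hfpos : ∀ s, 0 < f (F s) := fun s => H2 _ (F_mem s) (hF₁ s).1
    have hHf : Continuous fun s => H s / f (F s) * Xν s := by
      have h1 : (fun s => H s / f (F s) * Xν s) = fun s => H s * Xν s / f (F s) := by
        funext s
        ring
      rw [h1]
      exact hHX.div hf fun s => (hfpos s).ne'
    refine ⟨hint hHf, ?_⟩
    -- The weight 1/h' makes sense because Σ stays in r > 0; it is singular at r = 0, where h'
    -- vanishes.
    have hd : ∀ s, ContDiffAt ℝ 1 (radialDeriv rbar h) (F s).2 := fun s =>
      contDiffAt_radialDeriv hrbar h_smooth (hF₁ s).1 (hlt s)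
    -- The derivative is -h''/h'², and h'' > 0 on [0, r₁].
    have hφ' : ∀ s, deriv (fun r => (radialDeriv rbar h r)⁻¹) (F s).2 ≤ 0 := by
      intro s
      have h1 := hconv _ ⟨(hF₁ s).1.le, (hF₁ s).2.le⟩
      have h2 : deriv (radialDeriv rbar h) (F s).2 =
          radialDeriv rbar (radialDeriv rbar h) (F s).2 :=
        (derivWithin_of_mem_nhds (radialInterval_mem_nhds (hF₁ s).1 (hlt s))).symm
      rw [deriv_fun_inv'' ((hd s).differentiableAt one_ne_zero) (hfpos s).ne', h2]
      exact div_nonpos_of_nonpos_of_nonneg (neg_nonpos.mpr h1.le) (sq_nonneg _)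
    have h3 : ∀ s, (radialDeriv rbar h (F s).2)⁻¹ *
        tangentialDivergence gN.toRiemannianMetric rbar h k F ν s =
        ((n : ℝ) - 1) - H s / f (F s) * Xν s := by
      intro s
      have h4 : radialDeriv rbar h (F s).2 ≠ 0 := (hfpos s).ne'
      rw [hT]
      simp only [f]
      field_simp
    have hmain : 0 ≤ ∫ s, ((n : ℝ) - 1) - H s / f (F s) * Xν s ∂μ := by
      simp only [← h3]
      rw [hμ]
      exact integral_mul_tangentialDivergence_nonneg gN hrbar hhk F_mem hk hkpos F_smooth
        F_immersion hν (fun s => (hd s).inv (hfpos s).ne') hφ'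
    rw [integral_sub (integrable_const _) (hint hHf), integral_const, smul_eq_mul] at hmain
    linarith

end
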